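/- Let $N\ge 0$ and let $\psi^{(\alpha)}_j,\psi^{*(\alpha)}_j$ ($\alpha=1,\dots,N$, $j\in\mathbb Z$) be $N$-component free fermions, $[\psi^{(\alpha)}_j,\psi^{*(\beta)}_k]_+=\delta_{\alpha\beta}\delta_{jk}$, $[\psi^{(\alpha)}_j,\psi^{(\beta)}_k]_+=[\psi^{*(\alpha)}_j,\psi^{*(\beta)}_k]_+=0$, acting on the Fock space with vacuum $|\mathbf 0\rangle$ and dual vacuum $\langle\mathbf 0|$, where $\psi^{(\alpha)}_j|\mathbf 0\rangle=0$ and $\langle\mathbf 0|\psi^{*(\alpha)}_j=0$ for $j<0$, $\psi^{*(\alpha)}_j|\mathbf 0\rangle=0$ and $\langle\mathbf 0|\psi^{(\alpha)}_j=0$ for $j\ge 0$, $\langle\mathbf 0|\mathbf 0\rangle=1$. For $\mathbf s\in\mathbb Z^N$ put $|\mathbf s\rangle=\Psi^{*(N)}_{s_N}\cdots\Psi^{*(1)}_{s_1}|\mathbf 0\rangle$ and $\langle\mathbf s|=\langle\mathbf 0|\Psi^{(1)}_{s_1}\cdots\Psi^{(N)}_{s_N}$, where $\Psi^{*(\alpha)}_s=\psi^{(\alpha)}_{s-1}\cdots\psi^{(\alpha)}_0$,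 $\Psi^{(\alpha)}_s=\psi^{*(\alpha)}_0\cdots\psi^{*(\alpha)}_{s-1}$ for $s>0$, both are $1$ for $s=0$, and $\Psi^{*(\alpha)}_s=\psi^{*(\alpha)}_s\cdots\psi^{*(\alpha)}_{-1}$, $\Psi^{(\alpha)}_s=\psi^{(\alpha)}_{-1}\cdots\psi^{(\alpha)}_{s}$ for $s<0$. Let $J^{(\alpha)}_k=\sum_{j}{:}\psi^{(\alpha)}_j\psi^{*(\alpha)}_{j+k}{:}$, where ${:}\phi_1\phi_2{:}=\phi_1\phi_2-\langle\mathbf 0|\phi_1\phi_2|\mathbf 0\rangle$, and $$J(\mathbf t)=\sum_{\alpha}\sum_{k\ge1}t_{\alpha,k}J^{(\alpha)}_k,\qquad \bar J(\bar{\mathbf t})=\sum_{\alpha}\sum_{k\ge1}\bar t_{\alpha,k}J^{(\alpha)}_{-k}.$$ Let $$g=\exp\Big(\sum_{\alpha,\beta}\sum_{j,k\in\mathbb Z}A^{(\alpha\beta)}_{jk}\,\psi^{*(\alpha)}_j\psi^{(\beta)}_k\Big)$$ with an infinite complex matrix $A$ for which $g$ is well defined, i.e. for every $a$ in the algebra generated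 by the fermions and every Fock state $|v\rangle$ the matrix element $\langle\mathbf 0|a\,g|v\rangle$, with the exponential expanded as a sum over all finite sequences of pairs of modes (a sequence of length $n$ being weighted by $1/n!$ and the product of the entries of $A$), converges absolutely. Then the formal power series in the times $\mathbf t=(t_{\alpha,k})$, $\bar{\mathbf t}=(\bar t_{\alpha,k})$ $$\tau_{\alpha\beta}(\mathbf s,\mathbf t,\bar{\mathbf t})=(-1)^{|\mathbf s|(|\mathbf s|-1)/2}\,\langle\mathbf s+[1]_\alpha-[1]_\beta|\,e^{J(\mathbf t)}\,g\,e^{-\bar J(\bar{\mathbf t})}\,|\mathbf s\rangle,\qquad |\mathbf s|=\sum_\mu s_\mu ,$$ ($[1]_\alpha$ is the $\alpha$-th unit vector) are the tau-function of the $N$-component Toda lattice hierarchy, i.e. they satisfy, for all $\alpha,\beta\in\{1,\dots,N\}$ and $\mathbf s,\mathbf s'\in\mathbb Z^N$, identically in $\mathbf t,\bar{\mathbf t},\mathbf t',\bar{\mathbf t}'$, the integral bilinear equation $$\begin{aligned}&\sum_{\gamma=1}^N\epsilon_{\alpha\gamma}(\mathbf s)\,\epsilon^{-1}_{\beta\gamma}(\mathbf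 s')\oint_{C_\infty} z^{s_\gamma-s'_\gamma+\delta_{\alpha\gamma}+\delta_{\beta\gamma}-2}\,e^{\xi(\mathbf t_\gamma-\mathbf t'_\gamma,z)}\,\tau_{\alpha\gamma}(\mathbf s,\mathbf t-[z^{-1}]_\gamma,\bar{\mathbf t})\,\tau_{\gamma\beta}(\mathbf s',\mathbf t'+[z^{-1}]_\gamma,\bar{\mathbf t}')\,dz\\ =-&\sum_{\gamma=1}^N\epsilon_{\alpha\gamma}\,\epsilon_{\beta\gamma}\,\epsilon_{\alpha\gamma}(\mathbf s)\,\epsilon_{0N}(\mathbf s)\,\epsilon^{-1}_{\beta\gamma}(\mathbf s')\,\epsilon^{-1}_{0N}(\mathbf s')\oint_{C_\infty} z^{s'_\gamma-s_\gamma-2}\,e^{\xi(\bar{\mathbf t}_\gamma-\bar{\mathbf t}'_\gamma,z)}\\ &\qquad\times\tau_{\alpha\gamma}(\mathbf s+[1]_\gamma,\mathbf t,\bar{\mathbf t}-[z^{-1}]_\gamma)\,\tau_{\gamma\beta}(\mathbf s'-[1]_\gamma,\mathbf t',\bar{\mathbf t}'+[z^{-1}]_\gamma)\,dz .\end{aligned}$$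 Here $\xi(\mathbf t_\gamma,z)=\sum_{k\ge1}t_{\gamma,k}z^k$; $\mathbf t\pm[z^{-1}]_\gamma$ is $\mathbf t$ with $t_{\gamma,k}$ replaced by $t_{\gamma,k}\pm z^{-k}/k$ for all $k\ge1$; $\epsilon_{\alpha\gamma}=1$ and $\epsilon_{\alpha\gamma}(\mathbf s)=(-1)^{\sum_{\alpha<\mu\le\gamma}s_\mu}$ for $\alpha\le\gamma$, $\epsilon_{\alpha\gamma}=-1$ and $\epsilon_{\alpha\gamma}(\mathbf s)=-(-1)^{\sum_{\gamma<\mu\le\alpha}s_\mu}$ for $\alpha>\gamma$; $\epsilon_{0N}(\mathbf s)=(-1)^{|\mathbf s|}$. The integrands are formal power series in $\mathbf t,\bar{\mathbf t},\mathbf t',\bar{\mathbf t}'$ whose coefficients are Laurent series in $z^{-1}$, and $\oint_{C_\infty}(\cdot)\,dz$ is the residue: the coefficient of $z^{-1}$ of every coefficient. -/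

import Mathlib

open scoped BigOperators

noncomputable section

namespace MultiToda

/-! ### Generalities on formal power series in commuting variables -/

/-- The homogeneous linear series `∑ v, x_v * c v` in the formal variables `x_v`; the coefficient
ring may be noncommutative and the set of variables may be infinite. -/
def linSeries {σ R : Type*} [Semiring R] (c : σ → R) : MvPowerSeries σ R :=
  fun m => if m.degree = 1 then m.sum (fun v n => n • c v) else 0

/-- The formal exponential `∑ n, X ^ n / n!` of a series `X` without constant term: only the powers
`X ^ n` with `n ≤ degree m` contribute to the coefficient of the monomial `m`. -/
def expSeries {σ R : Type*} [Ring R] [Algebra ℂ R] (X : MvPowerSeries σ R) : MvPowerSeries σ R :=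
  fun m => ∑ n ∈ Finset.range (m.degree + 1),
    ((n.factorial : ℂ)⁻¹) • MvPowerSeries.coeff m (X ^ n)

/-! ### Multi-component fermions and the Fock space -/

/-- Labels `(α, j)` of the fermionic modes. -/
abbrev Mode (N : ℕ) : Type := Fin N × ℤ

/-- The fermionic Fock space: the exterior algebra on the creation operators (one generator for
each mode). The vacuum state is `1`. -/
abbrev Fock (N : ℕ) : Type := ExteriorAlgebra ℂ (Mode N →₀ ℂ)

/-- Creation: exterior multiplication by the basis vector of a mode. -/
def cre {N : ℕ} (i : Mode N) : Module.End ℂ (Fock N) :=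
  LinearMap.mulLeft ℂ (ExteriorAlgebra.ι ℂ (Finsupp.single i (1 : ℂ)))

/-- Annihilation: interior multiplication (contraction) by the dual basis vector of a mode. -/
def ann {N : ℕ} (i : Mode N) : Module.End ℂ (Fock N) :=
  CliffordAlgebra.contractLeft (Finsupp.lapply i)

/-- The fermion `ψ_j^{(α)}`: it is a creation operator exactly for `j ≥ 0`. -/
def psi {N : ℕ} (i : Mode N) : Module.End ℂ (Fock N) :=
  if 0 ≤ i.2 then cre i else ann i

/-- The fermion `ψ_j^{*(α)}`: it is a creation operator exactly for `j < 0`. -/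
def psiStar {N : ℕ} (i : Mode N) : Module.End ℂ (Fock N) :=
  if 0 ≤ i.2 then ann i else cre i

/-- The vacuum state `|0⟩`. -/
def vac (N : ℕ) : Fock N := 1

/-- The dual vacuum state `⟨0|`, as a linear functional on the Fock space (the projection onto the
degree zero part). -/
def dualVac (N : ℕ) : Module.Dual ℂ (Fock N) :=
  (ExteriorAlgebra.algebraMapInv : Fock N →ₐ[ℂ] ℂ).toLinearMap

section
variable {N : ℕ}

theorem cre_apply (i : Mode N) (x : Fock N) :
    cre i x = ExteriorAlgebra.ι ℂ (Finsupp.single i (1 : ℂ)) * x := rfl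

theorem cre_cre (i k : Mode N) (x : Fock N) : cre i (cre k x) = - cre k (cre i x) := by
  have h := ExteriorAlgebra.ι_add_mul_swap (R := ℂ)
    (Finsupp.single i (1 : ℂ)) (Finsupp.single k (1 : ℂ))
  simp only [cre_apply, ← mul_assoc]
  rw [eq_neg_of_add_eq_zero_left h, neg_mul]

theorem ann_ann (i k : Mode N) (x : Fock N) : ann i (ann k x) = - ann k (ann i x) :=
  CliffordAlgebra.contractLeft_comm _ _ x

theorem ann_cre (i k : Mode N) (x : Fock N) :
    ann i (cre k x) = (if k = i then x else 0) - cre k (ann i x) := by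
  have h := CliffordAlgebra.contractLeft_ι_mul (Q := (0 : QuadraticForm ℂ (Mode N →₀ ℂ)))
    (Finsupp.lapply i) (Finsupp.single k (1 : ℂ)) x
  refine h.trans ?_
  by_cases hk : k = i
  · subst hk; simp [cre_apply, ann, ExteriorAlgebra.ι]
  · simp [cre_apply, ann, ExteriorAlgebra.ι, hk]

theorem ann_vac (i : Mode N) : ann i (vac N) = 0 := by
  have h := CliffordAlgebra.contractLeft_one (0 : QuadraticForm ℂ (Mode N →₀ ℂ))
    (Finsupp.lapply i)
  exact h

theorem dualVac_cre (i : Mode N) (x : Fock N) : dualVac N (cre i x) = 0 := by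
  simp [dualVac, cre_apply, ExteriorAlgebra.algebraMapInv]

theorem dualVac_vac : dualVac N (vac N) = 1 := by simp [dualVac, vac]

/-- `[ψ_i, ψ*_k]₊ = δ_{ik}`. -/
theorem psi_psiStar_anticomm (i k : Mode N) :
    psi i * psiStar k + psiStar k * psi i = if i = k then 1 else 0 := by
  refine LinearMap.ext fun x => ?_
  by_cases hi : 0 ≤ i.2 <;> by_cases hk : 0 ≤ k.2
  · rcases eq_or_ne i k with h | h
    · subst h; simp [psi, psiStar, hi, ann_cre]
    · simp [psi, psiStar, hi, hk, ann_cre, h]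
  · have h : i ≠ k := by rintro rfl; exact hk hi
    simp [psi, psiStar, hi, hk, h, cre_cre i k]
  · have h : i ≠ k := by rintro rfl; exact hi hk
    simp [psi, psiStar, hi, hk, h, ann_ann i k]
  · rcases eq_or_ne i k with h | h
    · subst h; simp [psi, psiStar, hi, ann_cre]
    · simp [psi, psiStar, hi, hk, ann_cre, h, h.symm]

/-- `[ψ_i, ψ_k]₊ = 0`. -/
theorem psi_psi_anticomm (i k : Mode N) : psi i * psi k + psi k * psi i = 0 := by
  refine LinearMap.ext fun x => ?_
  by_cases hi : 0 ≤ i.2 <;> by_cases hk : 0 ≤ k.2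
  · simp [psi, hi, hk, cre_cre i k]
  · have h : i ≠ k := by rintro rfl; exact hk hi
    simp [psi, hi, hk, ann_cre, h]
  · have h : k ≠ i := by rintro rfl; exact hi hk
    simp [psi, hi, hk, ann_cre, h]
  · simp [psi, hi, hk, ann_ann i k]

/-- `[ψ*_i, ψ*_k]₊ = 0`. -/
theorem psiStar_psiStar_anticomm (i k : Mode N) :
    psiStar i * psiStar k + psiStar k * psiStar i = 0 := by
  refine LinearMap.ext fun x => ?_
  by_cases hi : 0 ≤ i.2 <;> by_cases hk : 0 ≤ k.2
  · simp [psiStar, hi, hk, ann_ann i k]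
  · have h : k ≠ i := by rintro rfl; exact hk hi
    simp [psiStar, hi, hk, ann_cre, h]
  · have h : i ≠ k := by rintro rfl; exact hi hk
    simp [psiStar, hi, hk, ann_cre, h]
  · simp [psiStar, hi, hk, cre_cre i k]

theorem psi_vac (i : Mode N) (hi : i.2 < 0) : psi i (vac N) = 0 := by
  simp [psi, not_le.2 hi, ann_vac]

theorem psiStar_vac (i : Mode N) (hi : 0 ≤ i.2) : psiStar i (vac N) = 0 := by
  simp [psiStar, hi, ann_vac]

theorem dualVac_psi (i : Mode N) (hi : 0 ≤ i.2) (x : Fock N) : dualVac N (psi i x) = 0 := by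
  simp [psi, hi, dualVac_cre]

theorem dualVac_psiStar (i : Mode N) (hi : i.2 < 0) (x : Fock N) :
    dualVac N (psiStar i x) = 0 := by
  simp [psiStar, not_le.2 hi, dualVac_cre]

end

/-- The vacuum expectation value `⟨a⟩ = ⟨0|a|0⟩`. -/
def vev {N : ℕ} (a : Module.End ℂ (Fock N)) : ℂ := dualVac N (a (vac N))

/-- The algebra of fermionic operators: the (faithful) action on the Fock space of the Clifford
algebra generated by the `ψ_j^{(α)}` and `ψ_j^{*(α)}`. -/
def fermionAlg (N : ℕ) : Subalgebra ℂ (Module.End ℂ (Fock N)) :=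
  Algebra.adjoin ℂ (Set.range psi ∪ Set.range psiStar)

/-! ### Charged vacua -/

/-- The operator `Ψ_s^{*(α)}`: it is `ψ_{s-1} ⋯ ψ_0` for `s > 0` and `ψ*_s ⋯ ψ*_{-1}` for
`s < 0`. -/
def chargeKet {N : ℕ} (α : Fin N) (s : ℤ) : Module.End ℂ (Fock N) :=
  if 0 ≤ s then ((List.range s.toNat).reverse.map fun n : ℕ => psi (α, (n : ℤ))).prod
  else ((List.range (-s).toNat).reverse.map fun n : ℕ => psiStar (α, -1 - (n : ℤ))).prod

/-- The operator `Ψ_s^{(α)}`: it is `ψ*_0 ⋯ ψ*_{s-1}` for `s > 0` and `ψ_{-1} ⋯ ψ_s` for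
`s < 0`. -/
def chargeBra {N : ℕ} (α : Fin N) (s : ℤ) : Module.End ℂ (Fock N) :=
  if 0 ≤ s then ((List.range s.toNat).map fun n : ℕ => psiStar (α, (n : ℤ))).prod
  else ((List.range (-s).toNat).map fun n : ℕ => psi (α, -1 - (n : ℤ))).prod

/-- The state `|s⟩ = Ψ*_{s_N} ⋯ Ψ*_{s_1} |0⟩`. -/
def ket {N : ℕ} (s : Fin N → ℤ) : Fock N :=
  ((List.finRange N).reverse.map fun α => chargeKet α (s α)).prod (vac N)

/-- The dual state `⟨s| = ⟨0| Ψ_{s_1} ⋯ Ψ_{s_N}`. -/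
def bra {N : ℕ} (s : Fin N → ℤ) : Module.Dual ℂ (Fock N) :=
  dualVac N ∘ₗ ((List.finRange N).map fun α => chargeBra α (s α)).prod

/-! ### Current operators -/

/-- The normal ordered product `:ψ_j^{(α)} ψ_{j+k}^{*(α)}:`. -/
def currentTerm {N : ℕ} (α : Fin N) (k j : ℤ) : Module.End ℂ (Fock N) :=
  psi (α, j) * psiStar (α, j + k) - vev (psi (α, j) * psiStar (α, j + k)) • 1

section
variable {N : ℕ}

theorem currentTerm_vac (α : Fin N) (k : ℤ) :
    {j | currentTerm α k j (vac N) ≠ 0}.Finite := by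
  refine (Set.finite_Icc (-|k|) |k|).subset ?_
  intro j hj
  by_contra hjk
  apply hj
  have hvv : dualVac N (vac N) = 1 := dualVac_vac
  by_cases h1 : 0 ≤ j + k
  · simp [currentTerm, vev, psiStar_vac (α, j + k) h1]
  · by_cases h2 : 0 ≤ j
    · exfalso
      apply hjk
      have := neg_abs_le k
      have := abs_nonneg k
      exact ⟨by omega, by omega⟩
    · have h := congrArg (fun f : Module.End ℂ (Fock N) => f (vac N))
        (psi_psiStar_anticomm (α, j) (α, j + k))
      simp only [LinearMap.add_apply, Module.End.mul_apply] at h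
      rw [psi_vac (α, j) (not_le.1 h2), map_zero, add_zero] at h
      simp only [currentTerm, vev, LinearMap.sub_apply, Module.End.mul_apply, LinearMap.smul_apply]
      rw [h]
      by_cases hk : ((α, j) : Mode N) = (α, j + k)
      · simp [hk, hvv]
      · simp [hk]

theorem currentTerm_cre (α : Fin N) (k : ℤ) (i : Mode N) (x : Fock N)
    (hx : {j | currentTerm α k j x ≠ 0}.Finite) :
    {j | currentTerm α k j (cre i x) ≠ 0}.Finite := by
  refine (hx.union (Set.toFinite {i.2, i.2 - k})).subset ?_
  intro j hj
  by_contra hjn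
  simp only [Set.mem_union, Set.mem_ofPred_eq, Set.mem_insert_iff, Set.mem_singleton_iff,
    not_or, not_not] at hjn
  obtain ⟨h0, h1, h2⟩ := hjn
  apply hj
  have n1 : ((α, j) : Mode N) ≠ i := by rintro rfl; exact h1 rfl
  have n2 : ((α, j + k) : Mode N) ≠ i := by rintro rfl; apply h2; simp
  have e1 : psi (α, j) (cre i (psiStar (α, j + k) x))
      = - cre i (psi (α, j) (psiStar (α, j + k) x)) := by
    by_cases h : 0 ≤ j
    · simpa [psi, h] using cre_cre (α, j) i _
    · simp [psi, h, ann_cre, n1.symm]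
  have e2 : psiStar (α, j + k) (cre i x) = - cre i (psiStar (α, j + k) x) := by
    by_cases h : 0 ≤ j + k
    · simp [psiStar, h, ann_cre, n2.symm]
    · simpa [psiStar, h] using cre_cre (α, j + k) i x
  have : currentTerm α k j (cre i x) = cre i (currentTerm α k j x) := by
    simp only [currentTerm, LinearMap.sub_apply, Module.End.mul_apply, LinearMap.smul_apply,
      Module.End.one_apply, map_sub, map_smul, e2, map_neg, e1, neg_neg]
  rw [this, h0, map_zero]

/-- On a given state only finitely many terms of the current `J_k^{(α)}` act nontrivially. -/
theorem currentTerm_finite (α : Fin N) (k : ℤ) (x : Fock N) :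
    (Function.support fun j => currentTerm α k j x).Finite := by
  have hadd : ∀ y z : Fock N, {j | currentTerm α k j y ≠ 0}.Finite →
      {j | currentTerm α k j z ≠ 0}.Finite → {j | currentTerm α k j (y + z) ≠ 0}.Finite := by
    intro y z hy hz
    refine (hy.union hz).subset ?_
    intro j hj
    by_contra hn
    simp only [Set.mem_union, Set.mem_ofPred_eq, not_or, not_not] at hn
    exact hj (by simp [map_add, hn.1, hn.2])
  have hsmul : ∀ (c : ℂ) (y : Fock N), {j | currentTerm α k j y ≠ 0}.Finite →
      {j | currentTerm α k j (c • y) ≠ 0}.Finite := by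
    intro c y hy
    refine hy.subset ?_
    intro j hj hn
    exact hj (by rw [map_smul, hn, smul_zero])
  change {j | currentTerm α k j x ≠ 0}.Finite
  induction x using CliffordAlgebra.left_induction with
  | algebraMap r =>
    rw [Algebra.algebraMap_eq_smul_one]
    exact hsmul r _ (currentTerm_vac α k)
  | add x y hx hy => exact hadd x y hx hy
  | ι_mul x m hx =>
    induction m using Finsupp.induction_linear with
    | zero => simp
    | add f g hf hg =>
      rw [map_add, add_mul]
      exact hadd _ _ hf hg
    | single i c =>
      have : (CliffordAlgebra.ι (0 : QuadraticForm ℂ (Mode N →₀ ℂ))) (Finsupp.single i c) * x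
          = c • cre i x := by
        rw [cre_apply, ExteriorAlgebra.ι, ← smul_mul_assoc, ← map_smul, Finsupp.smul_single,
          smul_eq_mul, mul_one]
      rw [this]
      exact hsmul c _ (currentTerm_cre α k i x hx)

end

/-- The current mode `J_k^{(α)} = ∑_j :ψ_j^{(α)} ψ_{j+k}^{*(α)}:` as an operator on the Fock
space. -/
def current {N : ℕ} (α : Fin N) (k : ℤ) : Module.End ℂ (Fock N) where
  toFun x := ∑ᶠ j : ℤ, currentTerm α k j x
  map_add' x y := by
    simp only [map_add]
    exact finsum_add_distrib (currentTerm_finite α k x) (currentTerm_finite α k y)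
  map_smul' c x := by
    simp only [map_smul, RingHom.id_apply]
    exact (smul_finsum c _).symm

/-! ### Evolution operators -/

/-- Labels `(α, k)`, `k ≥ 1`, of one infinite set of times. -/
abbrev TimeIdx (N : ℕ) : Type := Fin N × ℕ+

/-- `e^{J(t)}` with `J(t) = ∑_α ∑_{k ≥ 1} t_{α,k} J_k^{(α)}`, as a formal power series in `t` with
operator coefficients. -/
def expJ (N : ℕ) : MvPowerSeries (TimeIdx N) (Module.End ℂ (Fock N)) :=
  expSeries (linSeries fun p => current p.1 (p.2 : ℤ))

/-- `e^{-J̄(t̄)}` with `J̄(t̄) = ∑_α ∑_{k ≥ 1} t̄_{α,k} J_{-k}^{(α)}`, as a formal power series in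
`t̄` with operator coefficients. -/
def expNegJbar (N : ℕ) : MvPowerSeries (TimeIdx N) (Module.End ℂ (Fock N)) :=
  expSeries (-(linSeries fun p => current p.1 (-(p.2 : ℤ))))

/-! ### Clifford group elements -/

/-- The summand of `exp (∑ A_{jk}^{(αβ)} ψ_j^{*(α)} ψ_k^{(β)})` which belongs to a finite word of
pairs of modes, without its operator part: `(1/n!) A_{i₁k₁} ⋯ A_{iₙkₙ}`. -/
def wordCoeff {N : ℕ} (A : Mode N → Mode N → ℂ) (w : List (Mode N × Mode N)) : ℂ :=
  ((w.length.factorial : ℂ)⁻¹) * (w.map fun p => A p.1 p.2).prod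

/-- The operator part `ψ*_{i₁} ψ_{k₁} ⋯ ψ*_{iₙ} ψ_{kₙ}` of that summand. -/
def wordOp {N : ℕ} (w : List (Mode N × Mode N)) : Module.End ℂ (Fock N) :=
  (w.map fun p => psiStar p.1 * psi p.2).prod

/-- The element `g = exp (∑ A_{jk}^{(αβ)} ψ_j^{*(α)} ψ_k^{(β)})` is well defined: all its matrix
elements `⟨0|a g|v⟩` between a dual state `⟨0|a` and a state `|v⟩` are (unconditionally, hence
absolutely) convergent when the exponential is expanded. -/
def WellDefined {N : ℕ} (A : Mode N → Mode N → ℂ) : Prop :=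
  ∀ a ∈ fermionAlg N, ∀ v : Fock N,
    Summable fun w : List (Mode N × Mode N) => wordCoeff A w * dualVac N (a (wordOp w v))

/-- The matrix element `⟨φ| g |v⟩` of
`g = exp (∑ A_{jk}^{(αβ)} ψ_j^{*(α)} ψ_k^{(β)})`. -/
def gElem {N : ℕ} (A : Mode N → Mode N → ℂ) (φ : Module.Dual ℂ (Fock N)) (v : Fock N) : ℂ :=
  ∑' w : List (Mode N × Mode N), wordCoeff A w * φ (wordOp w v)

/-! ### The fermionic tau-function -/

/-- Variables of a tau-function: the times `t` (left summand) and `t̄` (right summand). -/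
abbrev TauVar (N : ℕ) : Type := TimeIdx N ⊕ TimeIdx N

/-- The expectation value `τ(s, s̄, t, t̄; g) = ⟨s| e^{J(t)} g e^{-J̄(t̄)} |s̄⟩`, as a formal power
series in `t` and `t̄`. -/
def tauExp {N : ℕ} (A : Mode N → Mode N → ℂ) (s sbar : Fin N → ℤ) :
    MvPowerSeries (TauVar N) ℂ :=
  fun m => gElem A
    (bra s ∘ₗ MvPowerSeries.coeff (m.comapDomain Sum.inl Sum.inl_injective.injOn) (expJ N))
    (MvPowerSeries.coeff (m.comapDomain Sum.inr Sum.inr_injective.injOn) (expNegJbar N) (ket sbar))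

/-- The vector `[1]_α`. -/
def unitVec {N : ℕ} (α : Fin N) : Fin N → ℤ := Pi.single α 1

/-- `|s| = ∑ s_μ`. -/
def total {N : ℕ} (s : Fin N → ℤ) : ℤ := ∑ μ, s μ

/-- `τ_{αβ}(s, t, t̄) = (-1)^{|s|(|s|-1)/2} ⟨s + [1]_α - [1]_β| e^{J(t)} g e^{-J̄(t̄)} |s⟩`. -/
def fermionTau {N : ℕ} (A : Mode N → Mode N → ℂ) (α β : Fin N) (s : Fin N → ℤ) :
    MvPowerSeries (TauVar N) ℂ :=
  ((-1 : ℂ) ^ (total s * (total s - 1) / 2)) • tauExp A (s + unitVec α - unitVec β) s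

/-! ### The integral bilinear equation -/

/-- The sign `ε_{αγ}`. -/
def epsConst {N : ℕ} (α γ : Fin N) : ℂ := if α ≤ γ then 1 else -1

/-- The sign `ε_{αγ}(s)`. -/
def eps {N : ℕ} (α γ : Fin N) (s : Fin N → ℤ) : ℂ :=
  if α ≤ γ then (-1) ^ (∑ μ ∈ Finset.Ioc α γ, s μ) else -((-1) ^ (∑ μ ∈ Finset.Ioc γ α, s μ))

/-- The sign `ε_{0N}(s)`. -/
def epsTotal {N : ℕ} (s : Fin N → ℤ) : ℂ := (-1) ^ total s

/-- The Kronecker symbol. -/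
def kron {N : ℕ} (α β : Fin N) : ℤ := if α = β then 1 else 0

/-- Variables of the bilinear equation: `t, t̄` (left summand) and `t', t̄'` (right summand). -/
abbrev BilVar (N : ℕ) : Type := TauVar N ⊕ TauVar N

/-- Formal power series in `t, t̄, t', t̄'` whose coefficients are Laurent series in `z⁻¹`, that is,
`LaurentSeries ℂ` is used with its variable playing the role of `z⁻¹`. -/
abbrev BilRing (N : ℕ) : Type := MvPowerSeries (BilVar N) (LaurentSeries ℂ)

/-- The monomial `z ^ n`, as a Laurent series in `z⁻¹`. -/
def zPow (n : ℤ) : LaurentSeries ℂ := HahnSeries.single (-n) 1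

/-- `e^{ξ(t_γ - t'_γ, z)}` with `ξ(t_γ, z) = ∑_{k ≥ 1} t_{γ,k} z^k`. -/
def expXi {N : ℕ} (γ : Fin N) : BilRing N :=
  expSeries (linSeries (Sum.elim
    (Sum.elim (fun p => if p.1 = γ then zPow p.2 else 0) (fun _ => 0))
    (Sum.elim (fun p => if p.1 = γ then -zPow p.2 else 0) (fun _ => 0))))

/-- `e^{ξ(t̄_γ - t̄'_γ, z)}`. -/
def expXiBar {N : ℕ} (γ : Fin N) : BilRing N :=
  expSeries (linSeries (Sum.elim
    (Sum.elim (fun _ => 0) (fun p => if p.1 = γ then zPow p.2 else 0))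
    (Sum.elim (fun _ => 0) (fun p => if p.1 = γ then -zPow p.2 else 0))))

/-- The increments of the variables in the shift `t ↦ t + c [z⁻¹]_γ`, that is
`t_{α,k} ↦ t_{α,k} + c δ_{αγ} z^{-k} / k`, as power series in an additional variable `none`
which stands for `z⁻¹`. -/
def shiftT {N : ℕ} (γ : Fin N) (c : ℂ) : TauVar N → MvPowerSeries (Option (BilVar N)) ℂ :=
  Sum.elim
    (fun p => if p.1 = γ then MvPowerSeries.monomial (Finsupp.single none (p.2 : ℕ)) (c / (p.2 : ℕ))
      else 0)
    (fun _ => 0)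

/-- The increments of the variables in the shift `t̄ ↦ t̄ + c [z⁻¹]_γ`. -/
def shiftTbar {N : ℕ} (γ : Fin N) (c : ℂ) : TauVar N → MvPowerSeries (Option (BilVar N)) ℂ :=
  Sum.elim (fun _ => 0)
    (fun p => if p.1 = γ then MvPowerSeries.monomial (Finsupp.single none (p.2 : ℕ)) (c / (p.2 : ℕ))
      else 0)

/-- The replacement of the variables used in the shifts below is admissible for the substitution
into formal power series. -/
theorem hasSubst_shift {N : ℕ} (e : TauVar N → BilVar N) (he : Function.Injective e)
    (γ : Fin N) (c : ℂ) :
    MvPowerSeries.HasSubst (fun v => MvPowerSeries.X (some (e v)) + shiftT γ c v) ∧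
    MvPowerSeries.HasSubst (fun v => MvPowerSeries.X (some (e v)) + shiftTbar γ c v) := by
  classical
  have hmono : ∀ (d : Option (BilVar N) →₀ ℕ) (p : TimeIdx N),
      MvPowerSeries.coeff d (if p.1 = γ then
        (MvPowerSeries.monomial (Finsupp.single none (p.2 : ℕ)) (c / (p.2 : ℕ)) :
          MvPowerSeries (Option (BilVar N)) ℂ) else 0) ≠ 0 →
      p.1 = γ ∧ (p.2 : ℕ) = d none := by
    intro d p hp
    split_ifs at hp with h
    · refine ⟨h, ?_⟩
      rw [MvPowerSeries.coeff_monomial] at hp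
      split_ifs at hp with h2
      · rw [h2]; simp
      · exact absurd rfl hp
    · exact absurd (map_zero _) hp
  have hX : MvPowerSeries.HasSubst
      (fun v => (MvPowerSeries.X (some (e v)) : MvPowerSeries (Option (BilVar N)) ℂ)) := by
    refine ⟨fun v => by simp, fun d => ?_⟩
    refine Set.Subsingleton.finite ?_
    intro v hv w hw
    simp only [Set.mem_ofPred_eq, MvPowerSeries.coeff_X, ne_eq, ite_eq_right_iff, one_ne_zero,
      imp_false, not_not] at hv hw
    have := Finsupp.single_left_injective one_ne_zero (hv.symm.trans hw)
    exact he (Option.some_injective _ this)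
  have hfin : ∀ d : Option (BilVar N) →₀ ℕ,
      {p : TimeIdx N | p.1 = γ ∧ (p.2 : ℕ) = d none}.Finite := by
    intro d
    refine Set.Subsingleton.finite ?_
    rintro ⟨a, k⟩ ⟨h1, h2⟩ ⟨b, l⟩ ⟨h3, h4⟩
    exact Prod.ext (h1.trans h3.symm) (PNat.coe_injective (h2.trans h4.symm))
  have hconst : ∀ p : TimeIdx N, MvPowerSeries.constantCoeff (if p.1 = γ then
        (MvPowerSeries.monomial (Finsupp.single none (p.2 : ℕ)) (c / (p.2 : ℕ)) :
          MvPowerSeries (Option (BilVar N)) ℂ) else 0) = 0 := by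
    intro p
    by_contra h
    have := (hmono 0 p h).2
    simp at this
  refine ⟨hX.add ⟨?_, fun d => ?_⟩, hX.add ⟨?_, fun d => ?_⟩⟩
  · rintro (p | p)
    · simp only [shiftT, Sum.elim_inl, hconst]; exact IsNilpotent.zero
    · simp [shiftT]
  · refine ((hfin d).image Sum.inl).subset ?_
    rintro (p | p) hp
    · exact ⟨p, hmono d p hp, rfl⟩
    · exact absurd (map_zero _) hp
  · rintro (p | p)
    · simp [shiftTbar]
    · simp only [shiftTbar, Sum.elim_inr, hconst]; exact IsNilpotent.zero
  · refine ((hfin d).image Sum.inr).subset ?_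
    rintro (p | p) hp
    · exact absurd (map_zero _) hp
    · exact ⟨p, hmono d p hp, rfl⟩

/-- A power series in `t, t̄, t', t̄'` and `z⁻¹` (the variable `none`), regarded as a power series
in `t, t̄, t', t̄'` with coefficients which are (power, hence Laurent) series in `z⁻¹`. -/
def toBilRing {N : ℕ} (F : MvPowerSeries (Option (BilVar N)) ℂ) : BilRing N :=
  fun m => HahnSeries.ofPowerSeries ℤ ℂ
    (PowerSeries.mk fun n =>
      MvPowerSeries.coeff (m.mapDomain some + Finsupp.single none n) F)

/-- The series `F(t, t̄)` at the shifted arguments: each variable `v` of `F` is replaced by the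
variable `e v` (`e = Sum.inl` selects `t, t̄` and `e = Sum.inr` selects `t', t̄'`) plus the
increment `u v`. -/
def shifted {N : ℕ} (e : TauVar N → BilVar N) (u : TauVar N → MvPowerSeries (Option (BilVar N)) ℂ)
    (F : MvPowerSeries (TauVar N) ℂ) : BilRing N :=
  toBilRing (MvPowerSeries.subst (fun v => MvPowerSeries.X (some (e v)) + u v) F)

/-- The formal contour integral `∮_{C_∞} F dz`, normalised as the residue: the coefficient of `z⁻¹`
in `F`, for every monomial in the times. -/
def res {N : ℕ} (F : BilRing N) : MvPowerSeries (BilVar N) ℂ :=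
  fun m => (MvPowerSeries.coeff m F).coeff 1

/-- A matrix-valued function `τ_{αβ}(s, t, t̄)`, given by formal power series in `t, t̄` for every
`s ∈ ℤ^N`, is a tau-function of the `N`-component Toda lattice hierarchy: it satisfies the integral
bilinear equation for all `α, β, s, s'`, identically in `t, t̄, t', t̄'`. -/
def IsTodaTau {N : ℕ} (τ : Fin N → Fin N → (Fin N → ℤ) → MvPowerSeries (TauVar N) ℂ) : Prop :=
  ∀ (α β : Fin N) (s s' : Fin N → ℤ),
    ∑ γ, (eps α γ s * (eps β γ s')⁻¹) •
        res (MvPowerSeries.C (zPow (s γ - s' γ + kron α γ + kron β γ - 2)) * expXi γ *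
          shifted Sum.inl (shiftT γ (-1)) (τ α γ s) *
          shifted Sum.inr (shiftT γ 1) (τ γ β s'))
      = -∑ γ, (epsConst α γ * epsConst β γ * eps α γ s * epsTotal s *
            (eps β γ s')⁻¹ * (epsTotal s')⁻¹) •
        res (MvPowerSeries.C (zPow (s' γ - s γ - 2)) * expXiBar γ *
          shifted Sum.inl (shiftTbar γ (-1)) (τ α γ (s + unitVec γ)) *
          shifted Sum.inr (shiftTbar γ 1) (τ γ β (s' - unitVec γ)))

end MultiToda

end

open scoped BigOperators

noncomputable section

namespace MultiToda

/-! ### Formal exponentials of linear series -/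

section Exponentials
open Finsupp MvPowerSeries

/-! The source of the equation is a symmetry of `g`. For a bilinear `X = ψ*_p ψ_q` the operator `∑_i
ψ_i ⊗ ψ*_i` commutes with `X ⊗ 1 + 1 ⊗ X`, because the contractions arising in the two factors
cancel (`pairing_step`). Hence it commutes with `g ⊗ g`, which is the identity `∑_i ⟨φ|ψ_i
g|x⟩⟨φ'|ψ*_i g|y⟩ = ∑_i ⟨φ|g ψ_i|x⟩⟨φ'|g ψ*_i|y⟩` (`bilinear_identity`). Since `g` exists only
through its matrix elements, the product of two of them is expanded over pairs of words. Each pair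
is spread evenly over its shuffles, the factorials combine to the weight of a single word, and for
one word the identity is a finite statement about its colourings (`exists_colourings`).

The identity is used with `⟨φ| = ⟨s + [1]_α| e^{J(t)}`, `|x⟩ = e^{-J̄(t̄)}|s⟩`, `⟨φ'| = ⟨s' - [1]_β|
e^{J(t')}` and `|y⟩ = e^{-J̄(t̄')}|s'⟩`. The modes of one component `γ` form the generating series
`ψ(z)` and `ψ*(z)`, and their sum over `j` is a residue in `z`. Moving `ψ(z)` through the evolution
operator produces the factor `e^ξ` (`coeff_vertex`). On a charged vacuum `ψ(z)` changes the charge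
by one and acts as `exp (∓∑ J_k z^{-k} / k)`, which is a shift of the times; this bosonization is
the recursion `IsCAR.boson_rec`. Both facts rest on the commutator of a current with a fermion being
a shifted fermion.

Exponentials of linear series with commuting coefficients are handled throughout by the first order
recursion that characterises them. Fermions acting from the right on bras satisfy the same relations
as those acting on kets. The two evolutions become one commuting family on the tensor product of the
dual Fock space and the Fock space, with `g` as a functional. Thus `coeff_res_vertex` serves both
sides of the equation. The signs `ε` are those which make the factor in front of each component
independent of `γ`. -/

/-- Induction on exponents, adding one unit at a time. -/
theorem exponent_induction {σ : Type*} {p : (σ →₀ ℕ) → Prop} (h0 : p 0)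
    (hadd : ∀ m v, p m → p (m + single v 1)) (m : σ →₀ ℕ) : p m := by
  induction m using Finsupp.induction_linear with
  | zero => exact h0
  | add f g hf hg =>
    clear hf
    -- Hypotheses on the two summands cannot be combined by unit steps, so the degree is used for a
    -- second induction.
    have key : ∀ (n : ℕ) (g : σ →₀ ℕ), g.degree = n → p g := by
      intro n
      induction n with
      | zero => intro g hg; rw [(degree_eq_zero_iff g).1 hg]; exact h0
      | succ n ih =>
        intro g hg
        obtain ⟨v, hv⟩ : ∃ v, g v ≠ 0 := by
          by_contra! h
          have : g = 0 := Finsupp.ext h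
          simp [this] at hg
        have hle : single v 1 ≤ g := by
          rw [Finsupp.single_le_iff]; omega
        rw [← tsub_add_cancel_of_le hle]
        refine hadd _ _ (ih _ ?_)
        have := congrArg degree (tsub_add_cancel_of_le hle)
        rw [map_add, degree_single, hg] at this
        omega
    exact key _ _ rfl
  | single v n =>
    induction n with
    | zero => simpa using h0
    | succ n ih => rw [Finsupp.single_add]; exact hadd _ _ ih

/-- Two families indexed by exponents which obey the same first order recursion agree. -/
theorem eq_of_recursion {σ E : Type*} [AddCommGroup E] [Module ℂ E] (T : σ → E → E)
    {F G : (σ →₀ ℕ) → E} (h0 : F 0 = G 0)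
    (hF : ∀ m v, ((m v : ℂ) + 1) • F (m + single v 1) = T v (F m))
    (hG : ∀ m v, ((m v : ℂ) + 1) • G (m + single v 1) = T v (G m)) : F = G := by
  funext m
  induction m using exponent_induction with
  | h0 => exact h0
  | hadd m v ih =>
    have h : ((m v : ℂ) + 1) ≠ 0 := Nat.cast_add_one_ne_zero _
    have := (hF m v).trans ((congrArg (T v) ih).trans (hG m v).symm)
    exact smul_right_injective _ h this

/-- A pair with `p.1 v ≠ 0` arises from exactly one pair of `antidiagonal m` by a unit step at `v`,
and the factor `p.1 v` removes all other pairs. This is half of the Leibniz rule. -/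
theorem sum_antidiagonal_single {σ E : Type*} [AddCommMonoid E] [DecidableEq σ]
    (f : (σ →₀ ℕ) → (σ →₀ ℕ) → E)
    (m : σ →₀ ℕ) (v : σ) :
    ∑ p ∈ Finset.HasAntidiagonal.antidiagonal (m + single v (1 : ℕ)), (p.1 : σ →₀ ℕ) v • f p.1 p.2
      = ∑ q ∈ Finset.HasAntidiagonal.antidiagonal m, (q.1 v + 1) • f (q.1 + single v 1) q.2 := by
  symm
  refine Finset.sum_of_injOn (fun q => (q.1 + single v 1, q.2)) ?_ ?_ ?_ ?_
  · rintro ⟨a, b⟩ _ ⟨c, d⟩ _ h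
    simpa using h
  · rintro ⟨a, b⟩ h
    simp only [Finset.mem_coe, Finset.HasAntidiagonal.mem_antidiagonal] at h ⊢
    rw [← h]; abel
  · rintro ⟨a, b⟩ h hn
    simp only [Finset.HasAntidiagonal.mem_antidiagonal] at h
    by_cases ha : a v = 0
    · simp [ha]
    · exfalso
      apply hn
      have hle : single v 1 ≤ a := by rw [Finsupp.single_le_iff]; omega
      refine ⟨(a - single v 1, b), ?_, ?_⟩
      · simp only [Finset.mem_coe, Finset.HasAntidiagonal.mem_antidiagonal]
        have h2 : a - single v 1 + single v 1 + b = m + single v 1 := by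
          rw [tsub_add_cancel_of_le hle, h]
        apply add_right_cancel (b := single v 1)
        rw [← h2, add_right_comm]
      · simp [tsub_add_cancel_of_le hle]
  · rintro ⟨a, b⟩ _
    simp

/-- The Leibniz rule for partial derivatives of series over a noncommutative ring. -/
theorem coeff_mul_single {σ R : Type*} [Semiring R] (F G : MvPowerSeries σ R) (m : σ →₀ ℕ) (v : σ) :
    (m v + 1) • coeff (m + single v 1) (F * G)
      = coeff m (pderivFun v F * G) + coeff m (F * pderivFun v G) := by
  classical
  have e1 : ∀ q : σ →₀ ℕ, ∀ H : MvPowerSeries σ R,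
      coeff q (pderivFun v H) = (q v + 1) • coeff (q + single v 1) H := by
    intro q H
    rw [coeff_pderivFun, nsmul_eq_mul]
    push_cast
    exact ((Nat.cast_commute (q v) _).add_left (Commute.one_left _)).eq.symm
  rw [coeff_mul, coeff_mul, coeff_mul, Finset.smul_sum]
  simp only [e1]
  have h1 := sum_antidiagonal_single (fun a b => coeff a F * coeff b G) m v
  -- The derivative of the second factor is the same sum read through the swap of the antidiagonal.
  have h2 := sum_antidiagonal_single (fun a b => coeff b F * coeff a G) m v
  rw [← Finset.HasAntidiagonal.map_swap_antidiagonal, Finset.sum_map] at h2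
  conv_rhs at h2 => rw [← Finset.HasAntidiagonal.map_swap_antidiagonal, Finset.sum_map]
  simp only [Function.Embedding.coeFn_mk, Prod.fst_swap, Prod.snd_swap] at h2
  simp only [smul_mul_assoc, mul_smul_comm]
  rw [← h1, ← h2, ← Finset.sum_add_distrib]
  refine Finset.sum_congr rfl ?_
  rintro ⟨a, b⟩ h
  rw [Finset.HasAntidiagonal.mem_antidiagonal] at h
  have : a v + b v = m v + 1 := by
    have := congrArg (fun f => f v) h
    simpa using this
  rw [← add_smul, this]

theorem coeff_linSeries {σ R : Type*} [Semiring R] (c : σ → R) (m : σ →₀ ℕ) :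
    coeff m (linSeries c) = if m.degree = 1 then m.sum (fun v n => n • c v) else 0 := rfl

theorem pderivFun_linSeries {σ R : Type*} [Semiring R] (c : σ → R) (v : σ) :
    pderivFun v (linSeries c) = C (c v) := by
  classical
  ext m
  rw [coeff_pderivFun, coeff_linSeries, coeff_C, map_add, degree_single]
  by_cases hm : m = 0
  · subst hm; simp
  · have : m.degree ≠ 0 := fun h => hm ((degree_eq_zero_iff m).1 h)
    simp [hm, this]

theorem commute_C_linSeries {σ R : Type*} [Semiring R] (c : σ → R) (r : R)
    (hr : ∀ v, Commute r (c v)) : Commute (C r) (linSeries c) := by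
  classical
  ext m
  rw [coeff_C_mul, coeff_mul_C, coeff_linSeries]
  split_ifs
  · rw [Finsupp.sum, Finset.mul_sum, Finset.sum_mul]
    exact Finset.sum_congr rfl fun v _ => ((hr v).smul_right _).eq
  · simp

/-- Commuting coefficients make the `n + 1` terms of the derivative equal; this is what gives the
exponential a first order recursion. -/
theorem pderivFun_linSeries_pow {σ R : Type*} [Semiring R] (c : σ → R)
    (hc : ∀ v w, Commute (c v) (c w)) (v : σ) (n : ℕ) :
    pderivFun v (linSeries c ^ (n + 1)) = (n + 1) • (C (c v) * linSeries c ^ n) := by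
  have hmul : ∀ F G : MvPowerSeries σ R,
      pderivFun v (F * G) = pderivFun v F * G + F * pderivFun v G := by
    intro F G
    ext m
    rw [map_add, ← coeff_mul_single, coeff_pderivFun, nsmul_eq_mul]
    push_cast
    exact ((Nat.cast_commute (m v) _).add_left (Commute.one_left _)).eq.symm
  induction n with
  | zero => simp [pderivFun_linSeries]
  | succ n ih =>
    rw [pow_succ, hmul, ih, pderivFun_linSeries, smul_mul_assoc, mul_assoc, ← pow_succ,
      ((commute_C_linSeries c (c v) (hc v)).pow_right (n + 1)).eq.symm, succ_nsmul (_ : MvPowerSeries σ R) (n + 1)]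

theorem coeff_zero_exp {σ R : Type*} [Ring R] [Algebra ℂ R] (c : σ → R) :
    coeff 0 (expSeries (linSeries c)) = 1 := by
  change ∑ n ∈ Finset.range ((0 : σ →₀ ℕ).degree + 1), _ = _
  simp

/-- The recursion for the coefficients of the exponential of a linear series with commuting
coefficients. -/
theorem coeff_exp_single {σ R : Type*} [Ring R] [Algebra ℂ R] (c : σ → R)
    (hc : ∀ v w, Commute (c v) (c w)) (m : σ →₀ ℕ) (v : σ) :
    ((m v : ℂ) + 1) • coeff (m + single v 1) (expSeries (linSeries c))
      = c v * coeff m (expSeries (linSeries c)) := by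
  have e : ∀ m : σ →₀ ℕ, coeff m (expSeries (linSeries c))
      = ∑ n ∈ Finset.range (m.degree + 1), ((n.factorial : ℂ)⁻¹) • coeff m (linSeries c ^ n) :=
    fun _ => rfl
  -- The zeroth power drops out, so the sum can be reindexed by `n + 1`; the truncations at the
  -- degrees of `m + single v 1` and `m` then match.
  have h0 : coeff (m + single v 1) (linSeries c ^ 0) = 0 := by
    classical
    rw [pow_zero, coeff_one, if_neg]
    intro h
    have := congrArg (fun f => f v) h
    simp at this
  have h1 : ∀ n : ℕ, ((m v : ℂ) + 1) • coeff (m + single v 1) (linSeries c ^ (n + 1))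
      = ((n : ℂ) + 1) • (c v * coeff m (linSeries c ^ n)) := by
    intro n
    have h := congrArg (coeff m) (pderivFun_linSeries_pow c hc v n)
    rw [coeff_pderivFun, map_nsmul, coeff_C_mul] at h
    have e2 : ((m v : ℂ) + 1) • coeff (m + single v 1) (linSeries c ^ (n + 1))
        = coeff (m + single v 1) (linSeries c ^ (n + 1)) * ((m v : R) + 1) := by
      rw [Algebra.smul_def, map_add, map_natCast, map_one]
      exact ((Nat.cast_commute (m v) _).add_left (Commute.one_left _)).eq
    rw [e2, h, ← Nat.cast_smul_eq_nsmul ℂ]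
    push_cast
    rfl
  rw [e, e, map_add, degree_single, Finset.sum_range_succ', h0, smul_zero, add_zero,
    Finset.smul_sum, Finset.mul_sum]
  refine Finset.sum_congr rfl fun n _ => ?_
  rw [smul_comm, h1, smul_smul, mul_smul_comm]
  congr 1
  rw [Nat.factorial_succ]
  have : ((n : ℂ) + 1) ≠ 0 := Nat.cast_add_one_ne_zero _
  have : (n.factorial : ℂ) ≠ 0 := Nat.cast_ne_zero.2 n.factorial_ne_zero
  push_cast
  field_simp

/-- Both sides have constant term `1` and are multiplied by `b v + c v` under the derivative in `v`.
-/
theorem exp_add {σ B : Type*} [CommRing B] [Algebra ℂ B] (b c : σ → B) :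
    expSeries (linSeries fun v => b v + c v) = expSeries (linSeries b) * expSeries (linSeries c) := by
  have key : (fun m => coeff m (expSeries (linSeries fun v => b v + c v)))
      = fun m => coeff m (expSeries (linSeries b) * expSeries (linSeries c)) := by
    refine eq_of_recursion (fun v x => (b v + c v) * x) ?_
      (fun m v => coeff_exp_single _ (fun _ _ => Commute.all _ _) m v) ?_
    · classical
      simp [coeff_mul, coeff_zero_exp]
    · intro m v
      have hp : ∀ b : σ → B, pderivFun v (expSeries (linSeries b))
          = C (b v) * expSeries (linSeries b) := by
        intro b
        ext m
        rw [coeff_pderivFun, coeff_C_mul, ← coeff_exp_single b (fun _ _ => Commute.all _ _) m v,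
          Algebra.smul_def, mul_comm]
        simp
      have h := coeff_mul_single (expSeries (linSeries b)) (expSeries (linSeries c)) m v
      rw [hp, hp, ← map_add] at h
      have e2 : expSeries (linSeries b) * (C (c v) * expSeries (linSeries c))
          = C (c v) * (expSeries (linSeries b) * expSeries (linSeries c)) := by ring
      rw [e2, mul_assoc, ← add_mul, ← map_add, coeff_C_mul, ← Nat.cast_smul_eq_nsmul ℂ] at h
      rw [← h]
      push_cast
      rfl
  exact MvPowerSeries.ext fun m => congrFun key m

theorem neg_linSeries {σ R : Type*} [Ring R] (c : σ → R) :
    -linSeries c = linSeries fun v => -c v := by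
  ext m
  rw [map_neg, coeff_linSeries, coeff_linSeries]
  split_ifs
  · simp [Finsupp.sum]
  · simp

end Exponentials

/-! ### Powers of commuting operators -/

section Powers
open Finsupp MvPowerSeries
variable {σ : Type*}

/-- The reciprocal of the multi-index factorial `m!`. -/
def invFact (m : σ →₀ ℕ) : ℂ := coeff m (expSeries (linSeries fun _ : σ => (1 : ℂ)))

theorem invFact_zero : invFact (0 : σ →₀ ℕ) = 1 := coeff_zero_exp _

theorem invFact_single (m : σ →₀ ℕ) (v : σ) :
    ((m v : ℂ) + 1) * invFact (m + single v 1) = invFact m :=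
  (coeff_exp_single _ (fun _ _ => Commute.all _ _) m v).trans (one_mul _)

theorem invFact_ne_zero (m : σ →₀ ℕ) : invFact m ≠ 0 := by
  induction m using exponent_induction with
  | h0 => simp [invFact_zero]
  | hadd m v ih =>
    intro h
    rw [← invFact_single m v, h, mul_zero] at ih
    exact ih rfl

/-- The monomial `∏ v, c v ^ m v` in commuting elements `c v`. -/
def opPow {R : Type*} [Ring R] [Algebra ℂ R] (c : σ → R) (m : σ →₀ ℕ) : R :=
  (invFact m)⁻¹ • coeff m (expSeries (linSeries c))

theorem coeff_exp_eq {R : Type*} [Ring R] [Algebra ℂ R] (c : σ → R) (m : σ →₀ ℕ) :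
    coeff m (expSeries (linSeries c)) = invFact m • opPow c m := by
  rw [opPow, smul_smul, mul_inv_cancel₀ (invFact_ne_zero m), one_smul]

theorem opPow_zero {R : Type*} [Ring R] [Algebra ℂ R] (c : σ → R) : opPow c 0 = 1 := by
  rw [opPow, invFact_zero, coeff_zero_exp, inv_one, one_smul]

theorem opPow_single {R : Type*} [Ring R] [Algebra ℂ R] (c : σ → R)
    (hc : ∀ v w, Commute (c v) (c w)) (m : σ →₀ ℕ) (v : σ) :
    opPow c (m + single v 1) = c v * opPow c m := by
  rw [opPow, opPow, mul_smul_comm, ← coeff_exp_single c hc, smul_smul, ← invFact_single m v]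
  congr 1
  have : ((m v : ℂ) + 1) ≠ 0 := Nat.cast_add_one_ne_zero _
  have := invFact_ne_zero (m + single v 1)
  field_simp

theorem opPow_add {R : Type*} [Ring R] [Algebra ℂ R] (c : σ → R)
    (hc : ∀ v w, Commute (c v) (c w)) (m k : σ →₀ ℕ) :
    opPow c (m + k) = opPow c m * opPow c k := by
  induction m using exponent_induction with
  | h0 => rw [zero_add, opPow_zero, one_mul]
  | hadd m v ih =>
    rw [add_right_comm, opPow_single c hc, opPow_single c hc, ih, mul_assoc]

/-- Links the products occurring in a substitution to the coefficients of an exponential. -/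
theorem opPow_eq_prod {R : Type*} [CommRing R] [Algebra ℂ R] (c : σ → R) (m : σ →₀ ℕ) :
    (m.prod fun v n => c v ^ n) = opPow c m := by
  induction m using exponent_induction with
  | h0 => rw [opPow_zero, Finsupp.prod_zero_index]
  | hadd m v ih =>
    classical
    rw [opPow_single c (fun _ _ => Commute.all _ _), ← ih, Finsupp.prod_add_index', mul_comm]
    · simp
    · simp
    · intro a b₁ b₂; exact pow_add _ _ _

theorem commute_opPow {R : Type*} [Ring R] [Algebra ℂ R] (c : σ → R)
    (hc : ∀ v w, Commute (c v) (c w)) (x : R) (hx : ∀ v, Commute x (c v)) (m : σ →₀ ℕ) :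
    Commute x (opPow c m) := by
  induction m using exponent_induction with
  | h0 => rw [opPow_zero]; exact Commute.one_right _
  | hadd m v ih => rw [opPow_single c hc]; exact (hx v).mul_right ih

end Powers

/-! ### The shifts of the times -/

section Shift
open Finsupp MvPowerSeries
variable {σ : Type*}

/-- The coefficient `c / k` of the increment of a variable of weight `k ≥ 1`; variables of weight
`0` are not shifted. -/
def shiftCoeff (wt : σ → ℕ) (c : ℂ) (v : σ) : ℂ := if wt v = 0 then 0 else c / wt v

/-- The coefficients of the series `exp (∑ v, c / wt v * y_v)`. -/
def expCoeff (wt : σ → ℕ) (c : ℂ) (m : σ →₀ ℕ) : ℂ :=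
  coeff m (expSeries (linSeries (shiftCoeff wt c)))

theorem expCoeff_single (wt : σ → ℕ) (c : ℂ) (m : σ →₀ ℕ) (v : σ) :
    ((m v : ℂ) + 1) * expCoeff wt c (m + single v 1) = shiftCoeff wt c v * expCoeff wt c m :=
  coeff_exp_single _ (fun _ _ => Commute.all _ _) m v

/-- The part of weight `n` of `expCoeff`. -/
def wtCoeff (wt : σ → ℕ) (c : ℂ) (n : ℕ) (m : σ →₀ ℕ) : ℂ :=
  if weight wt m = n then expCoeff wt c m else 0

/-- Variables of weight `0` are absent from the exponent, so the recursion kills every monomial that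
contains one. -/
theorem expCoeff_ne_zero {wt : σ → ℕ} {c : ℂ} {m : σ →₀ ℕ} (h : expCoeff wt c m ≠ 0) {v : σ}
    (hv : m v ≠ 0) : wt v ≠ 0 := by
  intro hw
  have hle : single v 1 ≤ m := by rw [Finsupp.single_le_iff]; omega
  have := expCoeff_single wt c (m - single v 1) v
  rw [tsub_add_cancel_of_le hle, shiftCoeff, if_pos hw, zero_mul] at this
  rcases mul_eq_zero.1 this with h1 | h1
  · exact Nat.cast_add_one_ne_zero _ h1
  · exact h h1

/-- There is at most one variable of each positive weight. A surviving monomial of weight `n`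
therefore involves finitely many variables, each with exponent at most `n`. -/
theorem wtCoeff_finite (wt : σ → ℕ) (κ : ℕ → σ) (hκ : ∀ v, wt v ≠ 0 → κ (wt v) = v) (c : ℂ)
    (n : ℕ) : Function.HasFiniteSupport (wtCoeff wt c n) := by
  classical
  refine (Finset.finite_toSet (Finset.Iic
    (∑ j ∈ Finset.range (n + 1), single (κ j) n))).subset ?_
  intro m hm
  simp only [Function.mem_support, wtCoeff, ne_eq, ite_eq_right_iff, Classical.not_imp] at hm
  obtain ⟨h1, h2⟩ := hm
  simp only [Finset.coe_Iic, Set.mem_Iic]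
  intro v
  by_cases hv : m v = 0
  · rw [hv]; exact Nat.zero_le _
  · have hw := expCoeff_ne_zero h2 hv
    have hle : m v * wt v ≤ n := by
      rw [← h1, weight_apply, Finsupp.sum]
      exact Finset.single_le_sum (f := fun i => m i • wt i) (fun _ _ => Nat.zero_le _)
        (Finsupp.mem_support_iff.2 hv)
    have h3 : m v ≤ n := (Nat.le_mul_of_pos_right _ (Nat.pos_of_ne_zero hw)).trans hle
    have h4 : wt v ≤ n := (Nat.le_mul_of_pos_left _ (Nat.pos_of_ne_zero hv)).trans hle
    refine h3.trans ?_
    rw [Finsupp.finsetSum_apply]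
    refine le_trans ?_ (Finset.single_le_sum (f := fun j => single (κ j) n v)
      (fun _ _ => Nat.zero_le _) (Finset.mem_range.2 (Nat.lt_succ_of_le h4)))
    simp [hκ v hw]

/-- Euler's identity for the grading by weight; a variable heavier than `n` cannot occur in a
monomial of weight `n`. -/
theorem weight_eq_sum (wt : σ → ℕ) (κ : ℕ → σ) (hκ : ∀ v, wt v ≠ 0 → κ (wt v) = v)
    (hκ' : ∀ j, j ≠ 0 → wt (κ j) = j) (m : σ →₀ ℕ) (n : ℕ) (h : weight wt m = n) :
    n = ∑ j ∈ Finset.range n, m (κ (j + 1)) * (j + 1) := by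
  classical
  have h1 : ∑ v ∈ m.support, m v * wt v = n := h ▸ rfl
  symm
  rw [← h1]
  have : ∑ j ∈ Finset.range n, m (κ (j + 1)) * (j + 1)
      = ∑ j ∈ Finset.range n, m (κ (j + 1)) * wt (κ (j + 1)) :=
    Finset.sum_congr rfl fun j _ => by rw [hκ' _ (Nat.succ_ne_zero j)]
  rw [h1, this]
  have hinj : Set.InjOn (fun j => κ (j + 1)) (Finset.range n) := by
    intro i _ j _ hij
    have := congrArg wt hij
    simp only [hκ' _ (Nat.succ_ne_zero _)] at this
    omega
  rw [← Finset.sum_image (f := fun v => m v * wt v) hinj]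
  refine Eq.trans ?_ h1
  refine Finset.sum_congr_of_eq_on_inter ?_ ?_ (fun _ _ _ => rfl)
  · intro v _ hv
    simp [Finsupp.notMem_support_iff.1 hv]
  · intro v hv hv'
    by_contra hne
    apply hv'
    have hw : wt v ≠ 0 := fun h => hne (by simp [h])
    have hle : m v * wt v ≤ n := by
      rw [← h1]
      exact Finset.single_le_sum (f := fun i => m i * wt i) (fun _ _ => Nat.zero_le _) hv
    have h4 : wt v ≤ n :=
      (Nat.le_mul_of_pos_left _ (Nat.pos_of_ne_zero (Finsupp.mem_support_iff.1 hv))).trans hle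
    refine Finset.mem_image.2 ⟨wt v - 1, Finset.mem_range.2 (by omega), ?_⟩
    rw [Nat.sub_add_cancel (Nat.pos_of_ne_zero hw), hκ v hw]

variable {V : Type*} [AddCommGroup V] [Module ℂ V]

/-- The coefficient of `z^{-n}` of `exp (c * ∑ k, J_k z^{-k} / k) u`. -/
def shiftVec (wt : σ → ℕ) (c : ℂ) (J : σ → Module.End ℂ V) (u : V) (n : ℕ) : V :=
  ∑ᶠ m, wtCoeff wt c n m • opPow J m u

theorem support_smul_finite {ι : Type*} {f : ι → ℂ} (hf : Function.HasFiniteSupport f) (g : ι → V) :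
    Function.HasFiniteSupport fun i => f i • g i :=
  Set.Finite.subset hf (Function.support_smul_subset_left f g)

theorem finsum_eq_finsum_comp {ι ι' E : Type*} [AddCommMonoid E] (f : ι → E) (g : ι' → ι)
    (hg : Function.Injective g) (hf : ∀ i, i ∉ Set.range g → f i = 0) :
    ∑ᶠ i, f i = ∑ᶠ j, f (g j) := by
  rw [← finsum_mem_range hg, finsum_mem_def]
  refine finsum_congr fun i => ?_
  by_cases h : i ∈ Set.range g
  · rw [Set.indicator_of_mem h]
  · rw [Set.indicator_of_notMem h, hf i h]

theorem shiftVec_zero (wt : σ → ℕ) (c : ℂ)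
    (J : σ → Module.End ℂ V) (u : V) : shiftVec wt c J u 0 = u := by
  classical
  rw [shiftVec, finsum_eq_single _ (0 : σ →₀ ℕ)]
  · rw [wtCoeff, if_pos (map_zero _), opPow_zero, expCoeff, coeff_zero_exp, one_smul]; rfl
  · intro m hm
    rw [wtCoeff]
    split_ifs with h
    · by_cases he : expCoeff wt c m = 0
      · rw [he, zero_smul]
      · exfalso
        apply hm
        ext v
        by_contra hv
        have hv' : m v ≠ 0 := hv
        have hw := expCoeff_ne_zero he hv'
        have : m v * wt v ≤ weight wt m := by
          rw [weight_apply, Finsupp.sum]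
          exact Finset.single_le_sum (f := fun i => m i • wt i) (fun _ _ => Nat.zero_le _)
            (Finsupp.mem_support_iff.2 hv')
        rw [h] at this
        exact (Nat.mul_ne_zero hv' hw) (Nat.le_zero.1 this)
    · rw [zero_smul]

/-- Applying `-z d/dz` to `exp (c * ∑ J_k z^{-k} / k) u` cancels the denominators and multiplies the
series by `c * ∑ J_k z^{-k}`. -/
theorem shiftVec_rec (wt : σ → ℕ) (κ : ℕ → σ) (hκ : ∀ v, wt v ≠ 0 → κ (wt v) = v)
    (hκ' : ∀ j, j ≠ 0 → wt (κ j) = j) (c : ℂ) (J : σ → Module.End ℂ V)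
    (hJ : ∀ v w, Commute (J v) (J w)) (u : V) (n : ℕ) :
    (n : ℂ) • shiftVec wt c J u n
      = c • ∑ j ∈ Finset.range n, J (κ (j + 1)) (shiftVec wt c J u (n - (j + 1))) := by
  classical
  have hfin := fun n => wtCoeff_finite wt κ hκ c n
  have e1 : ∀ m, (n : ℂ) • (wtCoeff wt c n m • opPow J m u)
      = ∑ j ∈ Finset.range n,
        ((m (κ (j + 1)) : ℂ) * (j + 1)) • (wtCoeff wt c n m • opPow J m u) := by
    intro m
    by_cases h : weight wt m = n
    · rw [← Finset.sum_smul]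
      congr 1
      have := congrArg (Nat.cast (R := ℂ)) (weight_eq_sum wt κ hκ hκ' m n h)
      push_cast at this
      exact this
    · simp [wtCoeff, h]
  rw [shiftVec, smul_finsum, finsum_congr e1, finsum_sum_comm, Finset.smul_sum]
  · refine Finset.sum_congr rfl fun j hj => ?_
    have hj' : j + 1 ≤ n := Finset.mem_range.1 hj
    -- Monomials without the variable `κ (j + 1)` carry the factor `0`; removing one copy from the
    -- others lowers the weight by `j + 1`.
    rw [finsum_eq_finsum_comp _ (fun m => m + single (κ (j + 1)) 1) (fun _ _ h => by simpa using h),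
      shiftVec, map_finsum _ (support_smul_finite (hfin _) _), smul_finsum]
    · refine finsum_congr fun m => ?_
      rw [opPow_single J hJ, map_smul, smul_smul, smul_smul, Module.End.mul_apply]
      congr 1
      have h2 := expCoeff_single wt c m (κ (j + 1))
      have hw : wt (κ (j + 1)) = j + 1 := hκ' _ (Nat.succ_ne_zero j)
      have hne : ((j : ℂ) + 1) ≠ 0 := Nat.cast_add_one_ne_zero _
      have hiff : weight wt (m + single (κ (j + 1)) 1) = n ↔ weight wt m = n - (j + 1) := by
        rw [map_add, weight_single, hw, smul_eq_mul, one_mul]; omega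
      rw [shiftCoeff, hw, if_neg (Nat.succ_ne_zero j)] at h2
      simp only [wtCoeff, hiff, Finsupp.add_apply, Finsupp.single_eq_same]
      split_ifs
      · push_cast at h2 ⊢
        calc ((m (κ (j + 1)) : ℂ) + 1) * (j + 1) * expCoeff wt c (m + single (κ (j + 1)) 1)
            = (j + 1) * (((m (κ (j + 1)) : ℂ) + 1) * expCoeff wt c (m + single (κ (j + 1)) 1)) := by
              ring
          _ = c * expCoeff wt c m := by rw [h2]; field_simp
      · simp
    · intro m hm
      have : m (κ (j + 1)) = 0 := by
        by_contra h
        apply hm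
        have hle : single (κ (j + 1)) 1 ≤ m := by rw [Finsupp.single_le_iff]; omega
        exact ⟨m - single (κ (j + 1)) 1, tsub_add_cancel_of_le hle⟩
      simp [this]
  · intro j _
    refine (hfin n).subset ?_
    intro m hm h
    exact hm (by simp only [h, zero_smul, smul_zero])

/-- The increments of the variables in a shift, as series in an additional variable `none`. -/
def shiftSeries {τ : Type*} (wt : σ → ℕ) (c : ℂ) (v : σ) : MvPowerSeries (Option τ) ℂ :=
  monomial (single none (wt v)) (shiftCoeff wt c v)

/-- With `coeff_exp_shiftSeries` and `exp_add` this expands a monomial in "variable plus increment"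
without binomial coefficients. -/
theorem coeff_exp_X {τ : Type*} (e : σ → τ) (i : σ →₀ ℕ) :
    coeff i (expSeries (linSeries fun v => (X (e v) : MvPowerSeries τ ℂ)))
      = monomial (i.mapDomain e) (invFact i) := by
  revert i
  refine congrFun (eq_of_recursion (fun v x => X (e v) * x) ?_
    (fun m v => coeff_exp_single _ (fun _ _ => Commute.all _ _) m v) ?_)
  · rw [coeff_zero_exp, mapDomain_zero, invFact_zero]; rfl
  · intro m v
    rw [X_def, monomial_mul_monomial, one_mul, ← map_smul, smul_eq_mul, invFact_single,
      mapDomain_add, mapDomain_single, add_comm]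

theorem coeff_exp_shiftSeries {τ : Type*} (wt : σ → ℕ) (c : ℂ) (k : σ →₀ ℕ) :
    coeff k (expSeries (linSeries (shiftSeries (τ := τ) wt c)))
      = monomial (single none (weight wt k)) (expCoeff wt c k) := by
  revert k
  refine congrFun (eq_of_recursion (fun v x => shiftSeries (τ := τ) wt c v * x) ?_
    (fun m v => coeff_exp_single _ (fun _ _ => Commute.all _ _) m v) ?_)
  · rw [coeff_zero_exp, map_zero, expCoeff, coeff_zero_exp, single_zero]; rfl
  · intro m v
    rw [shiftSeries, monomial_mul_monomial, ← map_smul, smul_eq_mul, expCoeff_single,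
      map_add, weight_single, ← single_add, smul_eq_mul, one_mul, add_comm]

/-- Neither the variables `e v` nor the increments, which only involve `none`, contain the variable
`w`. -/
theorem coeff_subst_shift_eq_zero {τ : Type*} (wt : σ → ℕ) (c : ℂ) (F : MvPowerSeries σ ℂ)
    (e : σ → τ) (hs : HasSubst fun v => X (some (e v)) + shiftSeries (τ := τ) wt c v)
    (d : Option τ →₀ ℕ) {w : τ} (hw : w ∉ Set.range e) (hd : d (some w) ≠ 0) :
    coeff d (subst (fun v => X (some (e v)) + shiftSeries (τ := τ) wt c v) F) = 0 := by
  classical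
  rw [coeff_subst hs]
  refine finsum_eq_zero_of_forall_eq_zero fun M => ?_
  rw [opPow_eq_prod, opPow, exp_add, coeff_mul, map_smul, map_sum, Finset.sum_eq_zero, smul_zero,
    smul_zero]
  intro p _
  rw [coeff_exp_X (fun v => some (e v)), coeff_exp_shiftSeries, monomial_mul_monomial,
    coeff_monomial, if_neg]
  rintro rfl
  apply hd
  rw [Finsupp.add_apply, mapDomain_of_notMem_range, single_eq_of_ne, add_zero]
  · simp
  · rintro ⟨v, hv⟩
    exact hw ⟨v, Option.some_injective _ hv⟩

/-- Taylor's formula for the coefficients of a shifted series. -/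
theorem coeff_subst_shift {τ : Type*} (wt : σ → ℕ) (κ : ℕ → σ)
    (hκ : ∀ v, wt v ≠ 0 → κ (wt v) = v) (c : ℂ)
    (J : σ → Module.End ℂ V) (hJ : ∀ v w, Commute (J v) (J w)) (ℓ : V →ₗ[ℂ] ℂ) (u : V)
    (F : MvPowerSeries σ ℂ)
    (hF : ∀ m, coeff m F = ℓ (coeff m (expSeries (linSeries J)) u))
    (e : σ → τ) (he : Function.Injective e)
    (hs : HasSubst fun v => X (some (e v)) + shiftSeries (τ := τ) wt c v)
    (m : σ →₀ ℕ) (n : ℕ) :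
    coeff (m.mapDomain (fun v => some (e v)) + single none n)
        (subst (fun v => X (some (e v)) + shiftSeries (τ := τ) wt c v) F)
      = ℓ (coeff m (expSeries (linSeries J)) (shiftVec wt c J u n)) := by
  classical
  set ie : σ → Option τ := fun v => some (e v) with hie
  have hie_inj : Function.Injective ie := fun a b h => he (Option.some_injective _ h)
  -- Old variables sit at `some (e v)` and increments at `none`. The exponent thus determines the
  -- first contribution completely and the second one up to its weight.
  have hd : ∀ i k : σ →₀ ℕ,
      m.mapDomain ie + single none n = i.mapDomain ie + single none (weight wt k)
        ↔ i = m ∧ weight wt k = n := by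
    intro i k
    constructor
    · intro h
      constructor
      · ext v
        have := congrArg (fun f => f (ie v)) h
        simp only [Finsupp.add_apply, mapDomain_apply hie_inj] at this
        simpa [hie] using this.symm
      · have hn : ∀ i : σ →₀ ℕ, i.mapDomain ie none = 0 := fun i =>
          mapDomain_of_notMem_range _ _ (by simp [hie])
        have := congrArg (fun f => f none) h
        simpa [hn] using this.symm
    · rintro ⟨rfl, rfl⟩; rfl
  have hterm : ∀ M : σ →₀ ℕ, coeff M F • coeff (m.mapDomain ie + single none n)
      (M.prod fun v k => (X (ie v) + shiftSeries (τ := τ) wt c v) ^ k)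
      = ∑ p ∈ Finset.HasAntidiagonal.antidiagonal M,
        if p.1 = m then wtCoeff wt c n p.2 * (invFact m * (coeff M F * (invFact M)⁻¹)) else 0 := by
    intro M
    rw [opPow_eq_prod, opPow, exp_add, coeff_mul, map_smul, map_sum, Finset.smul_sum,
      Finset.smul_sum]
    refine Finset.sum_congr rfl fun p _ => ?_
    rw [coeff_exp_X ie, coeff_exp_shiftSeries, monomial_mul_monomial, coeff_monomial]
    simp only [hd, wtCoeff]
    by_cases h1 : p.1 = m <;> by_cases h2 : weight wt p.2 = n
    · simp only [h1, h2, if_true, and_self, smul_eq_mul]; ring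
    · simp [h2]
    · simp [h1]
    · simp [h1]
  -- Only the exponents `M = m + k` contribute, and `opPow_add` then splits off the power of `J`
  -- with exponent `k`, which belongs to the shift.
  rw [coeff_subst hs, finsum_congr hterm,
    finsum_eq_finsum_comp _ (fun k => m + k) (add_right_injective m), shiftVec,
    map_finsum _ (support_smul_finite (wtCoeff_finite wt κ hκ c n) _),
    map_finsum]
  · refine finsum_congr fun k => ?_
    rw [Finset.sum_eq_single_of_mem (m, k) (Finset.HasAntidiagonal.mem_antidiagonal.2 rfl)]
    · rw [if_pos rfl, hF, map_smul, map_smul, smul_eq_mul]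
      congr 1
      rw [coeff_exp_eq, coeff_exp_eq, opPow_add J hJ]
      simp only [LinearMap.smul_apply, map_smul, smul_eq_mul, Module.End.mul_apply]
      have := invFact_ne_zero (m + k)
      field_simp
    · rintro ⟨a, b⟩ h hne
      rw [if_neg]
      rintro rfl
      apply hne
      rw [Finset.HasAntidiagonal.mem_antidiagonal] at h
      simpa using h
  · refine (wtCoeff_finite wt κ hκ c n).subset ?_
    intro k hk h
    exact hk (by simp only [h, zero_smul, map_zero])
  · intro M hM
    refine Finset.sum_eq_zero fun p hp => if_neg ?_
    rintro rfl
    exact hM ⟨p.2, Finset.HasAntidiagonal.mem_antidiagonal.1 hp⟩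

end Shift

/-! ### Residues of products of vertex operators -/

section Vertex
open Finsupp MvPowerSeries
variable {N : ℕ}

theorem coeff_toBilRing (F : MvPowerSeries (Option (BilVar N)) ℂ) (m : BilVar N →₀ ℕ) (n : ℕ) :
    (coeff m (toBilRing F)).coeff (n : ℤ) = coeff (m.mapDomain some + single none n) F := by
  change (HahnSeries.ofPowerSeries ℤ ℂ _).coeff (n : ℤ) = _
  rw [HahnSeries.ofPowerSeries_apply_coeff, PowerSeries.coeff_mk]

theorem coeff_toBilRing_of_neg (F : MvPowerSeries (Option (BilVar N)) ℂ) (m : BilVar N →₀ ℕ)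
    {k : ℤ} (hk : k < 0) : (coeff m (toBilRing F)).coeff k = 0 := by
  change (HahnSeries.ofPowerSeries ℤ ℂ _).coeff k = _
  rw [HahnSeries.ofPowerSeries_apply, HahnSeries.embDomain_of_notMem_range]
  rintro ⟨n, hn⟩
  have hn' : (n : ℤ) = k := hn
  omega

theorem coeff_zPow_mul (n : ℤ) (x : LaurentSeries ℂ) (k : ℤ) :
    (zPow n * x).coeff k = x.coeff (k + n) := by
  rw [zPow, HahnSeries.coeff_single_mul, one_mul, sub_neg_eq_add]

theorem laurent_coeff_mul_zero (x y : LaurentSeries ℂ) :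
    (x * y).coeff 0 = ∑ᶠ j : ℤ, x.coeff (-j) * y.coeff j := by
  classical
  rw [HahnSeries.coeff_mul]
  set s := Finset.antidiagonal x.isPWO_support y.isPWO_support (0 : ℤ) with hs
  have hinj : Set.InjOn Prod.snd (s : Set (ℤ × ℤ)) := by
    rintro ⟨a, b⟩ h ⟨c, d⟩ h' hbd
    rw [Finset.mem_coe, hs, Finset.mem_antidiagonal] at h h'
    simp only at h h' hbd
    ext <;> simp <;> omega
  rw [finsum_eq_sum_of_support_subset (s := s.image Prod.snd), Finset.sum_image hinj]
  · refine Finset.sum_congr rfl ?_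
    rintro ⟨a, b⟩ h
    rw [hs, Finset.mem_antidiagonal] at h
    simp only at h ⊢
    rw [show -b = a by omega]
  · intro j hj
    simp only [Function.mem_support] at hj
    refine Finset.mem_coe.2 (Finset.mem_image.2 ⟨(-j, j), ?_, rfl⟩)
    rw [hs, Finset.mem_antidiagonal]
    exact ⟨left_ne_zero_of_mul hj, right_ne_zero_of_mul hj, neg_add_cancel j⟩

variable {V : Type*} [AddCommGroup V] [Module ℂ V]

/-- The recursion determines every term from the first one because `n ≠ 0` is invertible. This is
how a shifted vacuum is recognised as a sequence of fermion modes. -/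
theorem shiftVec_eq (wt : TauVar N → ℕ) (κ : ℕ → TauVar N)
    (hκ : ∀ v, wt v ≠ 0 → κ (wt v) = v) (hκ' : ∀ j, j ≠ 0 → wt (κ j) = j) (c : ℂ)
    (J : TauVar N → Module.End ℂ V) (hJ : ∀ v w, Commute (J v) (J w)) (u : V) (p : ℕ → V)
    (h0 : p 0 = u)
    (hp : ∀ n : ℕ, (n : ℂ) • p n
      = c • ∑ j ∈ Finset.range n, J (κ (j + 1)) (p (n - (j + 1)))) (n : ℕ) :
    shiftVec wt c J u n = p n := by
  induction n using Nat.strong_induction_on with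
  | _ n ih =>
    rcases Nat.eq_zero_or_pos n with rfl | hn
    · rw [shiftVec_zero, h0]
    · have hne : (n : ℂ) ≠ 0 := Nat.cast_ne_zero.2 (by omega)
      apply smul_right_injective V hne
      change (n : ℂ) • _ = (n : ℂ) • _
      rw [shiftVec_rec wt κ hκ hκ' c J hJ, hp]
      congr 1
      refine Finset.sum_congr rfl fun j hj => ?_
      rw [ih _ (by have := Finset.mem_range.1 hj; omega)]

/-- The series with coefficients `ℓ (J^m / m! u)`. -/
def matSeries {σ : Type*} (J : σ → Module.End ℂ V) (ℓ : V →ₗ[ℂ] ℂ) (u : V) : MvPowerSeries σ ℂ :=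
  fun m => ℓ (coeff m (expSeries (linSeries J)) u)

/-- Differentiation commutes with the shift and inserts `J v` into the matrix element. As the
currents commute, `J v` can be placed next to `ℓ`, and the vector to which the shift is applied does
not change. -/
theorem pderiv_shifted (wt : TauVar N → ℕ) (κ : ℕ → TauVar N)
    (hκ : ∀ v, wt v ≠ 0 → κ (wt v) = v) (c : ℂ)
    (J : TauVar N → Module.End ℂ V) (hJ : ∀ v w, Commute (J v) (J w)) (ℓ : V →ₗ[ℂ] ℂ) (u : V)
    (e : TauVar N → BilVar N) (he : Function.Injective e)
    (hs : HasSubst fun v => X (some (e v)) + shiftSeries (τ := BilVar N) wt c v) (v : TauVar N) :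
    pderiv _ (e v) (shifted e (shiftSeries wt c) (matSeries J ℓ u))
      = shifted e (shiftSeries wt c) (matSeries J (ℓ ∘ₗ J v) u) := by
  classical
  ext m k
  rw [coeff_pderiv]
  have hcomm : (((m (e v) : ℕ) : LaurentSeries ℂ) + 1) = HahnSeries.C ((m (e v) : ℂ) + 1) := by
    rw [map_add, map_natCast, map_one]
  rw [hcomm, mul_comm, HahnSeries.C_mul_eq_smul, HahnSeries.coeff_smul, smul_eq_mul]
  rcases lt_or_ge k 0 with hk | hk
  · rw [shifted, shifted, coeff_toBilRing_of_neg _ _ hk, coeff_toBilRing_of_neg _ _ hk, mul_zero]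
  · lift k to ℕ using hk
    rw [shifted, shifted, coeff_toBilRing, coeff_toBilRing]
    by_cases hm : ∃ M : TauVar N →₀ ℕ, M.mapDomain e = m
    · obtain ⟨M, rfl⟩ := hm
      have h1 : ((M.mapDomain e + single (e v) 1).mapDomain some + single none k
          : Option (BilVar N) →₀ ℕ)
          = (M + single v 1).mapDomain (fun v => some (e v)) + single none k := by
        rw [mapDomain_add, mapDomain_add, mapDomain_single, mapDomain_single,
          ← mapDomain_comp]
        rfl
      have h2 : ((M.mapDomain e).mapDomain some + single none k : Option (BilVar N) →₀ ℕ)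
          = M.mapDomain (fun v => some (e v)) + single none k := by
        rw [← mapDomain_comp]
        rfl
      rw [h1, h2, coeff_subst_shift wt κ hκ c J hJ ℓ u (matSeries J ℓ u) (fun _ => rfl) e he hs,
        coeff_subst_shift wt κ hκ c J hJ (ℓ ∘ₗ J v) u (matSeries J (ℓ ∘ₗ J v) u) (fun _ => rfl) e he hs,
        mapDomain_apply he, ← smul_eq_mul, ← map_smul, ← LinearMap.smul_apply,
        coeff_exp_single J hJ]
      rfl
    · obtain ⟨w, hw, hmw⟩ : ∃ w, w ∉ Set.range e ∧ m w ≠ 0 := by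
        by_contra! hcon
        apply hm
        refine ⟨m.comapDomain e he.injOn, mapDomain_comapDomain e he m ?_⟩
        intro w hw
        by_contra h
        exact (Finsupp.mem_support_iff.1 hw) (hcon w h)
      have hmem : ∀ d : BilVar N →₀ ℕ, d w ≠ 0 →
          (d.mapDomain Option.some + single none k : Option (BilVar N) →₀ ℕ) (Option.some w) ≠ 0 := by
        intro d hd
        rw [Finsupp.add_apply, mapDomain_apply (Option.some_injective _)]
        omega
      rw [coeff_subst_shift_eq_zero wt c _ e hs _ hw (hmem _ ?_),
        coeff_subst_shift_eq_zero wt c _ e hs _ hw (hmem _ hmw), mul_zero]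
      rw [Finsupp.add_apply]; omega

theorem pderiv_shifted_of_notMem (wt : TauVar N → ℕ) (c : ℂ) (F : MvPowerSeries (TauVar N) ℂ)
    (e : TauVar N → BilVar N)
    (hs : HasSubst fun v => X (some (e v)) + shiftSeries (τ := BilVar N) wt c v)
    {w : BilVar N} (hw : w ∉ Set.range e) :
    pderiv _ w (shifted e (shiftSeries wt c) F) = 0 := by
  ext m k
  rw [coeff_pderiv]
  have h0 : coeff (m + single w 1) (shifted e (shiftSeries wt c) F) = 0 := by
    ext k
    rcases lt_or_ge k 0 with hk | hk
    · rw [shifted, coeff_toBilRing_of_neg _ _ hk]; rfl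
    · lift k to ℕ using hk
      rw [shifted, coeff_toBilRing, coeff_subst_shift_eq_zero wt c _ e hs _ hw]
      · rfl
      · rw [Finsupp.add_apply, mapDomain_apply (Option.some_injective _), Finsupp.add_apply,
          single_eq_same]
        omega
  rw [h0, zero_mul, map_zero]

/-- The matrix elements of a vertex operator: dressing the shifted series by `z ^ a` and the
exponential factor produces the modes `P j`. -/
theorem coeff_vertex (wt : TauVar N → ℕ) (κ : ℕ → TauVar N)
    (hκ : ∀ v, wt v ≠ 0 → κ (wt v) = v) (hκ' : ∀ j, j ≠ 0 → wt (κ j) = j) (c : ℂ)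
    (J : TauVar N → Module.End ℂ V) (hJ : ∀ v w, Commute (J v) (J w))
    (P : ℤ → Module.End ℂ V)
    (hJP : ∀ v j x, J v (P j x) = P j (J v x) + if wt v = 0 then 0 else c • P (j - wt v) x)
    (ℓ : V →ₗ[ℂ] ℂ) (a : ℤ) (u : V) (hu : ∀ j, a < j → P j u = 0)
    (hrec : ∀ n : ℕ, (n : ℂ) • P (a - n) u
      = c • ∑ j ∈ Finset.range n, J (κ (j + 1)) (P (a - (n - (j + 1) : ℕ)) u))
    (e : TauVar N → BilVar N) (he : Function.Injective e)
    (hs : HasSubst fun v => X (some (e v)) + shiftSeries (τ := BilVar N) wt c v)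
    (E : BilRing N) (hE0 : coeff 0 E = 1)
    (hE : ∀ v, pderiv _ (e v) E = C (if wt v = 0 then 0 else HahnSeries.single (-(wt v : ℤ)) (-c)) * E)
    (M : TauVar N →₀ ℕ) (j : ℤ) :
    (coeff (M.mapDomain e) (C (zPow a) * E *
        shifted e (shiftSeries wt c) (matSeries J ℓ (P a u)))).coeff (-j)
      = ℓ (P j (coeff M (expSeries (linSeries J)) u)) := by
  classical
  induction M using exponent_induction generalizing ℓ j with
  | h0 =>
    rw [mapDomain_zero, mul_assoc, coeff_C_mul, coeff_zero_eq_constantCoeff, map_mul,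
      ← coeff_zero_eq_constantCoeff, hE0, one_mul, coeff_zPow_mul, coeff_zero_exp]
    -- At time zero only the action on `u` remains: modes above `a` vanish on `u`, and the shift
    -- produces `P (a - n) u` in front of `z^{a - n}`.
    rcases lt_or_ge a j with h | h
    · rw [shifted, coeff_toBilRing_of_neg _ _ (by omega), Module.End.one_apply, hu j h, map_zero]
    · obtain ⟨n, hn⟩ := Int.eq_ofNat_of_zero_le (a := -j + a) (by omega)
      rw [hn, shifted, coeff_toBilRing]
      have := coeff_subst_shift wt κ hκ c J hJ ℓ (P a u) (matSeries J ℓ (P a u)) (fun _ => rfl) e he hs 0 n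
      rw [mapDomain_zero] at this ⊢
      refine this.trans ?_
      rw [coeff_zero_exp, shiftVec_eq wt κ hκ hκ' c J hJ _ (fun n => P (a - n) u) (by simp) hrec]
      simp only [Module.End.one_apply]
      rw [show a - (n : ℤ) = j by omega]
  | hadd M v ih =>
    have hne : ((M v : ℂ) + 1) ≠ 0 := Nat.cast_add_one_ne_zero _
    apply mul_left_cancel₀ hne
    -- The derivative of `E` contributes `-c z^{wt v}`, that of the shifted series replaces `ℓ` by
    -- `ℓ ∘ₗ J v`; hence the induction is over all `ℓ` and `j`.
    have hd : pderiv _ (e v) (C (zPow a) * E *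
          shifted e (shiftSeries wt c) (matSeries J ℓ (P a u)))
        = C (if wt v = 0 then 0 else HahnSeries.single (-(wt v : ℤ)) (-c)) * (C (zPow a) * E *
            shifted e (shiftSeries wt c) (matSeries J ℓ (P a u)))
          + C (zPow a) * E * shifted e (shiftSeries wt c) (matSeries J (ℓ ∘ₗ J v) (P a u)) := by
      rw [Derivation.leibniz, Derivation.leibniz, hE, pderiv_C,
        pderiv_shifted wt κ hκ c J hJ ℓ _ e he hs]
      simp only [smul_eq_mul, mul_zero, add_zero]
      ring
    have h1 := congrArg (fun x => (coeff (M.mapDomain e) x).coeff (-j)) hd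
    have hcomm : (((M v : ℕ) : LaurentSeries ℂ) + 1) = HahnSeries.C ((M v : ℂ) + 1) := by
      rw [map_add, map_natCast, map_one]
    simp only [coeff_pderiv, mapDomain_apply he] at h1
    rw [hcomm, mul_comm, HahnSeries.C_mul_eq_smul, HahnSeries.coeff_smul, smul_eq_mul, map_add,
      HahnSeries.coeff_add, ih, coeff_C_mul] at h1
    rw [mapDomain_add, mapDomain_single, h1, ← smul_eq_mul (_ + _), ← map_smul, ← map_smul,
      ← LinearMap.smul_apply, coeff_exp_single J hJ]
    -- The commutator term `c • P (j - wt v)` cancels the contribution of the exponential factor.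
    rw [LinearMap.comp_apply, hJP, Module.End.mul_apply, map_add]
    split_ifs with hw
    · simp
    · rw [HahnSeries.coeff_single_mul,
        show -j - -(wt v : ℤ) = -(j - wt v) by ring, ih, map_smul, smul_eq_mul]
      ring

theorem coeff_eq_zero_of_pderiv {F : BilRing N} {w : BilVar N} (h : pderiv _ w F = 0)
    {m : BilVar N →₀ ℕ} (hm : m w ≠ 0) : coeff m F = 0 := by
  have hle : single w 1 ≤ m := by rw [Finsupp.single_le_iff]; omega
  have h1 := congrArg (coeff (m - single w 1)) h
  rw [coeff_pderiv, tsub_add_cancel_of_le hle, map_zero] at h1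
  rcases mul_eq_zero.1 h1 with h2 | h2
  · exact h2
  · have h3 : HahnSeries.C (Γ := ℤ) ((((m - single w 1 : BilVar N →₀ ℕ) w : ℕ) : ℂ) + 1) = 0 := by
      rw [← h2, map_add, map_natCast, map_one]
    rw [← map_zero HahnSeries.C] at h3
    exact absurd (HahnSeries.C_injective h3) (Nat.cast_add_one_ne_zero _)

/-- The coefficients of a product of two series in disjoint sets of variables. -/
theorem coeff_mul_of_disjoint {F G : BilRing N}
    (hF : ∀ v, pderiv _ (Sum.inr v) F = 0) (hG : ∀ v, pderiv _ (Sum.inl v) G = 0)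
    (M M' : TauVar N →₀ ℕ) :
    coeff (M.mapDomain Sum.inl + M'.mapDomain Sum.inr) (F * G)
      = coeff (M.mapDomain Sum.inl) F * coeff (M'.mapDomain Sum.inr) G := by
  classical
  have hlr : ∀ (M : TauVar N →₀ ℕ) v, (M.mapDomain Sum.inl : BilVar N →₀ ℕ) (Sum.inr v) = 0 :=
    fun M v => mapDomain_of_notMem_range _ _ (by simp)
  have hrl : ∀ (M : TauVar N →₀ ℕ) v, (M.mapDomain Sum.inr : BilVar N →₀ ℕ) (Sum.inl v) = 0 :=
    fun M v => mapDomain_of_notMem_range _ _ (by simp)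
  rw [coeff_mul, Finset.sum_eq_single_of_mem (M.mapDomain Sum.inl, M'.mapDomain Sum.inr)
    (Finset.HasAntidiagonal.mem_antidiagonal.2 rfl)]
  rintro ⟨p, q⟩ hpq hne
  rw [Finset.HasAntidiagonal.mem_antidiagonal] at hpq
  simp only at hpq ⊢
  by_cases h1 : ∃ v, p (Sum.inr v) ≠ 0
  · obtain ⟨v, hv⟩ := h1
    rw [coeff_eq_zero_of_pderiv (hF v) hv, zero_mul]
  by_cases h2 : ∃ v, q (Sum.inl v) ≠ 0
  · obtain ⟨v, hv⟩ := h2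
    rw [coeff_eq_zero_of_pderiv (hG v) hv, mul_zero]
  exfalso
  push Not at h1 h2
  apply hne
  have hl : ∀ v, p (Sum.inl v) = M v := fun v => by
    have := congrArg (fun f => f (Sum.inl v)) hpq
    simpa [h2, hrl, mapDomain_apply Sum.inl_injective] using this
  have hr : ∀ v, q (Sum.inr v) = M' v := fun v => by
    have := congrArg (fun f => f (Sum.inr v)) hpq
    simpa [h1, hlr, mapDomain_apply Sum.inr_injective] using this
  ext1
  · ext (v | v)
    · rw [mapDomain_apply Sum.inl_injective]; exact hl v
    · rw [hlr]; exact h1 v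
  · ext (v | v)
    · rw [hrl]; exact h2 v
    · rw [mapDomain_apply Sum.inr_injective]; exact hr v

theorem pderiv_exp {σ B : Type*} [CommRing B] [Algebra ℂ B] (b : σ → B) (v : σ) :
    pderiv B v (expSeries (linSeries b)) = C (b v) * expSeries (linSeries b) := by
  ext m
  rw [coeff_pderiv, coeff_C_mul, ← coeff_exp_single b (fun _ _ => Commute.all _ _) m v,
    Algebra.smul_def, mul_comm]
  simp

/-- The exponential factor `e^{ξ(t - t', z)}` for the variables of positive weight. -/
def expWt (wt : TauVar N → ℕ) : BilRing N :=
  expSeries (linSeries (Sum.elim (fun v => if wt v = 0 then 0 else zPow (wt v))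
    (fun v => if wt v = 0 then 0 else -zPow (wt v))))

/-- The residue of the product of two vertex operators. -/
theorem coeff_res_vertex (wt : TauVar N → ℕ) (κ : ℕ → TauVar N)
    (hκ : ∀ v, wt v ≠ 0 → κ (wt v) = v) (hκ' : ∀ j, j ≠ 0 → wt (κ j) = j)
    (hs : ∀ (e : TauVar N → BilVar N) (c : ℂ), Function.Injective e →
      HasSubst fun v => X (some (e v)) + shiftSeries (τ := BilVar N) wt c v)
    (J : TauVar N → Module.End ℂ V) (hJ : ∀ v w, Commute (J v) (J w))
    (P P' : ℤ → Module.End ℂ V)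
    (hJP : ∀ v j x, J v (P j x)
      = P j (J v x) + if wt v = 0 then 0 else (-1 : ℂ) • P (j - wt v) x)
    (hJP' : ∀ v j x, J v (P' j x)
      = P' j (J v x) + if wt v = 0 then 0 else (1 : ℂ) • P' (j - wt v) x)
    (ℓ ℓ' : V →ₗ[ℂ] ℂ) (a b : ℤ) (u u' : V) (hu : ∀ j, a < j → P j u = 0)
    (hu' : ∀ j, b < j → P' j u' = 0)
    (hrec : ∀ n : ℕ, (n : ℂ) • P (a - n) u
      = (-1 : ℂ) • ∑ j ∈ Finset.range n, J (κ (j + 1)) (P (a - (n - (j + 1) : ℕ)) u))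
    (hrec' : ∀ n : ℕ, (n : ℂ) • P' (b - n) u'
      = (1 : ℂ) • ∑ j ∈ Finset.range n, J (κ (j + 1)) (P' (b - (n - (j + 1) : ℕ)) u'))
    (M M' : TauVar N →₀ ℕ) :
    coeff (M.mapDomain Sum.inl + M'.mapDomain Sum.inr) (res (C (zPow (a + b - 1)) * expWt wt *
        shifted Sum.inl (shiftSeries wt (-1)) (matSeries J ℓ (P a u)) *
        shifted Sum.inr (shiftSeries wt 1) (matSeries J ℓ' (P' b u'))))
      = ∑ᶠ j : ℤ, ℓ (P j (coeff M (expSeries (linSeries J)) u)) *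
          ℓ' (P' (-j) (coeff M' (expSeries (linSeries J)) u')) := by
  set b₁ : BilVar N → LaurentSeries ℂ :=
    Sum.elim (fun v => if wt v = 0 then 0 else zPow (wt v)) 0 with hb₁
  set b₂ : BilVar N → LaurentSeries ℂ :=
    Sum.elim 0 (fun v => if wt v = 0 then 0 else -zPow (wt v)) with hb₂
  have hE : expWt wt = expSeries (linSeries b₁) * expSeries (linSeries b₂) := by
    rw [← exp_add, expWt]
    congr 2
    funext w
    rcases w with v | v <;> simp [hb₁, hb₂]
  -- The factor `z^{-1}` turns the residue into a coefficient of `z^0`; the others are the leading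
  -- powers of the two vertex operators.
  have hz : zPow (a + b - 1) = zPow (-1) * (zPow a * zPow b) := by
    simp only [zPow, HahnSeries.single_mul_single, mul_one]
    rw [show -(-1) + (-a + -b) = -(a + b - 1) by ring]
  set F := C (zPow a) * expSeries (linSeries b₁) *
    shifted Sum.inl (shiftSeries wt (-1)) (matSeries J ℓ (P a u)) with hF
  set G := C (zPow b) * expSeries (linSeries b₂) *
    shifted Sum.inr (shiftSeries wt 1) (matSeries J ℓ' (P' b u')) with hG
  have hprod : C (zPow (a + b - 1)) * expWt wt *
        shifted Sum.inl (shiftSeries wt (-1)) (matSeries J ℓ (P a u)) *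
        shifted Sum.inr (shiftSeries wt 1) (matSeries J ℓ' (P' b u'))
      = C (zPow (-1)) * (F * G) := by
    have hC : (C (zPow (-1) * (zPow a * zPow b)) : BilRing N)
        = C (zPow (-1)) * (C (zPow a) * C (zPow b)) := by rw [map_mul, map_mul]
    rw [hE, hz, hC, hF, hG]
    ring
  have hFr : ∀ v, pderiv _ (Sum.inr v) F = 0 := by
    intro v
    rw [hF, Derivation.leibniz, Derivation.leibniz, pderiv_C, pderiv_exp,
      pderiv_shifted_of_notMem wt _ _ _ (hs _ _ Sum.inl_injective) (by simp)]
    simp [hb₁]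
  have hGl : ∀ v, pderiv _ (Sum.inl v) G = 0 := by
    intro v
    rw [hG, Derivation.leibniz, Derivation.leibniz, pderiv_C, pderiv_exp,
      pderiv_shifted_of_notMem wt _ _ _ (hs _ _ Sum.inr_injective) (by simp)]
    simp [hb₂]
  rw [hprod]
  change (coeff (M.mapDomain Sum.inl + M'.mapDomain Sum.inr)
    (C (zPow (-1)) * (F * G)) : LaurentSeries ℂ).coeff 1 = _
  rw [coeff_C_mul, coeff_zPow_mul, show (1 : ℤ) + -1 = 0 by norm_num,
    coeff_mul_of_disjoint hFr hGl, laurent_coeff_mul_zero]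
  refine finsum_congr fun j => ?_
  rw [hF, coeff_vertex wt κ hκ hκ' (-1) J hJ P hJP ℓ a u hu hrec _ Sum.inl_injective
    (hs _ _ Sum.inl_injective) _ (coeff_zero_exp _), hG]
  · congr 1
    have := coeff_vertex wt κ hκ hκ' 1 J hJ P' hJP' ℓ' b u' hu' hrec' _ Sum.inr_injective
      (hs _ _ Sum.inr_injective) (expSeries (linSeries b₂)) (coeff_zero_exp _) ?_ M' (-j)
    · rw [neg_neg] at this
      exact this
    · intro v
      rw [pderiv_exp, hb₂, Sum.elim_inr, zPow, HahnSeries.single_neg]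
  · intro v
    rw [pderiv_exp, hb₁, Sum.elim_inl, zPow, neg_neg]

end Vertex

/-! ### Bosonization for a pair of fermions acting on a vector space -/

section Boson
variable {V : Type*} [AddCommGroup V] [Module ℂ V]

/-- A pair of free fermions `P j`, `Q j` acting on a vector space. -/
structure IsCAR (P Q : ℤ → Module.End ℂ V) : Prop where
  PP : ∀ j k x, P j (P k x) = -P k (P j x)
  QQ : ∀ j k x, Q j (Q k x) = -Q k (Q j x)
  PQ : ∀ j k x, P j (Q k x) = (if j = k then x else 0) - Q k (P j x)

theorem IsCAR.QP {P Q : ℤ → Module.End ℂ V} (h : IsCAR P Q) (j k : ℤ) (x : V) :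
    Q k (P j x) = (if j = k then x else 0) - P j (Q k x) := by
  rw [h.PQ]; abel

theorem IsCAR.symm {P Q : ℤ → Module.End ℂ V} (h : IsCAR P Q) : IsCAR Q P where
  PP := h.QQ
  QQ := h.PP
  PQ j k x := by rw [h.QP]; simp only [eq_comm]

theorem IsCAR.neg {P Q : ℤ → Module.End ℂ V} (h : IsCAR P Q) :
    IsCAR (fun j => P (-j)) (fun j => Q (-j)) where
  PP j k x := h.PP _ _ x
  QQ j k x := h.QQ _ _ x
  PQ j k x := by rw [h.PQ]; simp only [neg_inj]

theorem eq_zero_of_eq_neg {x : V} (h : x = -x) : x = 0 := by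
  have h2 : (2 : ℂ) • x = 0 := by
    rw [two_smul]; nth_rewrite 1 [h]; exact neg_add_cancel x
  exact (smul_eq_zero.1 h2).resolve_left two_ne_zero

theorem IsCAR.PP_self {P Q : ℤ → Module.End ℂ V} (h : IsCAR P Q) (j : ℤ) (x : V) :
    P j (P j x) = 0 := eq_zero_of_eq_neg (h.PP j j x)

/-- `J = -c * ∑ b, Q b * P (b - k)`, a locally finite sum. -/
structure IsCurrent (P Q : ℤ → Module.End ℂ V) (c : ℂ) (k : ℤ) (J : Module.End ℂ V) : Prop where
  finite : ∀ x, Function.HasFiniteSupport fun b => Q b (P (b - k) x)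
  eq : ∀ x, J x = (-c) • ∑ᶠ b, Q b (P (b - k) x)

variable {P Q : ℤ → Module.End ℂ V} {c : ℂ}

/-- Only the summand `b = j` has a contraction with `P j`. -/
theorem IsCurrent.comm (h : IsCAR P Q) {k : ℤ} {J : Module.End ℂ V}
    (hJ : IsCurrent P Q c k J) (j : ℤ) (x : V) :
    J (P j x) = P j (J x) + c • P (j - k) x := by
  have e1 : ∀ b, Q b (P (b - k) (P j x))
      = P j (Q b (P (b - k) x)) - if b = j then P (j - k) x else 0 := by
    intro b
    rw [h.PP, map_neg, h.QP]
    by_cases hb : b = j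
    · subst hb; simp
    · simp [hb, Ne.symm hb]
  have hf : Function.HasFiniteSupport fun b => P j (Q b (P (b - k) x)) :=
    Set.Finite.subset (hJ.finite x) fun b hb h0 => hb (by simp only [h0, map_zero])
  have hf2 : Function.HasFiniteSupport fun b => if b = j then P (j - k) x else 0 :=
    Set.Finite.subset (Set.finite_singleton j) fun b hb => by
      by_contra hne
      exact hb (if_neg hne)
  rw [hJ.eq, hJ.eq, finsum_congr e1, finsum_sub_distrib hf hf2, smul_sub, map_smul,
    map_finsum _ (hJ.finite x), finsum_eq_single (fun b => if b = j then P (j - k) x else 0) j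
      (fun b hb => if_neg hb), if_pos rfl]
  simp [sub_eq_add_neg]

/-- Modes above `a` vanish on `u`, so the range can be lengthened to the symmetric one of length `b
- i - 1`. There the reflection exchanges two anticommuting factors, and the sum equals its negative.
-/
theorem IsCAR.sum_antisymm (h : IsCAR P Q) {a i b : ℤ} {n : ℕ} (ha : a = i + n) (hb : a < b)
    {u : V} (hu : ∀ j, a < j → P j u = 0) :
    ∑ k ∈ Finset.range n, P (b - (k + 1)) (P (i + (k + 1)) u) = 0 := by
  obtain ⟨m, hm⟩ := Int.eq_ofNat_of_zero_le (a := b - i - 1) (by omega)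
  have h1 : ∑ k ∈ Finset.range n, P (b - (k + 1)) (P (i + (k + 1)) u)
      = ∑ k ∈ Finset.range m, P (b - (k + 1)) (P (i + (k + 1)) u) := by
    refine Finset.sum_subset (Finset.range_subset_range.2 (by omega)) ?_
    intro k _ hk
    rw [Finset.mem_range] at hk
    rw [hu _ (by omega), map_zero]
  rw [h1]
  apply eq_zero_of_eq_neg
  nth_rewrite 1 [← Finset.sum_range_reflect]
  rw [← Finset.sum_neg_distrib]
  refine Finset.sum_congr rfl fun k hk => ?_
  have hk' := Finset.mem_range.1 hk
  rw [h.PP]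
  congr 3
  · omega
  · congr 1; omega

/-- The bosonization recursion: on a charged vacuum the modes of `P` are generated by the
currents. -/
theorem IsCAR.boson_rec (h : IsCAR P Q) (hc : c * c = 1) (J : ℕ → Module.End ℂ V)
    (hJ : ∀ k : ℕ, k ≠ 0 → IsCurrent P Q c k (J k)) (a : ℤ) (u : V)
    (hu : ∀ j, a < j → P j u = 0) (hu' : ∀ j, j ≤ a → Q j u = 0) (n : ℕ) :
    (n : ℂ) • P (a - n) u
      = c • ∑ j ∈ Finset.range n, J (j + 1) (P (a - (n - (j + 1) : ℕ)) u) := by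
  set i : ℤ := a - n with hi
  have e1 : ∀ j ∈ Finset.range n, J (j + 1) (P (a - (n - (j + 1) : ℕ)) u)
      = (-c) • ∑ᶠ b, Q b (P (b - (j + 1)) (P (i + (j + 1)) u)) := by
    intro j hj
    have hj' := Finset.mem_range.1 hj
    rw [(hJ (j + 1) (Nat.succ_ne_zero j)).eq]
    push_cast
    rw [show a - ((n - (j + 1) : ℕ) : ℤ) = i + (j + 1) by omega]
  -- The order of summation is exchanged. For `b > a` the sum vanishes by antisymmetry; for `b ≤ a`
  -- the operator `Q b` annihilates `u`, and the one possible contraction is at `i + (j + 1) = b`.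
  have e2 : ∀ b, ∑ j ∈ Finset.range n, Q b (P (b - (j + 1)) (P (i + (j + 1)) u))
      = if b ∈ Finset.Ioc i a then -P i u else 0 := by
    intro b
    by_cases hb : a < b
    · rw [← map_sum, h.sum_antisymm (by omega) hb hu, map_zero, if_neg]
      rw [Finset.mem_Ioc]; omega
    · have hterm : ∀ j ∈ Finset.range n, Q b (P (b - (j + 1)) (P (i + (j + 1)) u))
          = if i + (j + 1) = b then -P i u else 0 := by
        intro j _
        rw [h.QP, if_neg (by omega), h.QP, hu' b (by omega)]
        by_cases hij : i + (j + 1) = b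
        · rw [if_pos hij, if_pos hij, show b - ((j : ℤ) + 1) = i by omega]; simp
        · simp [hij]
      rw [Finset.sum_congr rfl hterm]
      by_cases hb2 : i < b
      · rw [if_pos (Finset.mem_Ioc.2 ⟨hb2, by omega⟩),
          Finset.sum_eq_single_of_mem (b - i - 1).toNat (Finset.mem_range.2 (by omega))]
        · rw [if_pos (by omega)]
        · intro j _ hj
          rw [if_neg (by omega)]
      · rw [if_neg (by rw [Finset.mem_Ioc]; omega)]
        refine Finset.sum_eq_zero fun j _ => if_neg (by omega)
  have hfin : ∀ j ∈ Finset.range n, Function.HasFiniteSupport fun b =>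
      Q b (P (b - (j + 1)) (P (i + (j + 1)) u)) := by
    intro j _
    have := (hJ (j + 1) (Nat.succ_ne_zero j)).finite (P (i + (j + 1)) u)
    push_cast at this
    exact this
  -- The factor `n` is the number of integers in `Ioc i a`, where `i = a - n`.
  rw [Finset.sum_congr rfl e1, ← Finset.smul_sum, ← finsum_sum_comm _ _ hfin, finsum_congr e2,
    smul_smul, mul_neg, hc, finsum_eq_sum_of_support_subset (s := Finset.Ioc i a),
    Finset.sum_congr rfl (fun b hb => if_pos hb), Finset.sum_const, Int.card_Ioc,
    ← Nat.cast_smul_eq_nsmul ℂ, show (a - i).toNat = n by omega]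
  · simp
  · intro b hb
    by_contra hne
    exact hb (if_neg (fun h => hne (Finset.mem_coe.2 h)))

/-- Charged vacua: a sequence of states obtained from a vacuum by filling or emptying successive
modes. -/
theorem IsCAR.charged (h : IsCAR P Q) (u : ℤ → V) (h0 : ∀ j, 0 ≤ j → P j (u 0) = 0)
    (h0' : ∀ j, j < 0 → Q j (u 0) = 0) (hup : ∀ s, 0 ≤ s → u (s + 1) = Q s (u s))
    (hdown : ∀ s, s ≤ 0 → u (s - 1) = P (s - 1) (u s)) (s : ℤ) :
    (∀ j, s ≤ j → P j (u s) = 0) ∧ ∀ j, j < s → Q j (u s) = 0 := by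
  induction s using Int.induction_on with
  | zero => exact ⟨h0, h0'⟩
  | succ n ih =>
    rw [hup _ (Int.natCast_nonneg n)]
    refine ⟨fun j hj => ?_, fun j hj => ?_⟩
    · rw [h.PQ, if_neg (by omega), ih.1 j (by omega), map_zero, sub_zero]
    · rcases eq_or_ne j n with rfl | hne
      · exact h.symm.PP_self _ _
      · rw [h.QQ, ih.2 j (by omega), map_zero, neg_zero]
  | pred n ih =>
    rw [hdown _ (by omega)]
    refine ⟨fun j hj => ?_, fun j hj => ?_⟩
    · rcases eq_or_ne j (-n - 1) with rfl | hne
      · exact h.PP_self _ _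
      · rw [h.PP, ih.1 j (by omega), map_zero, neg_zero]
    · rw [h.QP, if_neg (by omega), ih.2 j (by omega), map_zero, sub_zero]

/-- For `s > 0` the state was obtained by filling the mode `s - 1`, and `P (s - 1)` empties it
again. -/
theorem IsCAR.charged_down (h : IsCAR P Q) (u : ℤ → V) (h0 : ∀ j, 0 ≤ j → P j (u 0) = 0)
    (h0' : ∀ j, j < 0 → Q j (u 0) = 0) (hup : ∀ s, 0 ≤ s → u (s + 1) = Q s (u s))
    (hdown : ∀ s, s ≤ 0 → u (s - 1) = P (s - 1) (u s)) (s : ℤ) :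
    P (s - 1) (u s) = u (s - 1) := by
  rcases le_or_gt s 0 with hs | hs
  · exact (hdown s hs).symm
  · have h1 := hup (s - 1) (by omega)
    rw [sub_add_cancel] at h1
    rw [h1, h.PQ, if_pos rfl, (h.charged u h0 h0' hup hdown (s - 1)).1 _ le_rfl, map_zero, sub_zero]

theorem IsCAR.charged_up (h : IsCAR P Q) (u : ℤ → V) (h0 : ∀ j, 0 ≤ j → P j (u 0) = 0)
    (h0' : ∀ j, j < 0 → Q j (u 0) = 0) (hup : ∀ s, 0 ≤ s → u (s + 1) = Q s (u s))
    (hdown : ∀ s, s ≤ 0 → u (s - 1) = P (s - 1) (u s)) (s : ℤ) :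
    Q s (u s) = u (s + 1) := by
  rcases le_or_gt 0 s with hs | hs
  · exact (hup s hs).symm
  · have h1 := hdown (s + 1) (by omega)
    rw [add_sub_cancel_right] at h1
    rw [h1, h.QP, if_pos rfl, (h.charged u h0 h0' hup hdown (s + 1)).2 _ (by omega), map_zero,
      sub_zero]

end Boson

/-! ### The fermionic bilinear identity -/

section Shuffle
variable {α : Type*}

/-- The two subwords of a word in two colours. -/
def splitWord : List (α × Bool) → List α × List α
  | [] => ([], [])
  | (a, true) :: w => (a :: (splitWord w).1, (splitWord w).2)
  | (a, false) :: w => ((splitWord w).1, a :: (splitWord w).2)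

/-- Sorting the shuffles by the colour of their first letter gives Pascal's rule. -/
theorem exists_shuffles (u v : List α) : ∃ s : Finset (List (α × Bool)),
    (∀ x, x ∈ s ↔ splitWord x = (u, v)) ∧ s.card = (u.length + v.length).choose u.length := by
  classical
  have hinj : ∀ p : α × Bool, Function.Injective (List.cons p) := fun p _ _ h => by simpa using h
  induction u generalizing v with
  | nil =>
    refine ⟨{v.map fun a => (a, false)}, fun x => ?_, by simp⟩
    rw [Finset.mem_singleton]
    induction x generalizing v with
    | nil => cases v <;> simp [splitWord]
    | cons p x ih =>
      obtain ⟨a, b⟩ := p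
      cases b
      · cases v with
        | nil => simp [splitWord]
        | cons b v =>
          have := ih v
          simp only [splitWord, List.map_cons, List.cons.injEq, Prod.mk.injEq, and_true] at this ⊢
          rw [this, Prod.ext_iff]
          tauto
      · cases v <;> simp [splitWord]
  | cons a u ihu =>
    induction v with
    | nil =>
      refine ⟨{(a :: u).map fun a => (a, true)}, fun x => ?_, by simp⟩
      rw [Finset.mem_singleton]
      generalize a :: u = u
      clear ihu
      induction x generalizing u with
      | nil => cases u <;> simp [splitWord]
      | cons p x ih =>
        obtain ⟨a, b⟩ := p
        cases b
        · cases u <;> simp [splitWord]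
        · cases u with
          | nil => simp [splitWord]
          | cons b v =>
            have := ih v
            simp only [splitWord, List.map_cons, List.cons.injEq, Prod.mk.injEq, and_true] at this ⊢
            rw [this, Prod.ext_iff]
            tauto
    | cons b v ihv =>
      obtain ⟨s₁, h₁, c₁⟩ := ihu (b :: v)
      obtain ⟨s₂, h₂, c₂⟩ := ihv
      refine ⟨s₁.image (List.cons (a, true)) ∪ s₂.image (List.cons (b, false)), fun x => ?_, ?_⟩
      · rw [Finset.mem_union, Finset.mem_image, Finset.mem_image]
        constructor
        · rintro (⟨x, hx, rfl⟩ | ⟨x, hx, rfl⟩)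
          · simp [splitWord, (h₁ x).1 hx]
          · simp [splitWord, (h₂ x).1 hx]
        · intro hx
          rcases x with _ | ⟨⟨p, c⟩, x⟩
          · simp [splitWord] at hx
          · cases c
            · right
              simp only [splitWord, Prod.mk.injEq, List.cons.injEq] at hx
              refine ⟨x, (h₂ x).2 (Prod.ext hx.1 hx.2.2), by rw [hx.2.1]⟩
            · left
              simp only [splitWord, Prod.mk.injEq, List.cons.injEq] at hx
              refine ⟨x, (h₁ x).2 (Prod.ext hx.1.2 hx.2), by rw [hx.1.1]⟩
      · rw [Finset.card_union_of_disjoint, Finset.card_image_of_injective _ (hinj _),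
          Finset.card_image_of_injective _ (hinj _), c₁, c₂]
        · simp only [List.length_cons]
          rw [show u.length + 1 + (v.length + 1) = (u.length + (v.length + 1)) + 1 by ring,
            Nat.choose_succ_succ]
          congr 2
          ring
        · rw [Finset.disjoint_left]
          intro x hx hx'
          obtain ⟨y, _, rfl⟩ := Finset.mem_image.1 hx
          obtain ⟨z, _, hz⟩ := Finset.mem_image.1 hx'
          simp at hz

theorem splitWord_length (x : List (α × Bool)) :
    (splitWord x).1.length + (splitWord x).2.length = x.length := by
  induction x with
  | nil => rfl
  | cons p x ih =>
    obtain ⟨a, b⟩ := p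
    cases b <;> simp only [splitWord, List.length_cons] <;> omega

theorem splitWord_prod (f : α → ℂ) (x : List (α × Bool)) :
    ((splitWord x).1.map f).prod * ((splitWord x).2.map f).prod
      = ((x.map Prod.fst).map f).prod := by
  induction x with
  | nil => simp [splitWord]
  | cons p x ih =>
    obtain ⟨a, b⟩ := p
    cases b <;> simp only [splitWord, List.map_cons, List.prod_cons, ← ih] <;> ring

/-- Regrouping a sum over a map with finite fibres. -/
theorem tsum_fiber {X Y : Type*} (q : X → Y) (s : Y → Finset X) (hs : ∀ y x, x ∈ s y ↔ q x = y)
    (hne : ∀ y, (s y).card ≠ 0) (g : Y → ℂ) (hg : Summable g) :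
    Summable (fun x => g (q x) / (s (q x)).card) ∧
      ∑' x, g (q x) / (s (q x)).card = ∑' y, g y := by
  have hset : ∀ y, q ⁻¹' {y} = ↑(s y) := fun y => by ext x; simp [hs]
  have hfib : ∀ (h : Y → ℂ) y, ∑' x : q ⁻¹' {y}, h (q x) / (s (q x)).card = h y := by
    intro h y
    rw [hset, Finset.tsum_subtype' (s y) (fun x => h (q x) / (s (q x)).card),
      Finset.sum_congr rfl (g := fun _ => h y / (s y).card)
      (fun x hx => by rw [(hs y x).1 hx]), Finset.sum_const, nsmul_eq_mul]
    have : ((s y).card : ℂ) ≠ 0 := Nat.cast_ne_zero.2 (hne y)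
    field_simp
  have hsum : Summable (fun x => g (q x) / (s (q x)).card) := by
    rw [← summable_norm_iff, ← (Equiv.sigmaFiberEquiv q).summable_iff]
    refine (summable_sigma_of_nonneg (fun _ => norm_nonneg _)).2 ⟨fun y => ?_, ?_⟩
    · have : Finite {x // q x = y} := by
        refine Set.Finite.to_subtype (s := {x | q x = y}) ?_
        have : {x | q x = y} = ↑(s y) := hset y
        rw [this]
        exact (s y).finite_toSet
      exact Summable.of_finite
    · refine (summable_congr fun y => ?_).2 hg.norm
      -- The fibre formula applied to the norms themselves: they sum to `‖g y‖` over each fibre.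
      have h := hfib (fun y => ((‖g y‖ : ℝ) : ℂ)) y
      have h2 : (∑' x : q ⁻¹' {y}, (((‖g (q x)‖ / (s (q x)).card : ℝ)) : ℂ)) = ((‖g y‖ : ℝ) : ℂ) := by
        rw [← h]; push_cast; rfl
      rw [← Complex.ofReal_tsum, Complex.ofReal_inj] at h2
      rw [← h2]
      refine tsum_congr fun x => ?_
      simp [Equiv.sigmaFiberEquiv]
  refine ⟨hsum, ?_⟩
  rw [← (hsum.hasSum.tsum_fiberwise q).tsum_eq]
  exact tsum_congr (hfib g)

theorem tsum_mul_weighted {X : Type*} (c f g : X → ℂ) (hf : Summable fun w => c w * f w)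
    (hg : Summable fun w => c w * g w) :
    Summable (fun w : X × X => c w.1 * c w.2 * (f w.1 * g w.2)) ∧
      (∑' w, c w * f w) * (∑' w, c w * g w)
        = ∑' w : X × X, c w.1 * c w.2 * (f w.1 * g w.2) := by
  have e : ∀ w : X × X, c w.1 * f w.1 * (c w.2 * g w.2) = c w.1 * c w.2 * (f w.1 * g w.2) :=
    fun w => by ring
  have h1 := summable_mul_of_summable_norm (f := fun w => c w * f w) (g := fun w => c w * g w)
    hf.norm hg.norm
  have h2 := tsum_mul_tsum_of_summable_norm (f := fun w => c w * f w) (g := fun w => c w * g w)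
    hf.norm hg.norm
  simp only [e] at h1 h2
  exact ⟨h1, h2⟩

end Shuffle

/-! ### Words in fermion bilinears and the bilinear identity -/

section Bilinear
variable {N : ℕ}

theorem psi_psi (i k : Mode N) (x : Fock N) : psi i (psi k x) = -psi k (psi i x) := by
  have := congrArg (fun f : Module.End ℂ (Fock N) => f x) (psi_psi_anticomm i k)
  exact eq_neg_of_add_eq_zero_left this

theorem psiStar_psiStar (i k : Mode N) (x : Fock N) :
    psiStar i (psiStar k x) = -psiStar k (psiStar i x) := by
  have := congrArg (fun f : Module.End ℂ (Fock N) => f x) (psiStar_psiStar_anticomm i k)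
  exact eq_neg_of_add_eq_zero_left this

theorem psi_psiStar (i k : Mode N) (x : Fock N) :
    psi i (psiStar k x) = (if i = k then x else 0) - psiStar k (psi i x) := by
  have := congrArg (fun f : Module.End ℂ (Fock N) => f x) (psi_psiStar_anticomm i k)
  refine eq_sub_of_add_eq (this.trans ?_)
  split_ifs <;> rfl

theorem psiStar_psi (i k : Mode N) (x : Fock N) :
    psiStar k (psi i x) = (if i = k then x else 0) - psi i (psiStar k x) := by
  rw [psi_psiStar]; abel

/-- A state is annihilated by all but finitely many annihilation operators. -/
theorem ann_finite (x : Fock N) : {i : Mode N | ann i x ≠ 0}.Finite := by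
  induction x using CliffordAlgebra.left_induction with
  | algebraMap r =>
    refine Set.finite_empty.subset fun i hi => hi ?_
    rw [Algebra.algebraMap_eq_smul_one, map_smul]
    exact (congrArg (r • ·) (ann_vac i)).trans (smul_zero r)
  | add x y hx hy =>
    refine (hx.union hy).subset fun i hi => ?_
    by_contra hn
    simp only [Set.mem_union, Set.mem_ofPred_eq, not_or, not_not] at hn
    exact hi (by rw [map_add, hn.1, hn.2, add_zero])
  | ι_mul x m hx =>
    refine (hx.union m.support.finite_toSet).subset fun i hi => ?_
    by_contra hn
    simp only [Set.mem_union, Set.mem_ofPred_eq, not_or, not_not, Finset.mem_coe,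
      Finsupp.mem_support_iff] at hn
    apply hi
    have h := CliffordAlgebra.contractLeft_ι_mul (Q := (0 : QuadraticForm ℂ (Mode N →₀ ℂ)))
      (Finsupp.lapply i) m x
    refine h.trans ?_
    have h1 : CliffordAlgebra.contractLeft (Q := (0 : QuadraticForm ℂ (Mode N →₀ ℂ)))
      (Finsupp.lapply i) x = 0 := hn.1
    rw [h1, Finsupp.lapply_apply, hn.2, zero_smul, mul_zero, sub_zero]

/-- The pairing `∑ i, φ (ψ_i x) φ' (ψ*_i y)`. -/
def pairing (φ φ' : Module.Dual ℂ (Fock N)) (x y : Fock N) : ℂ :=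
  ∑ᶠ i, φ (psi i x) * φ' (psiStar i y)

/-- For every mode one of `ψ_i` and `ψ*_i` is an annihilation operator, so `∑ ψ_i ⊗ ψ*_i` is locally
finite. -/
theorem psi_or_psiStar_finite (x y : Fock N) :
    {i : Mode N | psi i x ≠ 0 ∧ psiStar i y ≠ 0}.Finite := by
  refine ((ann_finite x).union (ann_finite y)).subset ?_
  rintro i ⟨h1, h2⟩
  by_cases hi : 0 ≤ i.2
  · right; simpa [psiStar, hi] using h2
  · left; simpa [psi, hi] using h1

theorem pairing_finite (f g : Fock N →ₗ[ℂ] Fock N) (φ φ' : Module.Dual ℂ (Fock N)) (x y : Fock N) :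
    Function.HasFiniteSupport fun i => φ (f (psi i x)) * φ' (g (psiStar i y)) := by
  refine Set.Finite.subset (psi_or_psiStar_finite x y) fun i hi => ⟨fun h => hi ?_, fun h => hi ?_⟩
  · simp only [h, map_zero, zero_mul]
  · simp only [h, map_zero, mul_zero]

/-- Write `X = ψ*_p ψ_q`. Moving `ψ_i` past `X` leaves the extra term `ψ_q ⊗ ψ*_p`; moving `ψ*_i`
past `X` leaves the same term with the opposite sign. -/
theorem pairing_step (φ φ' : Module.Dual ℂ (Fock N)) (x y : Fock N) (p : Mode N × Mode N) :
    pairing φ φ' (psiStar p.1 (psi p.2 x)) y + pairing φ φ' x (psiStar p.1 (psi p.2 y))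
      = pairing (φ ∘ₗ (psiStar p.1 * psi p.2)) φ' x y
        + pairing φ (φ' ∘ₗ (psiStar p.1 * psi p.2)) x y := by
  obtain ⟨p, q⟩ := p
  have hs : ∀ (i₀ : Mode N) (z : Mode N → ℂ),
      (Function.HasFiniteSupport fun i => if i = i₀ then z i else 0) ∧
        (∑ᶠ i, if i = i₀ then z i else 0) = z i₀ := by
    intro i₀ z
    refine ⟨Set.Finite.subset (Set.finite_singleton i₀) fun i hi => ?_, ?_⟩
    · by_contra hne
      exact hi (if_neg hne)
    · rw [finsum_eq_single _ i₀ (fun b hb => if_neg hb), if_pos rfl]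
  have e1 : ∀ i, φ (psi i (psiStar p (psi q x))) * φ' (psiStar i y)
      = φ (psiStar p (psi q (psi i x))) * φ' (psiStar i y)
        + if i = p then φ (psi q x) * φ' (psiStar i y) else 0 := by
    intro i
    rw [psi_psiStar, psi_psi i q]
    by_cases hi : i = p
    · simp only [hi, if_true, map_sub, map_neg]; ring
    · simp only [hi, if_false, map_sub, map_neg, map_zero]; ring
  have e2 : ∀ i, φ (psi i x) * φ' (psiStar i (psiStar p (psi q y)))
      = φ (psi i x) * φ' (psiStar p (psi q (psiStar i y)))
        - if i = q then φ (psi i x) * φ' (psiStar p y) else 0 := by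
    intro i
    rw [psiStar_psiStar, psiStar_psi]
    by_cases hi : q = i
    · subst hi; simp only [if_true, map_sub, map_neg]; ring
    · simp only [hi, Ne.symm hi, if_false, map_sub, map_neg, map_zero]; ring
  have h1 := hs p fun i => φ (psi q x) * φ' (psiStar i y)
  have h2 := hs q fun i => φ (psi i x) * φ' (psiStar p y)
  have f1 := pairing_finite (psiStar p * psi q) 1 φ φ' x y
  have f2 := pairing_finite 1 (psiStar p * psi q) φ φ' x y
  simp only [Module.End.mul_apply, Module.End.one_apply] at f1 f2
  simp only [pairing, LinearMap.comp_apply, Module.End.mul_apply]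
  rw [finsum_congr e1, finsum_congr e2, finsum_add_distrib f1 h1.1, finsum_sub_distrib f2 h2.1,
    h1.2, h2.2]
  ring

theorem wordOp_cons (p : Mode N × Mode N) (w : List (Mode N × Mode N)) :
    wordOp (p :: w) = psiStar p.1 * psi p.2 * wordOp w := rfl

/-- The colourings of `w` are the terms in the expansion of the product of `X ⊗ 1 + 1 ⊗ X` over the
letters `X` of `w`. These factors pass from the states to the functionals one at a time by
`pairing_step`. -/
theorem exists_colourings (w : List (Mode N × Mode N)) :
    ∃ t : Finset (List ((Mode N × Mode N) × Bool)), (∀ z, z ∈ t ↔ z.map Prod.fst = w) ∧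
      ∀ (φ φ' : Module.Dual ℂ (Fock N)) (x y : Fock N),
        ∑ z ∈ t, pairing φ φ' (wordOp (splitWord z).1 x) (wordOp (splitWord z).2 y)
          = ∑ z ∈ t, pairing (φ ∘ₗ wordOp (splitWord z).1) (φ' ∘ₗ wordOp (splitWord z).2) x y := by
  classical
  induction w with
  | nil =>
    refine ⟨{[]}, fun z => by simp, fun φ φ' x y => ?_⟩
    rw [Finset.sum_singleton, Finset.sum_singleton]
    rfl
  | cons p w ih =>
    obtain ⟨t, ht, hsum⟩ := ih
    have hinj : ∀ q : (Mode N × Mode N) × Bool, Function.Injective (List.cons q) :=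
      fun q _ _ h => by simpa using h
    have hdisj : Disjoint (t.image (List.cons (p, true))) (t.image (List.cons (p, false))) := by
      rw [Finset.disjoint_left]
      intro x hx hx'
      obtain ⟨y, _, rfl⟩ := Finset.mem_image.1 hx
      obtain ⟨z, _, hz⟩ := Finset.mem_image.1 hx'
      simp at hz
    refine ⟨t.image (List.cons (p, true)) ∪ t.image (List.cons (p, false)), fun z => ?_, ?_⟩
    · rw [Finset.mem_union, Finset.mem_image, Finset.mem_image]
      constructor
      · rintro (⟨z, hz, rfl⟩ | ⟨z, hz, rfl⟩) <;> simp [(ht z).1 hz]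
      · intro hz
        rcases z with _ | ⟨⟨a, b⟩, z⟩
        · simp at hz
        · simp only [List.map_cons, List.cons.injEq] at hz
          obtain ⟨rfl, hz⟩ := hz
          cases b
          · exact Or.inr ⟨z, (ht z).2 hz, rfl⟩
          · exact Or.inl ⟨z, (ht z).2 hz, rfl⟩
    · intro φ φ' x y
      rw [Finset.sum_union hdisj, Finset.sum_union hdisj,
        Finset.sum_image (fun _ _ _ _ h => hinj _ h), Finset.sum_image (fun _ _ _ _ h => hinj _ h),
        Finset.sum_image (fun _ _ _ _ h => hinj _ h), Finset.sum_image (fun _ _ _ _ h => hinj _ h)]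
      simp only [splitWord, wordOp_cons]
      have h1 := hsum (φ ∘ₗ (psiStar p.1 * psi p.2)) φ' x y
      have h2 := hsum φ (φ' ∘ₗ (psiStar p.1 * psi p.2)) x y
      have h3 : ∀ (f g : Module.End ℂ (Fock N)) (φ : Module.Dual ℂ (Fock N)),
        φ ∘ₗ (f * g) = (φ ∘ₗ f) ∘ₗ g := fun _ _ _ => rfl
      simp only [h3 (_ * _) _] at h1 h2 ⊢
      rw [← h1, ← h2, ← Finset.sum_add_distrib, ← Finset.sum_add_distrib]
      refine Finset.sum_congr rfl fun z _ => ?_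
      exact pairing_step φ φ' (wordOp (splitWord z).1 x) (wordOp (splitWord z).2 y) p

/-- The weight `1 / (a! b!)` spread over `(a + b)! / (a! b!)` shuffles is `1 / (a + b)!`. This is
the word form of `exp (X ⊗ 1 + 1 ⊗ X) = exp X ⊗ exp X`. -/
theorem wordCoeff_splitWord (A : Mode N → Mode N → ℂ) (z : List ((Mode N × Mode N) × Bool)) :
    wordCoeff A (splitWord z).1 * wordCoeff A (splitWord z).2
        / (((splitWord z).1.length + (splitWord z).2.length).choose (splitWord z).1.length : ℕ)
      = wordCoeff A (z.map Prod.fst) := by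
  have h1 := splitWord_prod (fun p : Mode N × Mode N => A p.1 p.2) z
  have h2 := splitWord_length z
  simp only [wordCoeff, List.length_map, ← h1, ← h2]
  generalize (splitWord z).1.length = a
  generalize (splitWord z).2.length = b
  have h3 := congrArg (Nat.cast (R := ℂ)) (Nat.add_choose_mul_factorial_mul_factorial a b)
  rw [← Nat.choose_symm_add] at h3
  push_cast at h3
  have ha : (a.factorial : ℂ) ≠ 0 := Nat.cast_ne_zero.2 a.factorial_ne_zero
  have hb : (b.factorial : ℂ) ≠ 0 := Nat.cast_ne_zero.2 b.factorial_ne_zero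
  have hab : ((a + b).factorial : ℂ) ≠ 0 := Nat.cast_ne_zero.2 (a + b).factorial_ne_zero
  have hc : ((a + b).choose a : ℂ) ≠ 0 :=
    Nat.cast_ne_zero.2 (Nat.choose_pos (Nat.le_add_right a b)).ne'
  rw [← h3]
  field_simp

/-- Summing over pairs of words is the same as summing over the colourings of one word. -/
theorem tsum_words (A : Mode N → Mode N → ℂ)
    (t : List (Mode N × Mode N) → Finset (List ((Mode N × Mode N) × Bool)))
    (ht : ∀ w z, z ∈ t w ↔ z.map Prod.fst = w)
    (f : List (Mode N × Mode N) × List (Mode N × Mode N) → ℂ)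
    (hf : Summable fun y => wordCoeff A y.1 * wordCoeff A y.2 * f y) :
    ∑' y, wordCoeff A y.1 * wordCoeff A y.2 * f y
      = ∑' w, wordCoeff A w * ∑ z ∈ t w, f (splitWord z) := by
  choose s hs hcard using fun y : List (Mode N × Mode N) × List (Mode N × Mode N) =>
    exists_shuffles y.1 y.2
  obtain ⟨h1, h2⟩ := tsum_fiber splitWord s (fun y x => hs y x)
    (fun y => by rw [hcard]; exact (Nat.choose_pos (Nat.le_add_right _ _)).ne') _ hf
  have e : ∀ z, wordCoeff A (splitWord z).1 * wordCoeff A (splitWord z).2 * f (splitWord z)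
      / (s (splitWord z)).card = wordCoeff A (z.map Prod.fst) * f (splitWord z) := by
    intro z
    rw [← wordCoeff_splitWord, hcard]
    ring
  rw [← h2, ← (h1.hasSum.tsum_fiberwise (List.map Prod.fst)).tsum_eq]
  refine tsum_congr fun w => ?_
  have hset : List.map Prod.fst ⁻¹' {w} = (t w : Set (List ((Mode N × Mode N) × Bool))) := by
    ext z; simp [ht]
  rw [hset, Finset.tsum_subtype' (t w) (fun z => wordCoeff A (splitWord z).1 *
    wordCoeff A (splitWord z).2 * f (splitWord z) / (s (splitWord z)).card), Finset.mul_sum]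
  exact Finset.sum_congr rfl fun z hz => by rw [e, (ht w z).1 hz]

/-- The dual Fock space `⟨0| a`, `a` in the algebra of fermions. -/
def dualFock (N : ℕ) : Submodule ℂ (Module.Dual ℂ (Fock N)) where
  carrier := {φ | ∃ a ∈ fermionAlg N, φ = dualVac N ∘ₗ a}
  add_mem' := by
    rintro _ _ ⟨a, ha, rfl⟩ ⟨b, hb, rfl⟩
    exact ⟨a + b, add_mem ha hb, (LinearMap.comp_add _ _ _).symm⟩
  zero_mem' := ⟨0, zero_mem _, (LinearMap.comp_zero _).symm⟩
  smul_mem' := by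
    rintro c _ ⟨a, ha, rfl⟩
    exact ⟨c • a, Subalgebra.smul_mem _ ha c, (LinearMap.comp_smul _ _ _).symm⟩

theorem psi_mem (i : Mode N) : psi i ∈ fermionAlg N :=
  Algebra.subset_adjoin (Or.inl ⟨i, rfl⟩)

theorem psiStar_mem (i : Mode N) : psiStar i ∈ fermionAlg N :=
  Algebra.subset_adjoin (Or.inr ⟨i, rfl⟩)

theorem dualVac_mem : dualVac N ∈ dualFock N := ⟨1, one_mem _, rfl⟩

theorem dualFock_comp {φ : Module.Dual ℂ (Fock N)} (hφ : φ ∈ dualFock N)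
    {a : Module.End ℂ (Fock N)} (ha : a ∈ fermionAlg N) : φ ∘ₗ a ∈ dualFock N := by
  obtain ⟨b, hb, rfl⟩ := hφ
  exact ⟨b * a, mul_mem hb ha, rfl⟩

/-- The dual Fock space is generated from the dual vacuum by the fermions. -/
theorem dualFock_induction {p : Module.Dual ℂ (Fock N) → Prop} (h0 : p (dualVac N))
    (hadd : ∀ φ φ', p φ → p φ' → p (φ + φ')) (hsmul : ∀ (c : ℂ) φ, p φ → p (c • φ))
    (hpsi : ∀ i φ, φ ∈ dualFock N → p φ → p (φ ∘ₗ psi i))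
    (hpsiStar : ∀ i φ, φ ∈ dualFock N → p φ → p (φ ∘ₗ psiStar i))
    {φ : Module.Dual ℂ (Fock N)} (hφ : φ ∈ dualFock N) : p φ := by
  obtain ⟨a, ha, rfl⟩ := hφ
  have key : ∀ a ∈ fermionAlg N, ∀ φ ∈ dualFock N, p φ → p (φ ∘ₗ a) := by
    intro a ha
    induction ha using Algebra.adjoin_induction with
    | mem x hx =>
      rcases hx with ⟨i, rfl⟩ | ⟨i, rfl⟩
      · exact hpsi i
      · exact hpsiStar i
    | algebraMap r =>
      intro φ _ h
      have e : φ ∘ₗ algebraMap ℂ (Module.End ℂ (Fock N)) r = r • φ :=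
        LinearMap.ext fun x => by
          rw [LinearMap.comp_apply, Module.algebraMap_end_apply, map_smul, LinearMap.smul_apply]
      rw [e]
      exact hsmul r φ h
    | add x y _ _ hx hy =>
      intro φ hφ h
      rw [LinearMap.comp_add]
      exact hadd _ _ (hx φ hφ h) (hy φ hφ h)
    | mul x y hxm _ hx hy => exact fun φ hφ h => hy _ (dualFock_comp hφ hxm) (hx φ hφ h)
  exact key a ha _ dualVac_mem h0

/-- For `i.2 ≥ 0` the operator `ψ_i` can be moved to the dual vacuum, which it annihilates, unless
it meets one of the finitely many factors `ψ*_i` of `φ`. -/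
theorem finite_comp_psi {φ : Module.Dual ℂ (Fock N)} (hφ : φ ∈ dualFock N) :
    {i : Mode N | 0 ≤ i.2 ∧ φ ∘ₗ psi i ≠ 0}.Finite := by
  refine dualFock_induction (p := fun φ => {i : Mode N | 0 ≤ i.2 ∧ φ ∘ₗ psi i ≠ 0}.Finite)
    ?_ ?_ ?_ ?_ ?_ hφ
  · refine Set.finite_empty.subset fun i hi => hi.2 ?_
    refine LinearMap.ext fun x => ?_
    exact dualVac_psi i hi.1 x
  · intro φ φ' h h'
    refine (h.union h').subset fun i hi => ?_
    by_contra hn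
    simp only [Set.mem_union, Set.mem_ofPred_eq, not_or, not_and, not_not] at hn
    exact hi.2 (by rw [LinearMap.add_comp, hn.1 hi.1, hn.2 hi.1, add_zero])
  · intro c φ h
    refine h.subset fun i hi => ⟨hi.1, fun hn => hi.2 ?_⟩
    rw [LinearMap.smul_comp, hn, smul_zero]
  · intro k φ _ h
    refine h.subset fun i hi => ⟨hi.1, fun hn => hi.2 ?_⟩
    refine LinearMap.ext fun x => ?_
    have := LinearMap.congr_fun hn (psi k x)
    simp only [LinearMap.comp_apply, LinearMap.zero_apply] at this ⊢
    rw [psi_psi, map_neg, this, neg_zero]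
  · intro k φ _ h
    refine (h.union (Set.finite_singleton k)).subset fun i hi => ?_
    by_contra hne
    simp only [Set.mem_union, Set.mem_ofPred_eq, not_or, not_and, not_not,
      Set.mem_singleton_iff] at hne
    apply hi.2
    refine LinearMap.ext fun x => ?_
    have := LinearMap.congr_fun (hne.1 hi.1) (psiStar k x)
    simp only [LinearMap.comp_apply, LinearMap.zero_apply] at this ⊢
    rw [psiStar_psi, if_neg hne.2, zero_sub, map_neg, this, neg_zero]

theorem finite_comp_psiStar {φ : Module.Dual ℂ (Fock N)} (hφ : φ ∈ dualFock N) :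
    {i : Mode N | i.2 < 0 ∧ φ ∘ₗ psiStar i ≠ 0}.Finite := by
  refine dualFock_induction (p := fun φ => {i : Mode N | i.2 < 0 ∧ φ ∘ₗ psiStar i ≠ 0}.Finite)
    ?_ ?_ ?_ ?_ ?_ hφ
  · refine Set.finite_empty.subset fun i hi => hi.2 ?_
    refine LinearMap.ext fun x => ?_
    exact dualVac_psiStar i hi.1 x
  · intro φ φ' h h'
    refine (h.union h').subset fun i hi => ?_
    by_contra hn
    simp only [Set.mem_union, Set.mem_ofPred_eq, not_or, not_and, not_not] at hn
    exact hi.2 (by rw [LinearMap.add_comp, hn.1 hi.1, hn.2 hi.1, add_zero])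
  · intro c φ h
    refine h.subset fun i hi => ⟨hi.1, fun hn => hi.2 ?_⟩
    rw [LinearMap.smul_comp, hn, smul_zero]
  · intro k φ _ h
    refine (h.union (Set.finite_singleton k)).subset fun i hi => ?_
    by_contra hne
    simp only [Set.mem_union, Set.mem_ofPred_eq, not_or, not_and, not_not,
      Set.mem_singleton_iff] at hne
    apply hi.2
    refine LinearMap.ext fun x => ?_
    have := LinearMap.congr_fun (hne.1 hi.1) (psi k x)
    simp only [LinearMap.comp_apply, LinearMap.zero_apply] at this ⊢
    rw [psi_psiStar, if_neg (Ne.symm hne.2), zero_sub, map_neg, this, neg_zero]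
  · intro k φ _ h
    refine h.subset fun i hi => ⟨hi.1, fun hn => hi.2 ?_⟩
    refine LinearMap.ext fun x => ?_
    have := LinearMap.congr_fun hn (psiStar k x)
    simp only [LinearMap.comp_apply, LinearMap.zero_apply] at this ⊢
    rw [psiStar_psiStar, map_neg, this, neg_zero]

theorem summable_gElem {A : Mode N → Mode N → ℂ} (hA : WellDefined A)
    {φ : Module.Dual ℂ (Fock N)} (hφ : φ ∈ dualFock N) (x : Fock N) :
    Summable fun w => wordCoeff A w * φ (wordOp w x) := by
  obtain ⟨a, ha, rfl⟩ := hφ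
  exact hA a ha x

theorem gElem_mul {A : Mode N → Mode N → ℂ} (hA : WellDefined A)
    {φ φ' : Module.Dual ℂ (Fock N)} (hφ : φ ∈ dualFock N) (hφ' : φ' ∈ dualFock N)
    (x y : Fock N) :
    Summable (fun w : List (Mode N × Mode N) × List (Mode N × Mode N) =>
        wordCoeff A w.1 * wordCoeff A w.2 * (φ (wordOp w.1 x) * φ' (wordOp w.2 y))) ∧
      gElem A φ x * gElem A φ' y = ∑' w : List (Mode N × Mode N) × List (Mode N × Mode N),
        wordCoeff A w.1 * wordCoeff A w.2 * (φ (wordOp w.1 x) * φ' (wordOp w.2 y)) := by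
  have h := tsum_mul_weighted (wordCoeff A) (fun w => φ (wordOp w x)) (fun w => φ' (wordOp w y))
    (summable_gElem hA hφ x) (summable_gElem hA hφ' y)
  simp only [gElem]
  exact h

/-- The bilinear identity `∑ ψ_i g ⊗ ψ*_i g = ∑ g ψ_i ⊗ g ψ*_i`. -/
theorem bilinear_identity {A : Mode N → Mode N → ℂ} (hA : WellDefined A)
    {φ φ' : Module.Dual ℂ (Fock N)} (hφ : φ ∈ dualFock N) (hφ' : φ' ∈ dualFock N)
    (x y : Fock N) :
    ∑ᶠ i, gElem A (φ ∘ₗ psi i) x * gElem A (φ' ∘ₗ psiStar i) y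
      = ∑ᶠ i, gElem A φ (psi i x) * gElem A φ' (psiStar i y) := by
  classical
  choose t ht hsum using exists_colourings (N := N)
  -- The finite set of relevant modes is independent of the word that follows, so the sum over modes
  -- can be moved inside the series over words.
  have hfin : {i : Mode N | φ ∘ₗ psi i ≠ 0 ∧ φ' ∘ₗ psiStar i ≠ 0}.Finite := by
    refine ((finite_comp_psi hφ).union (finite_comp_psiStar hφ')).subset ?_
    rintro i ⟨h1, h2⟩
    rcases le_or_gt 0 i.2 with h | h
    · exact Or.inl ⟨h, h1⟩
    · exact Or.inr ⟨h, h2⟩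
  set I := hfin.toFinset with hI
  set I' := (psi_or_psiStar_finite x y).toFinset with hI'
  have g0 : ∀ x, gElem A 0 x = 0 := fun x => by simp [gElem]
  have g0' : ∀ φ, gElem A φ (0 : Fock N) = 0 := fun φ => by simp [gElem]
  have hL : ∀ F : Module.Dual ℂ (Fock N) → Module.Dual ℂ (Fock N) → ℂ,
      (∀ a, F 0 a = 0) → (∀ a, F a 0 = 0) →
      ∑ᶠ i, F (φ ∘ₗ psi i) (φ' ∘ₗ psiStar i) = ∑ i ∈ I, F (φ ∘ₗ psi i) (φ' ∘ₗ psiStar i) := by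
    intro F h1 h2
    refine finsum_eq_sum_of_support_subset _ fun i hi => ?_
    rw [hI, Set.Finite.coe_toFinset]
    exact ⟨fun h => hi (by simp only [h, h1]), fun h => hi (by simp only [h, h2])⟩
  have hR : ∀ F : Fock N → Fock N → ℂ, (∀ a, F 0 a = 0) → (∀ a, F a 0 = 0) →
      ∑ᶠ i, F (psi i x) (psiStar i y) = ∑ i ∈ I', F (psi i x) (psiStar i y) := by
    intro F h1 h2
    refine finsum_eq_sum_of_support_subset _ fun i hi => ?_
    rw [hI', Set.Finite.coe_toFinset]
    exact ⟨fun h => hi (by simp only [h, h1]), fun h => hi (by simp only [h, h2])⟩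
  rw [hL (fun a b => gElem A a x * gElem A b y) (by simp [g0]) (by simp [g0]),
    hR (fun a b => gElem A φ a * gElem A φ' b) (by simp [g0']) (by simp [g0'])]
  have hLw : ∀ u v, ∑ i ∈ I, (φ ∘ₗ psi i) u * (φ' ∘ₗ psiStar i) v = pairing φ φ' u v := by
    intro u v
    exact (hL (fun a b => a u * b v) (by simp) (by simp)).symm
  have hRw : ∀ a b : Module.End ℂ (Fock N),
      ∑ i ∈ I', φ (a (psi i x)) * φ' (b (psiStar i y)) = pairing (φ ∘ₗ a) (φ' ∘ₗ b) x y := by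
    intro a b
    exact (hR (fun u v => φ (a u) * φ' (b v)) (by simp) (by simp)).symm
  have hLg := fun i => gElem_mul hA (dualFock_comp hφ (psi_mem i))
    (dualFock_comp hφ' (psiStar_mem i)) x y
  have hRg := fun i => gElem_mul hA hφ hφ' (psi i x) (psiStar i y)
  rw [Finset.sum_congr rfl (fun i _ => (hLg i).2), Finset.sum_congr rfl (fun i _ => (hRg i).2),
    ← Summable.tsum_finsetSum (fun i _ => (hLg i).1),
    ← Summable.tsum_finsetSum (fun i _ => (hRg i).1)]
  have hLs := summable_sum (s := I) fun i _ => (hLg i).1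
  have hRs := summable_sum (s := I') fun i _ => (hRg i).1
  simp only [← Finset.mul_sum, hLw, hRw] at hLs hRs ⊢
  -- Regrouped by the underlying word, the two series agree term by term.
  rw [tsum_words A t ht (fun w => pairing φ φ' (wordOp w.1 x) (wordOp w.2 y)) hLs,
    tsum_words A t ht (fun w => pairing (φ ∘ₗ wordOp w.1) (φ' ∘ₗ wordOp w.2) x y) hRs]
  exact tsum_congr fun w => by rw [hsum w]

end Bilinear

/-! ### Charged vacua of multi-component fermions -/

section Charged
variable {N : ℕ} {V : Type*} [AddCommGroup V] [Module ℂ V]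

/-- Multi-component free fermions `P i`, `Q i` acting on a vector space. -/
structure IsMultiCAR (P Q : Mode N → Module.End ℂ V) : Prop where
  PP : ∀ i k x, P i (P k x) = -P k (P i x)
  QQ : ∀ i k x, Q i (Q k x) = -Q k (Q i x)
  PQ : ∀ i k x, P i (Q k x) = (if i = k then x else 0) - Q k (P i x)

variable {P Q : Mode N → Module.End ℂ V}

theorem IsMultiCAR.symm (h : IsMultiCAR P Q) : IsMultiCAR Q P where
  PP := h.QQ
  QQ := h.PP
  PQ i k x := by rw [h.PQ]; simp only [eq_comm]; abel

theorem IsMultiCAR.component (h : IsMultiCAR P Q) (γ : Fin N) :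
    IsCAR (fun j => P (γ, j)) (fun j => Q (γ, j)) where
  PP j k x := h.PP _ _ x
  QQ j k x := h.QQ _ _ x
  PQ j k x := by rw [h.PQ]; simp

/-- The operator which creates the charge `s` in the component `α`. -/
def chargeOp (P Q : Mode N → Module.End ℂ V) (α : Fin N) (s : ℤ) : Module.End ℂ V :=
  if 0 ≤ s then ((List.range s.toNat).reverse.map fun n : ℕ => Q (α, (n : ℤ))).prod
  else ((List.range (-s).toNat).reverse.map fun n : ℕ => P (α, -1 - (n : ℤ))).prod

theorem chargeOp_zero (α : Fin N) : chargeOp P Q α 0 = 1 := by simp [chargeOp]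

theorem chargeOp_up (α : Fin N) {s : ℤ} (hs : 0 ≤ s) :
    chargeOp P Q α (s + 1) = Q (α, s) * chargeOp P Q α s := by
  lift s to ℕ using hs
  rw [chargeOp, chargeOp, if_pos (by omega), if_pos (by omega),
    show ((s : ℤ) + 1).toNat = s + 1 by omega, Int.toNat_natCast, List.range_succ,
    List.reverse_append]
  simp

theorem chargeOp_down (α : Fin N) {s : ℤ} (hs : s ≤ 0) :
    chargeOp P Q α (s - 1) = P (α, s - 1) * chargeOp P Q α s := by
  obtain ⟨n, rfl⟩ : ∃ n : ℕ, s = -n := ⟨(-s).toNat, by omega⟩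
  rw [chargeOp, if_neg (by omega), show (-(-(n : ℤ) - 1)).toNat = n + 1 by omega, List.range_succ,
    List.reverse_append, List.reverse_singleton, List.singleton_append, List.map_cons,
    List.prod_cons, show (-1 - (n : ℤ)) = -n - 1 by ring]
  congr 1
  rcases Nat.eq_zero_or_pos n with rfl | hn
  · simp [chargeOp]
  · rw [chargeOp, if_neg (by omega), show (- -(n : ℤ)).toNat = n by omega]

/-- An operator which anticommutes with the fermions of the component `α`. -/
def AnticommutesWith (P Q : Mode N → Module.End ℂ V) (α : Fin N) (X : Module.End ℂ V) : Prop :=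
  ∀ j x, X (P (α, j) x) = -P (α, j) (X x) ∧ X (Q (α, j) x) = -Q (α, j) (X x)

theorem AnticommutesWith.chargeOp {α : Fin N} {X : Module.End ℂ V}
    (h : AnticommutesWith P Q α X) (s : ℤ) (x : V) :
    X (chargeOp P Q α s x) = (-1 : ℂ) ^ s • chargeOp P Q α s (X x) := by
  have hne : (-1 : ℂ) ≠ 0 := by norm_num
  induction s using Int.induction_on with
  | zero => simp [chargeOp_zero]
  | succ n ih =>
    rw [chargeOp_up α (Int.natCast_nonneg n), Module.End.mul_apply, (h _ _).2, ih, map_smul,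
      zpow_add_one₀ hne, Module.End.mul_apply, mul_neg_one, neg_smul]
  | pred n ih =>
    rw [chargeOp_down α (by omega), Module.End.mul_apply, (h _ _).1, ih, map_smul,
      zpow_sub_one₀ hne, Module.End.mul_apply, inv_neg_one, mul_neg_one, neg_smul]

theorem AnticommutesWith.list {X : Module.End ℂ V} (l : List (Fin N))
    (h : ∀ α ∈ l, AnticommutesWith P Q α X) (s : Fin N → ℤ) (x : V) :
    X ((l.map fun α => MultiToda.chargeOp P Q α (s α)).prod x)
      = (-1 : ℂ) ^ (l.map s).sum • (l.map fun α => MultiToda.chargeOp P Q α (s α)).prod (X x) := by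
  have hne : (-1 : ℂ) ≠ 0 := by norm_num
  induction l with
  | nil => simp
  | cons α l ih =>
    rw [List.map_cons, List.prod_cons, Module.End.mul_apply,
      (h α List.mem_cons_self).chargeOp, ih fun β hβ => h β (List.mem_cons_of_mem _ hβ),
      map_smul, smul_smul, List.map_cons, List.sum_cons, zpow_add₀ hne, Module.End.mul_apply]

theorem IsMultiCAR.anticommutesWith_P (h : IsMultiCAR P Q) {α γ : Fin N} (hne : γ ≠ α) (k : ℤ) :
    AnticommutesWith P Q α (P (γ, k)) := by
  intro j x
  refine ⟨h.PP _ _ _, ?_⟩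
  rw [h.PQ, if_neg (by simp [hne]), zero_sub]

theorem IsMultiCAR.anticommutesWith_Q (h : IsMultiCAR P Q) {α γ : Fin N} (hne : γ ≠ α) (k : ℤ) :
    AnticommutesWith P Q α (Q (γ, k)) := fun j x =>
  ⟨(h.symm.anticommutesWith_P hne k j x).2, (h.symm.anticommutesWith_P hne k j x).1⟩

/-- The charged vacuum with charges `s`. -/
def chargedState (P Q : Mode N → Module.End ℂ V) (Ω : V) (s : Fin N → ℤ) : V :=
  ((List.finRange N).reverse.map fun α => chargeOp P Q α (s α)).prod Ω

/-- The sign `(-1)^{∑_{μ > γ} s_μ}`. -/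
def tailSign (γ : Fin N) (s : Fin N → ℤ) : ℂ := (-1) ^ (∑ μ ∈ Finset.Ioi γ, s μ)

/-- The components in front of `γ` in the reversed list are those larger than `γ`; a fermion of
component `γ` has to cross their charges. -/
theorem exists_finRange_split (γ : Fin N) : ∃ l₁ l₂ : List (Fin N),
    (List.finRange N).reverse = l₂ ++ γ :: l₁ ∧ γ ∉ l₁ ∧ γ ∉ l₂ ∧
      ∀ s : Fin N → ℤ, (l₂.map s).sum = ∑ μ ∈ Finset.Ioi γ, s μ := by
  obtain ⟨l₂, l₁, hl⟩ := List.append_of_mem (List.mem_reverse.2 (List.mem_finRange γ))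
  have hp : (l₂ ++ γ :: l₁).Pairwise (fun a b => b < a) := by
    rw [← hl, List.pairwise_reverse]
    exact List.pairwise_lt_finRange N
  rw [List.pairwise_append, List.pairwise_cons] at hp
  have h2 : ∀ μ ∈ l₂, γ < μ := fun μ hμ => hp.2.2 μ hμ γ List.mem_cons_self
  refine ⟨l₁, l₂, hl, fun h => lt_irrefl _ (hp.2.1.1 γ h), fun h => lt_irrefl _ (h2 γ h), ?_⟩
  intro s
  have hnd : l₂.Nodup := hp.1.imp fun h => ne_of_gt h
  rw [← List.sum_toFinset _ hnd]
  refine Finset.sum_congr ?_ fun _ _ => rfl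
  ext μ
  rw [List.mem_toFinset, Finset.mem_Ioi]
  refine ⟨h2 μ, fun h => ?_⟩
  have hm : μ ∈ l₂ ++ γ :: l₁ := by rw [← hl]; simp
  rcases List.mem_append.1 hm with h3 | h3
  · exact h3
  · rcases List.mem_cons.1 h3 with h4 | h4
    · exact absurd h4 h.ne'
    · exact absurd (hp.2.1.1 μ h4) h.not_gt

/-- Crossing the components above `γ` costs the tail sign. What remains is the one-component
statement on charged vacua. -/
theorem chargedState_aux (h : IsMultiCAR P Q) (Ω : V) (hP : ∀ i : Mode N, 0 ≤ i.2 → P i Ω = 0)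
    (hQ : ∀ i : Mode N, i.2 < 0 → Q i Ω = 0) (γ : Fin N) (s : Fin N → ℤ) :
    (∀ j, s γ ≤ j → P (γ, j) (chargedState P Q Ω s) = 0) ∧
    (∀ j, j < s γ → Q (γ, j) (chargedState P Q Ω s) = 0) ∧
    P (γ, s γ - 1) (chargedState P Q Ω s)
      = tailSign γ s • chargedState P Q Ω (s - unitVec γ) ∧
    Q (γ, s γ) (chargedState P Q Ω s) = tailSign γ s • chargedState P Q Ω (s + unitVec γ) := by
  obtain ⟨l₁, l₂, hl, h1, h2, hsum⟩ := exists_finRange_split γ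
  set B : Module.End ℂ V := (l₂.map fun α => chargeOp P Q α (s α)).prod with hB
  set w : V := (l₁.map fun α => chargeOp P Q α (s α)).prod Ω with hw
  have hst : ∀ s' : Fin N → ℤ, (∀ μ, μ ≠ γ → s' μ = s μ) →
      chargedState P Q Ω s' = B (chargeOp P Q γ (s' γ) w) := by
    intro s' hs'
    have e : ∀ l : List (Fin N), γ ∉ l → (l.map fun α => chargeOp P Q α (s' α))
        = l.map fun α => chargeOp P Q α (s α) := by
      intro l hγ
      refine List.map_congr_left fun μ hμ => ?_
      rw [hs' μ (fun h => hγ (h ▸ hμ))]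
    rw [chargedState, hl, List.map_append, List.prod_append, List.map_cons, List.prod_cons,
      e _ h1, e _ h2]
    rfl
  have hne1 : ∀ α ∈ l₁, γ ≠ α := fun α hα h => h1 (h ▸ hα)
  have hne2 : ∀ α ∈ l₂, γ ≠ α := fun α hα h => h2 (h ▸ hα)
  have hcar := h.component γ
  -- Charges in the components below `γ` leave the vacuum conditions of component `γ` intact.
  have w0 : ∀ j, 0 ≤ j → P (γ, j) w = 0 := fun j hj => by
    rw [hw, AnticommutesWith.list l₁ (fun α hα => h.anticommutesWith_P (hne1 α hα) j),
      hP _ hj, map_zero, smul_zero]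
  have w0' : ∀ j, j < 0 → Q (γ, j) w = 0 := fun j hj => by
    rw [hw, AnticommutesWith.list l₁ (fun α hα => h.anticommutesWith_Q (hne1 α hα) j),
      hQ _ hj, map_zero, smul_zero]
  have hBP : ∀ j x, P (γ, j) (B x) = tailSign γ s • B (P (γ, j) x) := fun j x => by
    rw [hB, AnticommutesWith.list l₂ (fun α hα => h.anticommutesWith_P (hne2 α hα) j), hsum]; rfl
  have hBQ : ∀ j x, Q (γ, j) (B x) = tailSign γ s • B (Q (γ, j) x) := fun j x => by
    rw [hB, AnticommutesWith.list l₂ (fun α hα => h.anticommutesWith_Q (hne2 α hα) j), hsum]; rfl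
  set u : ℤ → V := fun k => chargeOp P Q γ k w with hu
  have u0 : u 0 = w := by rw [hu]; simp [chargeOp_zero]
  have hup : ∀ k, 0 ≤ k → u (k + 1) = Q (γ, k) (u k) := fun k hk => by
    simp only [hu, chargeOp_up γ hk]; rfl
  have hdown : ∀ k, k ≤ 0 → u (k - 1) = P (γ, k - 1) (u k) := fun k hk => by
    simp only [hu, chargeOp_down γ hk]; rfl
  have a0 : ∀ j, 0 ≤ j → P (γ, j) (u 0) = 0 := fun j hj => by rw [u0]; exact w0 j hj
  have a0' : ∀ j, j < 0 → Q (γ, j) (u 0) = 0 := fun j hj => by rw [u0]; exact w0' j hj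
  have hch := hcar.charged u a0 a0' hup hdown (s γ)
  have hd := hcar.charged_down u a0 a0' hup hdown (s γ)
  have hq := hcar.charged_up u a0 a0' hup hdown (s γ)
  have hs0 : chargedState P Q Ω s = B (u (s γ)) := hst s fun _ _ => rfl
  refine ⟨fun j hj => ?_, fun j hj => ?_, ?_, ?_⟩
  · rw [hs0, hBP, hch.1 j hj, map_zero, smul_zero]
  · rw [hs0, hBQ, hch.2 j hj, map_zero, smul_zero]
  · rw [hs0, hBP, hd, hst (s - unitVec γ) fun μ hμ => by simp [unitVec, hμ]]
    simp [unitVec, hu]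
  · rw [hs0, hBQ, hq, hst (s + unitVec γ) fun μ hμ => by simp [unitVec, hμ]]
    simp [unitVec, hu]

end Charged

/-! ### Currents -/

section GeneralCurrents
variable {V : Type*} [AddCommGroup V] [Module ℂ V] {P Q : ℤ → Module.End ℂ V} {c : ℂ} {k : ℤ}
  {J : Module.End ℂ V}

/-- Reversing the modes brings the currents `J_{-k}` into the same form as the `J_k`, with positive
index. -/
theorem IsCurrent.neg (hJ : IsCurrent P Q c k J) :
    IsCurrent (fun j => P (-j)) (fun j => Q (-j)) (-c) (-k) (-J) where
  finite x := by
    refine ((hJ.finite x).preimage (neg_injective.injOn)).subset fun b hb => ?_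
    simp only [Function.mem_support, Set.mem_preimage] at hb ⊢
    rwa [show -b - k = -(b - -k) by ring]
  eq x := by
    rw [LinearMap.neg_apply, hJ.eq, neg_neg, neg_smul, neg_neg]
    congr 1
    refine finsum_eq_of_bijective (fun b => -b) neg_bijective fun b => ?_
    rw [neg_neg, show -(-b - -k) = b - k by ring]

/-- For `k ≠ 0` the factors `Q b` and `P (b - k)` anticommute without contraction, so `P` and `Q`
can trade places. -/
theorem IsCurrent.dual (h : IsCAR P Q) (hk : k ≠ 0) (hJ : IsCurrent P Q c k J) :
    IsCurrent (fun j => Q (-j)) (fun j => P (-j)) (-c) k J := by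
  have e : ∀ b x, P (-(k - b)) (Q (-(k - b - k)) x) = -Q b (P (b - k) x) := fun b x => by
    rw [show -(k - b) = b - k by ring, show -(k - b - k) = b by ring, h.PQ,
      if_neg (by omega), zero_sub]
  have hb : Function.Bijective fun b : ℤ => k - b :=
    (Equiv.subLeft k).bijective
  refine ⟨fun x => ?_, fun x => ?_⟩
  · refine ((hJ.finite x).preimage (hb.injective.injOn)).subset fun b hb hn => hb ?_
    have h1 := e (k - b) x
    rw [sub_sub_cancel] at h1
    exact h1.trans (neg_eq_zero.2 hn)
  · rw [hJ.eq, neg_smul, ← smul_neg, ← finsum_neg_distrib, neg_neg]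
    congr 1
    exact finsum_eq_of_bijective _ hb fun b => (e b x).symm

theorem IsCurrent.commute (hJ : IsCurrent P Q c k J) {X : Module.End ℂ V}
    (hX : ∀ i j x, X (Q i (P j x)) = Q i (P j (X x))) : Commute J X := by
  refine LinearMap.ext fun x => ?_
  rw [Module.End.mul_apply, Module.End.mul_apply, hJ.eq, hJ.eq, map_smul, map_finsum _ (hJ.finite x)]
  simp only [hX]

/-- The commutator with `Q b P (b - l)` is a difference of two translates of the summand of the
current of index `k + l`. Local finiteness of that current, supplied by `J''`, lets the two sums
cancel. -/
theorem IsCurrent.commute_current (h : IsCAR P Q) {l : ℤ} {J' J'' : Module.End ℂ V} (hk : k ≠ 0)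
    (hJ : IsCurrent P Q c k J) (hJ' : IsCurrent P Q c l J') (hJ'' : IsCurrent P Q c (k + l) J'') :
    Commute J J' := by
  refine LinearMap.ext fun x => ?_
  have hd : ∀ b x, J (Q b x) = Q b (J x) - c • Q (b + k) x := fun b x => by
    have := (hJ.dual h hk).comm h.symm.neg (-b) x
    rw [neg_neg, show -(-b - k) = b + k by ring, neg_smul, ← sub_eq_add_neg] at this
    exact this
  have e : ∀ b, J (Q b (P (b - l) x)) = Q b (P (b - l) (J x))
      + c • (Q b (P (b - (k + l)) x) - Q (b + k) (P (b + k - (k + l)) x)) := fun b => by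
    rw [hd, hJ.comm h, map_add, map_smul, show b - l - k = b - (k + l) by ring,
      show b + k - (k + l) = b - l by ring, smul_sub]
    abel
  have f1 := hJ''.finite x
  have f2 : Function.HasFiniteSupport fun b => Q (b + k) (P (b + k - (k + l)) x) :=
    f1.preimage ((add_left_injective k).injOn)
  have f3 : Function.HasFiniteSupport fun b =>
      c • (Q b (P (b - (k + l)) x) - Q (b + k) (P (b + k - (k + l)) x)) := by
    refine Set.Finite.subset (f1.union f2) fun b hb => ?_
    by_contra hn
    simp only [Set.mem_union, Function.mem_support, not_or, not_not] at hn
    exact hb (by simp only [hn.1, hn.2, sub_zero, smul_zero])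
  have e2 : ∑ᶠ b, Q (b + k) (P (b + k - (k + l)) x) = ∑ᶠ b, Q b (P (b - (k + l)) x) :=
    finsum_eq_of_bijective (fun b => b + k) (Equiv.addRight k).bijective fun b => rfl
  rw [Module.End.mul_apply, Module.End.mul_apply, hJ'.eq, hJ'.eq, map_smul,
    map_finsum _ (hJ'.finite x), finsum_congr e, finsum_add_distrib (hJ'.finite _) f3,
    ← smul_finsum, finsum_sub_distrib f1 f2, e2, sub_self, smul_zero, add_zero]

end GeneralCurrents

/-! ### Currents on the Fock space and on its dual -/

section FockCurrents
variable {N : ℕ}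

theorem isMultiCAR_psi : IsMultiCAR (psi (N := N)) psiStar := ⟨psi_psi, psiStar_psiStar, psi_psiStar⟩

/-- The two modes differ, so the vacuum expectation value is `0` and normal ordering has no effect.
-/
theorem currentTerm_eq (γ : Fin N) {k : ℤ} (hk : k ≠ 0) (j : ℤ) (x : Fock N) :
    currentTerm γ k j x = -psiStar (γ, j + k) (psi (γ, j) x) := by
  have e : ∀ x, psi (γ, j) (psiStar (γ, j + k) x) = -psiStar (γ, j + k) (psi (γ, j) x) :=
    fun x => by rw [psi_psiStar, if_neg (by simp [hk]), zero_sub]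
  have hv : vev (psi (γ, j) * psiStar (γ, j + k)) = 0 := by
    rw [vev, Module.End.mul_apply]
    rcases le_or_gt 0 j with h | h
    · rw [dualVac_psi _ h]
    · rw [e, psi_vac _ h, map_zero, neg_zero, map_zero]
  rw [currentTerm, hv, zero_smul, sub_zero, Module.End.mul_apply, e]

theorem isCurrent_current (γ : Fin N) {k : ℤ} (hk : k ≠ 0) :
    IsCurrent (fun j => psi (γ, j)) (fun j => psiStar (γ, j)) 1 k (current γ k) where
  finite x := by
    refine ((currentTerm_finite γ k x).preimage (sub_left_injective (b := k)).injOn).subset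
      fun b hb hn => hb ?_
    have h1 := currentTerm_eq γ hk (b - k) x
    rw [sub_add_cancel] at h1
    exact neg_eq_zero.1 (h1.symm.trans hn)
  eq x := by
    change ∑ᶠ j, currentTerm γ k j x = _
    rw [neg_one_smul, ← finsum_neg_distrib]
    refine finsum_eq_of_bijective (fun b => b + k) (Equiv.addRight k).bijective fun j => ?_
    rw [currentTerm_eq γ hk, add_sub_cancel_right]

theorem commute_current_psi {γ : Fin N} {k : ℤ} (hk : k ≠ 0) {i : Mode N} (hi : i.1 ≠ γ) :
    Commute (current γ k) (psi i) := by
  refine (isCurrent_current γ hk).commute fun a b x => ?_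
  rw [psi_psiStar, if_neg (fun h => hi (congrArg Prod.fst h)), psi_psi, map_neg, zero_sub, neg_neg]

theorem commute_current_psiStar {γ : Fin N} {k : ℤ} (hk : k ≠ 0) {i : Mode N} (hi : i.1 ≠ γ) :
    Commute (current γ k) (psiStar i) := by
  refine (isCurrent_current γ hk).commute fun a b x => ?_
  rw [psiStar_psiStar, psiStar_psi, if_neg (fun h => hi (congrArg Prod.fst h).symm), zero_sub,
    map_neg, neg_neg]

theorem commute_current {α β : Fin N} {k l : ℤ} (hk : k ≠ 0) (hl : l ≠ 0) (hkl : k + l ≠ 0) :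
    Commute (current α k) (current β l) := by
  rcases eq_or_ne α β with rfl | hne
  · exact (isCurrent_current α hk).commute_current (isMultiCAR_psi.component α) hk
      (isCurrent_current α hl) (isCurrent_current α hkl)
  · refine ((isCurrent_current β hl).commute fun i j x => ?_).symm
    have h1 := LinearMap.congr_fun (commute_current_psiStar (γ := α) hk (i := (β, i)) hne.symm).eq
    have h2 := LinearMap.congr_fun (commute_current_psi (γ := α) hk (i := (β, j)) hne.symm).eq
    simp only [Module.End.mul_apply] at h1 h2
    rw [h1, h2]

/-- The transpose of an operator, acting on the dual Fock space. -/
def transpose (a : Module.End ℂ (Fock N)) (ha : ∀ φ ∈ dualFock N, φ ∘ₗ a ∈ dualFock N) :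
    Module.End ℂ (dualFock N) :=
  LinearMap.restrict (LinearMap.lcomp ℂ ℂ a) ha

theorem transpose_apply (a : Module.End ℂ (Fock N)) (ha : ∀ φ ∈ dualFock N, φ ∘ₗ a ∈ dualFock N)
    (φ : dualFock N) (x : Fock N) : (transpose a ha φ).1 x = φ.1 (a x) := rfl

theorem dualFock_ext {φ φ' : dualFock N} (h : ∀ x, φ.1 x = φ'.1 x) : φ = φ' :=
  Subtype.ext (LinearMap.ext h)

theorem transpose_commute {a b : Module.End ℂ (Fock N)} (ha : ∀ φ ∈ dualFock N, φ ∘ₗ a ∈ dualFock N)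
    (hb : ∀ φ ∈ dualFock N, φ ∘ₗ b ∈ dualFock N) (h : Commute a b) :
    Commute (transpose a ha) (transpose b hb) := by
  refine LinearMap.ext fun φ => dualFock_ext fun x => ?_
  have := LinearMap.congr_fun h.eq x
  simp only [Module.End.mul_apply] at this ⊢
  simp only [transpose_apply, this]

/-- The right action of `ψ_i` on the dual Fock space. -/
def psiT (i : Mode N) : Module.End ℂ (dualFock N) :=
  transpose (psi i) fun _ h => dualFock_comp h (psi_mem i)

/-- The right action of `ψ*_i` on the dual Fock space. -/
def psiStarT (i : Mode N) : Module.End ℂ (dualFock N) :=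
  transpose (psiStar i) fun _ h => dualFock_comp h (psiStar_mem i)

theorem psiT_apply (i : Mode N) (φ : dualFock N) (x : Fock N) :
    (psiT i φ).1 x = φ.1 (psi i x) := rfl

theorem psiStarT_apply (i : Mode N) (φ : dualFock N) (x : Fock N) :
    (psiStarT i φ).1 x = φ.1 (psiStar i x) := rfl

theorem isMultiCAR_psiT : IsMultiCAR (psiT (N := N)) psiStarT where
  PP i k φ := dualFock_ext fun x => by
    change (psiT i (psiT k φ)).1 x = -((psiT k (psiT i φ)).1 x)
    simp only [psiT_apply]
    rw [psi_psi, map_neg]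
  QQ i k φ := dualFock_ext fun x => by
    change (psiStarT i (psiStarT k φ)).1 x = -((psiStarT k (psiStarT i φ)).1 x)
    simp only [psiStarT_apply]
    rw [psiStar_psiStar, map_neg]
  PQ i k φ := dualFock_ext fun x => by
    have e : (((if i = k then φ else 0) - psiStarT k (psiT i φ) : dualFock N)).1 x
        = (if i = k then φ else 0 : dualFock N).1 x - (psiStarT k (psiT i φ)).1 x := rfl
    rw [e]
    simp only [psiStarT_apply, psiT_apply]
    rw [psiStar_psi]
    split_ifs
    · rw [map_sub]
    · rw [map_sub, map_zero]; rfl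

/-- Almost all `b ≥ k` are excluded by `ψ_{b - k}`, almost all `b < 0` by `ψ*_b` after anticommuting
it to the front; the range in between is finite. -/
theorem psiT_psiStarT_finite (γ : Fin N) {k : ℤ} (hk : k ≠ 0) (φ : dualFock N) :
    Function.HasFiniteSupport fun b => psiStarT (γ, b) (psiT (γ, b - k) φ) := by
  have i1 : Function.Injective fun b : ℤ => ((γ, b - k) : Mode N) := fun a b h => by simpa using h
  have i2 : Function.Injective fun b : ℤ => ((γ, b) : Mode N) := fun a b h => by simpa using h
  refine ((((finite_comp_psi φ.2).preimage i1.injOn).union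
    ((finite_comp_psiStar φ.2).preimage i2.injOn)).union (Set.finite_Icc 0 (k - 1))).subset ?_
  intro b hb
  by_contra hn
  simp only [Set.mem_union, Set.mem_preimage, Set.mem_ofPred_eq, not_or, not_and, not_not,
    Set.mem_Icc, not_le] at hn
  obtain ⟨⟨h1, h2⟩, h3⟩ := hn
  apply hb
  rcases le_or_gt 0 (b - k) with h | h
  · have : psiT (γ, b - k) φ = 0 := dualFock_ext fun x => LinearMap.congr_fun (h1 h) x
    change psiStarT (γ, b) (psiT (γ, b - k) φ) = 0
    rw [this, map_zero]
  · have hb0 : b < 0 := by omega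
    have : psiStarT (γ, b) φ = 0 := dualFock_ext fun x => LinearMap.congr_fun (h2 hb0) x
    change psiStarT (γ, b) (psiT (γ, b - k) φ) = 0
    rw [isMultiCAR_psiT.symm.PQ, this, map_zero, sub_zero, if_neg]
    intro h
    have := congrArg Prod.snd h
    simp only at this
    omega

theorem coe_finsum_psiT (γ : Fin N) {k : ℤ} (hk : k ≠ 0) (φ : dualFock N) :
    (∑ᶠ b, psiStarT (γ, b) (psiT (γ, b - k) φ) : dualFock N).1 = φ.1 ∘ₗ current γ k := by
  refine LinearMap.ext fun x => ?_
  have h := map_finsum ((LinearMap.applyₗ x).comp (dualFock N).subtype)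
    (psiT_psiStarT_finite γ hk φ)
  refine h.trans ?_
  rw [LinearMap.comp_apply]
  change _ = φ.1 (∑ᶠ j, currentTerm γ k j x)
  rw [map_finsum _ (currentTerm_finite γ k x)]
  symm
  refine finsum_eq_of_bijective (fun b => b + k) (Equiv.addRight k).bijective fun j => ?_
  rw [currentTerm_eq γ hk, add_sub_cancel_right]
  change _ = φ.1 (psi (γ, j) (psiStar (γ, j + k) x))
  rw [psi_psiStar, if_neg (by simp [hk]), zero_sub]

/-- A current is an infinite sum of fermion bilinears, but only finitely many survive next to a
given `φ`. Evolved bras thus stay where the matrix elements of `g` converge. -/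
theorem dualFock_comp_current (γ : Fin N) {k : ℤ} (hk : k ≠ 0) :
    ∀ φ ∈ dualFock N, φ ∘ₗ current γ k ∈ dualFock N := fun φ hφ => by
  rw [← coe_finsum_psiT γ hk ⟨φ, hφ⟩]
  exact Subtype.property _

/-- The right action of a current on the dual Fock space. -/
def currentT (p : TimeIdx N) : Module.End ℂ (dualFock N) :=
  transpose (current p.1 (p.2 : ℤ)) (dualFock_comp_current p.1 (by exact_mod_cast p.2.ne_zero))

theorem isCurrent_currentT (γ : Fin N) (k : ℕ+) :
    IsCurrent (fun j => psiT (γ, j)) (fun j => psiStarT (γ, j)) (-1) (k : ℤ) (currentT (γ, k)) where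
  finite φ := psiT_psiStarT_finite γ (by exact_mod_cast k.ne_zero) φ
  eq φ := by
    rw [neg_neg, one_smul]
    exact Subtype.ext (coe_finsum_psiT γ (by exact_mod_cast k.ne_zero) φ).symm

theorem currentT_comm (p q : TimeIdx N) : Commute (currentT p) (currentT q) := by
  have h1 := p.2.pos
  have h2 := q.2.pos
  exact transpose_commute _ _ (commute_current (by omega) (by omega) (by omega))

/-- The charged dual vacuum as an element of the dual Fock space. -/
def braState (s : Fin N → ℤ) : dualFock N := chargedState psiT psiStarT ⟨dualVac N, dualVac_mem⟩ s

theorem transpose_list_prod {ι : Type*} (F : ι → Module.End ℂ (dualFock N))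
    (f : ι → Module.End ℂ (Fock N)) (h : ∀ i φ x, (F i φ).1 x = φ.1 (f i x)) (l : List ι)
    (φ : dualFock N) (x : Fock N) :
    ((l.reverse.map F).prod φ).1 x = φ.1 ((l.map f).prod x) := by
  induction l generalizing φ with
  | nil => rfl
  | cons i l ih =>
    rw [List.reverse_cons, List.map_append, List.prod_append, Module.End.mul_apply, ih,
      List.map_cons, List.prod_cons, Module.End.mul_apply]
    simp [h]

/-- Transposition reverses products, and the bra is defined by products in the order opposite to
that of `chargedState`. -/
theorem coe_braState (s : Fin N → ℤ) : (braState s).1 = bra s := by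
  refine LinearMap.ext fun x => ?_
  rw [braState, chargedState, transpose_list_prod _ (fun α => chargeBra α (s α)), bra]
  · rfl
  · intro α φ x
    rw [chargeOp, chargeBra]
    split_ifs
    · exact transpose_list_prod _ _ (fun _ _ _ => rfl) _ _ _
    · exact transpose_list_prod _ _ (fun _ _ _ => rfl) _ _ _

end FockCurrents

/-! ### Tau-functions as matrix elements on the tensor product of the dual Fock space and the
Fock space -/

section Tensor
open Finsupp MvPowerSeries
open scoped TensorProduct
variable {N : ℕ}

/-- The tensor product of the dual Fock space and the Fock space. -/
def TensorFock (N : ℕ) : Type := dualFock N ⊗[ℂ] Fock N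

instance : AddCommGroup (TensorFock N) :=
  TensorProduct.addCommGroup (R := ℂ) (M := dualFock N) (N := Fock N)

instance : Module ℂ (TensorFock N) :=
  TensorProduct.instModule (R := ℂ) (M := dualFock N) (N := Fock N)

/-- The pure tensors. -/
def tmul : dualFock N →ₗ[ℂ] Fock N →ₗ[ℂ] TensorFock N := TensorProduct.mk ℂ (dualFock N) (Fock N)

theorem tensorFock_ext {E : Type*} [AddCommGroup E] [Module ℂ E] {f g : TensorFock N →ₗ[ℂ] E}
    (h : ∀ φ x, f (tmul φ x) = g (tmul φ x)) : f = g :=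
  TensorProduct.ext' (R := ℂ) (M := dualFock N) (N := Fock N) h

/-- An operator on the left factor. -/
def leftOp (a : Module.End ℂ (dualFock N)) : Module.End ℂ (TensorFock N) :=
  LinearMap.rTensor (Fock N) a

/-- An operator on the right factor. -/
def rightOp (a : Module.End ℂ (Fock N)) : Module.End ℂ (TensorFock N) :=
  LinearMap.lTensor (dualFock N) a

theorem leftOp_tmul (a : Module.End ℂ (dualFock N)) (φ : dualFock N) (x : Fock N) :
    leftOp a (tmul φ x) = tmul (a φ) x := rfl

theorem rightOp_tmul (a : Module.End ℂ (Fock N)) (φ : dualFock N) (x : Fock N) :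
    rightOp a (tmul φ x) = tmul φ (a x) := rfl

/-- The currents acting on the dual Fock space, with times `t`, and on the Fock space, with times
`t̄`. -/
def tensorCurrent : TauVar N → Module.End ℂ (TensorFock N) :=
  Sum.elim (fun p => leftOp (currentT p)) (fun p => rightOp (-current p.1 (-(p.2 : ℤ))))

theorem tensorCurrent_inl (p : TimeIdx N) (φ : dualFock N) (x : Fock N) :
    tensorCurrent (Sum.inl p) (tmul φ x) = tmul (currentT p φ) x := rfl

theorem tensorCurrent_inr (p : TimeIdx N) (φ : dualFock N) (x : Fock N) :
    tensorCurrent (Sum.inr p) (tmul φ x) = tmul φ (-current p.1 (-(p.2 : ℤ)) x) := rfl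

theorem commute_neg_current (p q : TimeIdx N) :
    Commute (-current p.1 (-(p.2 : ℤ))) (-current q.1 (-(q.2 : ℤ))) := by
  have h1 := p.2.pos
  have h2 := q.2.pos
  exact ((commute_current (by omega) (by omega) (by omega)).neg_left).neg_right

theorem commute_pos_current (p q : TimeIdx N) :
    Commute (current p.1 (p.2 : ℤ)) (current q.1 (q.2 : ℤ)) := by
  have h1 := p.2.pos
  have h2 := q.2.pos
  exact commute_current (by omega) (by omega) (by omega)

theorem commute_tensorCurrent (v w : TauVar N) :
    Commute (tensorCurrent v) (tensorCurrent w) := by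
  refine tensorFock_ext fun φ x => ?_
  simp only [Module.End.mul_apply]
  rcases v with p | p <;> rcases w with q | q
  · have := LinearMap.congr_fun (currentT_comm p q).eq φ
    simp only [Module.End.mul_apply] at this
    simp only [tensorCurrent_inl, this]
  · rfl
  · rfl
  · have := LinearMap.congr_fun (commute_neg_current p q).eq x
    simp only [Module.End.mul_apply, LinearMap.neg_apply] at this
    simp only [tensorCurrent_inr, this]

/-- The coefficients of `e^{J(t)}`, acting on the dual Fock space. -/
def evolT (m : TimeIdx N →₀ ℕ) : Module.End ℂ (dualFock N) :=
  coeff m (expSeries (linSeries currentT))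

theorem expNegJbar_eq : expNegJbar N
    = expSeries (linSeries fun p : TimeIdx N => -current p.1 (-(p.2 : ℤ))) := by
  rw [expNegJbar, neg_linSeries]

/-- The reversal of products under transposition is harmless because the currents commute. -/
theorem coe_evolT (m : TimeIdx N →₀ ℕ) (φ : dualFock N) :
    (evolT m φ).1 = φ.1 ∘ₗ coeff m (expJ N) := by
  refine congrFun (eq_of_recursion (F := fun m => (evolT m φ).1)
    (G := fun m => φ.1 ∘ₗ coeff m (expJ N))
    (fun p (f : Module.Dual ℂ (Fock N)) => f ∘ₗ current p.1 (p.2 : ℤ)) ?_ ?_ ?_) m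
  · have e := coeff_zero_exp (currentT (N := N))
    simp only [evolT, expJ, coeff_zero_exp, e]
    rfl
  · intro m p
    have := LinearMap.congr_fun (coeff_exp_single currentT currentT_comm m p) φ
    exact congrArg Subtype.val this
  · intro m p
    have h1 := coeff_exp_single _ commute_pos_current m p
    have h2 := commute_opPow _ commute_pos_current _ (fun q => commute_pos_current p q) m
    change ((m p : ℂ) + 1) • (φ.1 ∘ₗ coeff (m + single p 1) (expSeries _))
      = (φ.1 ∘ₗ coeff m (expSeries _)) ∘ₗ _
    rw [← LinearMap.comp_smul, h1, coeff_exp_eq, mul_smul_comm, h2.eq]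
    rfl

theorem comapDomain_add_single {σ τ : Type*} (e : σ → τ) (he : Function.Injective e)
    (m : τ →₀ ℕ) (v : σ) :
    (m + single (e v) 1).comapDomain e he.injOn = m.comapDomain e he.injOn + single v 1 := by
  classical
  ext w
  simp [Finsupp.single_apply, he.eq_iff]

theorem comapDomain_add_single_of_notMem {σ τ : Type*} (e : σ → τ) (he : Function.Injective e)
    (m : τ →₀ ℕ) (v : τ) (hv : ∀ w, e w ≠ v) :
    (m + single v 1).comapDomain e he.injOn = m.comapDomain e he.injOn := by
  classical
  ext w
  simp [(hv w).symm]

/-- Currents on different factors do not interact, so both sides obey the recursion of the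
exponential. -/
theorem coeff_exp_tensorCurrent (m : TauVar N →₀ ℕ) (φ : dualFock N) (x : Fock N) :
    coeff m (expSeries (linSeries tensorCurrent)) (tmul φ x)
      = tmul (evolT (m.comapDomain Sum.inl Sum.inl_injective.injOn) φ)
        (coeff (m.comapDomain Sum.inr Sum.inr_injective.injOn) (expNegJbar N) x) := by
  refine congrFun (eq_of_recursion
    (F := fun m => coeff m (expSeries (linSeries tensorCurrent)) (tmul φ x))
    (G := fun m => tmul (evolT (m.comapDomain Sum.inl Sum.inl_injective.injOn) φ)
        (coeff (m.comapDomain Sum.inr Sum.inr_injective.injOn) (expNegJbar N) x))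
    (fun v y => tensorCurrent v y) ?_ ?_ ?_) m
  · have e1 : (0 : TauVar N →₀ ℕ).comapDomain Sum.inl Sum.inl_injective.injOn = 0 := by ext; simp
    have e2 : (0 : TauVar N →₀ ℕ).comapDomain Sum.inr Sum.inr_injective.injOn = 0 := by ext; simp
    have e := coeff_zero_exp (currentT (N := N))
    simp only [e1, e2, evolT, expNegJbar_eq, coeff_zero_exp, e]
    rfl
  · intro m v
    exact LinearMap.congr_fun (coeff_exp_single _ commute_tensorCurrent m v) _
  · intro m v
    rcases v with p | p
    · have h := LinearMap.congr_fun (coeff_exp_single currentT currentT_comm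
        (m.comapDomain Sum.inl Sum.inl_injective.injOn) p) φ
      simp only [comapDomain_add_single _ Sum.inl_injective,
        comapDomain_add_single_of_notMem _ Sum.inr_injective m (Sum.inl p) (by simp)]
      rw [tensorCurrent_inl, ← LinearMap.smul_apply, ← map_smul]
      exact congrArg (fun φ => tmul φ _) h
    · have h := LinearMap.congr_fun (coeff_exp_single _ commute_neg_current
        (m.comapDomain Sum.inr Sum.inr_injective.injOn) p) x
      simp only [comapDomain_add_single _ Sum.inr_injective,
        comapDomain_add_single_of_notMem _ Sum.inl_injective m (Sum.inr p) (by simp)]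
      rw [← map_smul, tensorCurrent_inr, expNegJbar_eq]
      exact congrArg (tmul _) h

/-- The matrix elements of the group element, as a functional on the tensor product. -/
def gForm {A : Mode N → Mode N → ℂ} (hA : WellDefined A) : TensorFock N →ₗ[ℂ] ℂ :=
  TensorProduct.lift (R := ℂ) (M := dualFock N) (N := Fock N) (LinearMap.mk₂ ℂ (fun φ x => gElem A φ.1 x)
    (fun φ φ' x => by
      simp only [gElem, Submodule.coe_add, LinearMap.add_apply, mul_add]
      exact (summable_gElem hA φ.2 x).tsum_add (summable_gElem hA φ'.2 x))
    (fun c φ x => by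
      simp only [gElem, Submodule.coe_smul, LinearMap.smul_apply, smul_eq_mul, mul_left_comm _ c]
      exact tsum_mul_left)
    (fun φ x y => by
      simp only [gElem, map_add, mul_add]
      exact (summable_gElem hA φ.2 x).tsum_add (summable_gElem hA φ.2 y))
    (fun c φ x => by
      simp only [gElem, map_smul, smul_eq_mul, mul_left_comm _ c]
      exact tsum_mul_left))

theorem gForm_tmul {A : Mode N → Mode N → ℂ} (hA : WellDefined A) (φ : dualFock N) (x : Fock N) :
    gForm hA (tmul φ x) = gElem A φ.1 x := rfl

/-- In this form the times `t` and `t̄` belong to one commuting family, and the vertex operator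
results apply to both. -/
theorem tauExp_eq {A : Mode N → Mode N → ℂ} (hA : WellDefined A) (s r : Fin N → ℤ) :
    tauExp A s r = matSeries tensorCurrent (gForm hA) (tmul (braState s) (ket r)) := by
  funext m
  rw [matSeries, coeff_exp_tensorCurrent, gForm_tmul, coe_evolT, coe_braState]
  rfl

/-- Serves to remove the sign `t` with which a fermion mode produces the neighbouring charged
vacuum. -/
theorem matSeries_smul {σ V : Type*} [AddCommGroup V] [Module ℂ V] (J : σ → Module.End ℂ V)
    (ℓ : V →ₗ[ℂ] ℂ) (u : V) (c t : ℂ) (ht : t * t = 1) :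
    matSeries J ((c * t) • ℓ) (t • u) = c • matSeries J ℓ u := by
  funext m
  change (c * t) * ℓ (coeff m (expSeries (linSeries J)) (t • u))
    = c * ℓ (coeff m (expSeries (linSeries J)) u)
  rw [map_smul, map_smul, smul_eq_mul, mul_assoc, ← mul_assoc t, ht, one_mul]

/-! ### The two families of shifts -/

/-- The weights of the times `t_γ`. -/
def wtT (γ : Fin N) : TauVar N → ℕ :=
  Sum.elim (fun p => if p.1 = γ then (p.2 : ℕ) else 0) fun _ => 0

/-- The weights of the times `t̄_γ`. -/
def wtTbar (γ : Fin N) : TauVar N → ℕ :=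
  Sum.elim (fun _ => 0) fun p => if p.1 = γ then (p.2 : ℕ) else 0

theorem monomial_shiftCoeff (γ : Fin N) (c : ℂ) (p : TimeIdx N) :
    (if p.1 = γ then monomial (single none (p.2 : ℕ)) (c / (p.2 : ℕ)) else 0 :
      MvPowerSeries (Option (BilVar N)) ℂ)
      = monomial (single none (if p.1 = γ then (p.2 : ℕ) else 0))
        (if (if p.1 = γ then (p.2 : ℕ) else 0) = 0 then 0
          else c / (if p.1 = γ then (p.2 : ℕ) else 0 : ℕ)) := by
  split_ifs with h1 h2
  · exact absurd h2 p.2.ne_zero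
  · rfl
  · rw [map_zero]
  · contradiction

theorem shiftT_eq (γ : Fin N) (c : ℂ) : shiftT γ c = shiftSeries (wtT γ) c := by
  funext v
  rcases v with p | p
  · exact monomial_shiftCoeff γ c p
  · simp [shiftT, shiftSeries, shiftCoeff, wtT]

theorem shiftTbar_eq (γ : Fin N) (c : ℂ) : shiftTbar γ c = shiftSeries (wtTbar γ) c := by
  funext v
  rcases v with p | p
  · simp [shiftTbar, shiftSeries, shiftCoeff, wtTbar]
  · exact monomial_shiftCoeff γ c p

theorem zPow_weight (γ : Fin N) (p : TimeIdx N) (f : LaurentSeries ℂ → LaurentSeries ℂ) :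
    (if p.1 = γ then f (zPow p.2) else 0)
      = if (if p.1 = γ then (p.2 : ℕ) else 0) = 0 then 0
        else f (zPow (if p.1 = γ then (p.2 : ℕ) else 0 : ℕ)) := by
  split_ifs with h1 h2
  · exact absurd h2 p.2.ne_zero
  · rfl
  · rfl
  · contradiction

theorem expXi_eq (γ : Fin N) : expXi γ = expWt (wtT γ) := by
  rw [expXi, expWt]
  congr 2
  funext w
  rcases w with (p | p) | (p | p)
  · exact zPow_weight γ p id
  · simp [wtT]
  · exact zPow_weight γ p Neg.neg
  · simp [wtT]

theorem expXiBar_eq (γ : Fin N) : expXiBar γ = expWt (wtTbar γ) := by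
  rw [expXiBar, expWt]
  congr 2
  funext w
  rcases w with (p | p) | (p | p)
  · simp [wtTbar]
  · exact zPow_weight γ p id
  · simp [wtTbar]
  · exact zPow_weight γ p Neg.neg

theorem toPNat_weight (γ : Fin N) (p : TimeIdx N) (h : (if p.1 = γ then (p.2 : ℕ) else 0) ≠ 0) :
    ((γ, (if p.1 = γ then (p.2 : ℕ) else 0).toPNat') : TimeIdx N) = p := by
  split_ifs at h ⊢ with h1
  · exact Prod.ext h1.symm (PNat.coe_toPNat' _)
  · exact absurd rfl h

end Tensor

/-! ### The bilinear equation -/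

section Toda
open Finsupp MvPowerSeries
variable {N : ℕ}

/-- Contractions occur only within one component; fermions of other components commute with the
current. -/
theorem currentT_psiT (p : TimeIdx N) (γ : Fin N) (j : ℤ) (φ : dualFock N) :
    currentT p (psiT (γ, j) φ) = psiT (γ, j) (currentT p φ)
      + if p.1 = γ then (-1 : ℂ) • psiT (γ, j - p.2) φ else 0 := by
  obtain ⟨α, k⟩ := p
  split_ifs with h
  · obtain rfl : α = γ := h
    exact (isCurrent_currentT α k).comm (isMultiCAR_psiT.component α) j φ
  · have hk : (k : ℤ) ≠ 0 := by exact_mod_cast k.ne_zero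
    have := LinearMap.congr_fun (transpose_commute (dualFock_comp_current α hk)
      (fun _ h => dualFock_comp h (psi_mem (γ, j)))
      (commute_current_psi hk (i := (γ, j)) (Ne.symm h))).eq φ
    rw [add_zero]
    exact this

theorem isCurrent_currentT_dual (γ : Fin N) (k : ℕ+) :
    IsCurrent (fun j => psiStarT (γ, -j)) (fun j => psiT (γ, -j)) 1 (k : ℤ) (currentT (γ, k)) := by
  have h := (isCurrent_currentT γ k).dual (isMultiCAR_psiT.component γ)
    (by exact_mod_cast k.ne_zero)
  rw [neg_neg] at h
  exact h

theorem currentT_psiStarT (p : TimeIdx N) (γ : Fin N) (j : ℤ) (φ : dualFock N) :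
    currentT p (psiStarT (γ, -j) φ) = psiStarT (γ, -j) (currentT p φ)
      + if p.1 = γ then (1 : ℂ) • psiStarT (γ, -(j - p.2)) φ else 0 := by
  obtain ⟨α, k⟩ := p
  split_ifs with h
  · obtain rfl : α = γ := h
    exact (isCurrent_currentT_dual α k).comm (isMultiCAR_psiT.component α).symm.neg j φ
  · have hk : (k : ℤ) ≠ 0 := by exact_mod_cast k.ne_zero
    have := LinearMap.congr_fun (transpose_commute (dualFock_comp_current α hk)
      (fun _ h => dualFock_comp h (psiStar_mem (γ, -j)))
      (commute_current_psiStar hk (i := (γ, -j)) (Ne.symm h))).eq φ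
    rw [add_zero]
    exact this

theorem isCurrent_neg_current (γ : Fin N) (k : ℕ+) :
    IsCurrent (fun j => psi (γ, -j)) (fun j => psiStar (γ, -j)) (-1) (k : ℤ)
      (-current γ (-(k : ℤ))) := by
  have h := (isCurrent_current γ (k := -(k : ℤ))
    (neg_ne_zero.2 (by exact_mod_cast k.ne_zero))).neg
  rw [neg_neg] at h
  exact h

theorem isCurrent_neg_current_dual (γ : Fin N) (k : ℕ+) :
    IsCurrent (fun j => psiStar (γ, j)) (fun j => psi (γ, j)) 1 (k : ℤ)
      (-current γ (-(k : ℤ))) := by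
  have h := (isCurrent_neg_current γ k).dual (isMultiCAR_psi.component γ).neg
    (by exact_mod_cast k.ne_zero)
  simp only [neg_neg] at h
  exact h

theorem neg_current_psi (p : TimeIdx N) (γ : Fin N) (j : ℤ) (x : Fock N) :
    (-current p.1 (-(p.2 : ℤ))) (psi (γ, -j) x) = psi (γ, -j) ((-current p.1 (-(p.2 : ℤ))) x)
      + if p.1 = γ then (-1 : ℂ) • psi (γ, -(j - p.2)) x else 0 := by
  obtain ⟨α, k⟩ := p
  split_ifs with h
  · obtain rfl : α = γ := h
    exact (isCurrent_neg_current α k).comm (isMultiCAR_psi.component α).neg j x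
  · have hk : -(k : ℤ) ≠ 0 := neg_ne_zero.2 (by exact_mod_cast k.ne_zero)
    rw [add_zero]
    exact LinearMap.congr_fun
      (commute_current_psi hk (i := (γ, -j)) (Ne.symm h)).neg_left.eq x

theorem neg_current_psiStar (p : TimeIdx N) (γ : Fin N) (j : ℤ) (x : Fock N) :
    (-current p.1 (-(p.2 : ℤ))) (psiStar (γ, j) x)
      = psiStar (γ, j) ((-current p.1 (-(p.2 : ℤ))) x)
        + if p.1 = γ then (1 : ℂ) • psiStar (γ, j - p.2) x else 0 := by
  obtain ⟨α, k⟩ := p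
  split_ifs with h
  · obtain rfl : α = γ := h
    exact (isCurrent_neg_current_dual α k).comm (isMultiCAR_psi.component α).symm j x
  · have hk : -(k : ℤ) ≠ 0 := neg_ne_zero.2 (by exact_mod_cast k.ne_zero)
    rw [add_zero]
    exact LinearMap.congr_fun
      (commute_current_psiStar hk (i := (γ, j)) (Ne.symm h)).neg_left.eq x

theorem ite_weight_eq_zero {E : Type*} [Zero E] (γ : Fin N) (p : TimeIdx N) (f : ℕ → E) :
    (if (if p.1 = γ then (p.2 : ℕ) else 0) = 0 then 0 else f (if p.1 = γ then (p.2 : ℕ) else 0))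
      = if p.1 = γ then f p.2 else 0 := by
  by_cases h : p.1 = γ
  · simp [h]
  · simp [h]

/-- Fermions on the left factor and the times `t_γ`. -/
theorem tensorCurrent_leftOp (γ : Fin N) (ε : ℂ) (P : ℤ → Module.End ℂ (dualFock N))
    (hP : ∀ (p : TimeIdx N) j φ, currentT p (P j φ) = P j (currentT p φ)
      + if p.1 = γ then ε • P (j - p.2) φ else 0) (v : TauVar N) (j : ℤ) (y : TensorFock N) :
    tensorCurrent v (leftOp (P j) y) = leftOp (P j) (tensorCurrent v y)
      + if wtT γ v = 0 then 0 else ε • leftOp (P (j - wtT γ v)) y := by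
  have key : tensorCurrent v ∘ₗ leftOp (P j) = leftOp (P j) ∘ₗ tensorCurrent v
      + if wtT γ v = 0 then 0 else ε • leftOp (P (j - wtT γ v)) := by
    refine tensorFock_ext fun φ x => ?_
    rcases v with p | p
    · have e : (if wtT γ (Sum.inl p) = 0 then 0
          else ε • leftOp (P (j - wtT γ (Sum.inl p))))
          = if p.1 = γ then ε • leftOp (P (j - p.2)) else 0 :=
        ite_weight_eq_zero γ p fun k : ℕ => ε • leftOp (P (j - k))
      rw [e, LinearMap.add_apply, LinearMap.comp_apply, LinearMap.comp_apply, leftOp_tmul,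
        tensorCurrent_inl, tensorCurrent_inl, leftOp_tmul, hP, map_add, LinearMap.add_apply]
      split_ifs
      · rw [map_smul]; rfl
      · rw [map_zero]; rfl
    · simp only [wtT, Sum.elim_inr, if_true, add_zero]
      rfl
  have := LinearMap.congr_fun key y
  rw [LinearMap.add_apply] at this
  refine this.trans ?_
  split_ifs <;> rfl

/-- Fermions on the right factor and the times `t̄_γ`. -/
theorem tensorCurrent_rightOp (γ : Fin N) (ε : ℂ) (P : ℤ → Module.End ℂ (Fock N))
    (hP : ∀ (p : TimeIdx N) j x, (-current p.1 (-(p.2 : ℤ))) (P j x)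
      = P j ((-current p.1 (-(p.2 : ℤ))) x)
      + if p.1 = γ then ε • P (j - p.2) x else 0) (v : TauVar N) (j : ℤ) (y : TensorFock N) :
    tensorCurrent v (rightOp (P j) y) = rightOp (P j) (tensorCurrent v y)
      + if wtTbar γ v = 0 then 0 else ε • rightOp (P (j - wtTbar γ v)) y := by
  have key : tensorCurrent v ∘ₗ rightOp (P j) = rightOp (P j) ∘ₗ tensorCurrent v
      + if wtTbar γ v = 0 then 0 else ε • rightOp (P (j - wtTbar γ v)) := by
    refine tensorFock_ext fun φ x => ?_
    rcases v with p | p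
    · simp only [wtTbar, Sum.elim_inl, if_true, add_zero]
      rfl
    · have e : (if wtTbar γ (Sum.inr p) = 0 then 0
          else ε • rightOp (P (j - wtTbar γ (Sum.inr p))))
          = if p.1 = γ then ε • rightOp (P (j - p.2)) else 0 :=
        ite_weight_eq_zero γ p fun k : ℕ => ε • rightOp (P (j - k))
      have h1 : ∀ φ (x : Fock N), tensorCurrent (Sum.inr p) (tmul φ x)
        = tmul φ ((-current p.1 (-(p.2 : ℤ))) x) := fun _ _ => rfl
      rw [e, LinearMap.add_apply, LinearMap.comp_apply, LinearMap.comp_apply, rightOp_tmul,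
        h1, h1, rightOp_tmul, hP, map_add]
      split_ifs
      · rw [map_smul]; rfl
      · rw [map_zero]; rfl
  have := LinearMap.congr_fun key y
  rw [LinearMap.add_apply] at this
  refine this.trans ?_
  split_ifs <;> rfl

theorem braState_aux (γ : Fin N) (s : Fin N → ℤ) :
    (∀ j, s γ ≤ j → psiT (γ, j) (braState s) = 0) ∧
    (∀ j, j < s γ → psiStarT (γ, j) (braState s) = 0) ∧
    psiT (γ, s γ - 1) (braState s) = tailSign γ s • braState (s - unitVec γ) ∧
    psiStarT (γ, s γ) (braState s) = tailSign γ s • braState (s + unitVec γ) :=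
  chargedState_aux isMultiCAR_psiT ⟨dualVac N, dualVac_mem⟩
    (fun i hi => Subtype.ext (LinearMap.ext fun x => dualVac_psi i hi x))
    (fun i hi => Subtype.ext (LinearMap.ext fun x => dualVac_psiStar i hi x)) γ s

theorem ket_aux (γ : Fin N) (s : Fin N → ℤ) :
    (∀ j, s γ ≤ j → psiStar (γ, j) (ket s) = 0) ∧
    (∀ j, j < s γ → psi (γ, j) (ket s) = 0) ∧
    psiStar (γ, s γ - 1) (ket s) = tailSign γ s • ket (s - unitVec γ) ∧
    psi (γ, s γ) (ket s) = tailSign γ s • ket (s + unitVec γ) :=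
  chargedState_aux isMultiCAR_psi.symm _ psiStar_vac psi_vac γ s

theorem tailSign_mul_self (γ : Fin N) (s : Fin N → ℤ) : tailSign γ s * tailSign γ s = 1 := by
  rw [tailSign, ← mul_zpow]; norm_num

/-- The leading modes are `ψ_{s_γ - 1}` on `⟨s|` and `ψ*_{s'_γ}` on `⟨s'|`. With the modes of `ψ*`
counted in reverse this means `a = s γ - 1` and `b = -s' γ`, whence the exponent `a + b - 1`. -/
theorem coeff_res_T {A : Mode N → Mode N → ℂ} (hA : WellDefined A) (γ : Fin N)
    (s s' r r' : Fin N → ℤ) (c c' : ℂ) (n : ℤ) (hn : n = s γ - s' γ - 2) (M M' : TauVar N →₀ ℕ) :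
    coeff (M.mapDomain Sum.inl + M'.mapDomain Sum.inr) (res (C (zPow n) * expXi γ *
        shifted Sum.inl (shiftT γ (-1)) (c • tauExp A (s - unitVec γ) r) *
        shifted Sum.inr (shiftT γ 1) (c' • tauExp A (s' + unitVec γ) r')))
      = c * tailSign γ s * (c' * tailSign γ s') * ∑ᶠ j : ℤ,
        gForm hA (leftOp (psiT (γ, j))
          (coeff M (expSeries (linSeries tensorCurrent)) (tmul (braState s) (ket r)))) *
        gForm hA (leftOp (psiStarT (γ, j))
          (coeff M' (expSeries (linSeries tensorCurrent)) (tmul (braState s') (ket r')))) := by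
  obtain ⟨b1, b2, b3, -⟩ := braState_aux γ s
  obtain ⟨d1, d2, -, d4⟩ := braState_aux γ s'
  have h := coeff_res_vertex (wtT γ) (fun k => Sum.inl (γ, k.toPNat'))
    (by
      rintro (p | p) hv
      · exact congrArg Sum.inl (toPNat_weight γ p hv)
      · exact absurd rfl hv)
    (fun j hj => by simp [wtT, Nat.toPNat'_coe, Nat.pos_of_ne_zero hj])
    (fun e c he => by simpa only [shiftT_eq] using (hasSubst_shift e he γ c).1)
    tensorCurrent commute_tensorCurrent (fun j => leftOp (psiT (γ, j)))
    (fun j => leftOp (psiStarT (γ, -j)))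
    (tensorCurrent_leftOp γ (-1) (fun j => psiT (γ, j)) fun p j φ => currentT_psiT p γ j φ)
    (tensorCurrent_leftOp γ 1 (fun j => psiStarT (γ, -j)) fun p j φ => currentT_psiStarT p γ j φ)
    ((c * tailSign γ s) • gForm hA) ((c' * tailSign γ s') • gForm hA) (s γ - 1) (-s' γ)
    (tmul (braState s) (ket r)) (tmul (braState s') (ket r'))
    (fun j hj => by rw [leftOp_tmul, b1 j (by omega), map_zero, LinearMap.zero_apply])
    (fun j hj => by rw [leftOp_tmul, d2 (-j) (by omega), map_zero, LinearMap.zero_apply])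
    (fun n => by
      have := (isMultiCAR_psiT.component γ).boson_rec (c := -1) (by norm_num)
        (fun k => currentT (γ, k.toPNat')) (fun k hk => by
          have := isCurrent_currentT γ k.toPNat'
          rwa [Nat.toPNat'_coe, if_pos (Nat.pos_of_ne_zero hk)] at this) (s γ - 1) (braState s)
        (fun j hj => b1 j (by omega)) (fun j hj => b2 j (by omega)) n
      simp only [leftOp_tmul, tensorCurrent_inl]
      have h2 := congrArg (fun φ => tmul φ (ket r)) this
      simpa only [map_smul, map_sum, LinearMap.smul_apply, LinearMap.sum_apply] using h2)
    (fun n => by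
      have := (isMultiCAR_psiT.component γ).symm.neg.boson_rec (c := 1) (by norm_num)
        (fun k => currentT (γ, k.toPNat')) (fun k hk => by
          have := isCurrent_currentT_dual γ k.toPNat'
          rwa [Nat.toPNat'_coe, if_pos (Nat.pos_of_ne_zero hk)] at this) (-s' γ) (braState s')
        (fun j hj => d2 (-j) (by omega)) (fun j hj => d1 (-j) (by omega)) n
      simp only [leftOp_tmul, tensorCurrent_inl]
      have h2 := congrArg (fun φ => tmul φ (ket r')) this
      simpa only [map_smul, map_sum, LinearMap.smul_apply, LinearMap.sum_apply] using h2)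
    M M'
  simp only [leftOp_tmul, neg_neg, b3, d4, map_smul, LinearMap.smul_apply] at h
  rw [matSeries_smul _ _ _ _ _ (tailSign_mul_self γ s),
    matSeries_smul _ _ _ _ _ (tailSign_mul_self γ s'), ← tauExp_eq, ← tauExp_eq,
    ← shiftT_eq, ← shiftT_eq, ← expXi_eq, show s γ - 1 + -s' γ - 1 = n by omega] at h
  refine h.trans ?_
  rw [← smul_eq_mul (_ * _), smul_finsum]
  refine finsum_congr fun j => ?_
  simp only [smul_eq_mul]
  ring

/-- The leading modes are `ψ_{r_γ}` on `|r⟩` and `ψ*_{r'_γ - 1}` on `|r'⟩`. Now the modes of `ψ` are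
counted in reverse, since `J_{-k}` raises their index. -/
theorem coeff_res_Tbar {A : Mode N → Mode N → ℂ} (hA : WellDefined A) (γ : Fin N)
    (s s' r r' : Fin N → ℤ) (c c' : ℂ) (n : ℤ) (hn : n = r' γ - r γ - 2) (M M' : TauVar N →₀ ℕ) :
    coeff (M.mapDomain Sum.inl + M'.mapDomain Sum.inr) (res (C (zPow n) * expXiBar γ *
        shifted Sum.inl (shiftTbar γ (-1)) (c • tauExp A s (r + unitVec γ)) *
        shifted Sum.inr (shiftTbar γ 1) (c' • tauExp A s' (r' - unitVec γ))))
      = c * tailSign γ r * (c' * tailSign γ r') * ∑ᶠ j : ℤ,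
        gForm hA (rightOp (psi (γ, j))
          (coeff M (expSeries (linSeries tensorCurrent)) (tmul (braState s) (ket r)))) *
        gForm hA (rightOp (psiStar (γ, j))
          (coeff M' (expSeries (linSeries tensorCurrent)) (tmul (braState s') (ket r')))) := by
  obtain ⟨b1, b2, -, b4⟩ := ket_aux γ r
  obtain ⟨d1, d2, d3, -⟩ := ket_aux γ r'
  have hcur : ∀ (p : TimeIdx N) φ (x : Fock N), tensorCurrent (Sum.inr p) (tmul φ x)
    = tmul φ ((-current p.1 (-(p.2 : ℤ))) x) := fun _ _ _ => rfl
  have h := coeff_res_vertex (wtTbar γ) (fun k => Sum.inr (γ, k.toPNat'))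
    (by
      rintro (p | p) hv
      · exact absurd rfl hv
      · exact congrArg Sum.inr (toPNat_weight γ p hv))
    (fun j hj => by simp [wtTbar, Nat.toPNat'_coe, Nat.pos_of_ne_zero hj])
    (fun e c he => by simpa only [shiftTbar_eq] using (hasSubst_shift e he γ c).2)
    tensorCurrent commute_tensorCurrent (fun j => rightOp (psi (γ, -j)))
    (fun j => rightOp (psiStar (γ, j)))
    (tensorCurrent_rightOp γ (-1) (fun j => psi (γ, -j)) fun p j x => neg_current_psi p γ j x)
    (tensorCurrent_rightOp γ 1 (fun j => psiStar (γ, j)) fun p j x => neg_current_psiStar p γ j x)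
    ((c * tailSign γ r) • gForm hA) ((c' * tailSign γ r') • gForm hA) (-r γ) (r' γ - 1)
    (tmul (braState s) (ket r)) (tmul (braState s') (ket r'))
    (fun j hj => by rw [rightOp_tmul, b2 (-j) (by omega), map_zero])
    (fun j hj => by rw [rightOp_tmul, d1 j (by omega), map_zero])
    (fun n => by
      have := (isMultiCAR_psi.component γ).neg.boson_rec (c := -1) (by norm_num)
        (fun k => -current γ (-((k.toPNat' : ℕ) : ℤ))) (fun k hk => by
          have := isCurrent_neg_current γ k.toPNat'
          have e : (k.toPNat' : ℕ) = k := by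
            rw [Nat.toPNat'_coe, if_pos (Nat.pos_of_ne_zero hk)]
          simp only [e] at this ⊢
          exact this) (-r γ) (ket r)
        (fun j hj => b2 (-j) (by omega)) (fun j hj => b1 (-j) (by omega)) n
      simp only [rightOp_tmul, hcur]
      have h2 := congrArg (fun x => tmul (braState s) x) this
      simpa only [map_smul, map_sum] using h2)
    (fun n => by
      have := (isMultiCAR_psi.component γ).symm.boson_rec (c := 1) (by norm_num)
        (fun k => -current γ (-((k.toPNat' : ℕ) : ℤ))) (fun k hk => by
          have := isCurrent_neg_current_dual γ k.toPNat'
          have e : (k.toPNat' : ℕ) = k := by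
            rw [Nat.toPNat'_coe, if_pos (Nat.pos_of_ne_zero hk)]
          simp only [e] at this ⊢
          exact this) (r' γ - 1) (ket r')
        (fun j hj => d1 j (by omega)) (fun j hj => d2 j (by omega)) n
      simp only [rightOp_tmul, hcur]
      have h2 := congrArg (fun x => tmul (braState s') x) this
      simpa only [map_smul, map_sum] using h2)
    M M'
  simp only [rightOp_tmul, neg_neg, b4, d3, map_smul, LinearMap.smul_apply] at h
  rw [matSeries_smul _ _ _ _ _ (tailSign_mul_self γ r),
    matSeries_smul _ _ _ _ _ (tailSign_mul_self γ r'), ← tauExp_eq, ← tauExp_eq,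
    ← shiftTbar_eq, ← shiftTbar_eq, ← expXiBar_eq, show -r γ + (r' γ - 1) - 1 = n by omega] at h
  refine h.trans ?_
  rw [← smul_eq_mul (_ * _), smul_finsum]
  refine finsum_eq_of_bijective (fun j => -j) neg_bijective fun j => ?_
  simp only [smul_eq_mul]
  ring

end Toda

/-! ### Signs -/

section Signs
variable {N : ℕ}

theorem neg_one_zpow_mul_self (n : ℤ) : (-1 : ℂ) ^ n * (-1) ^ n = 1 := by
  rw [← mul_zpow]; norm_num

theorem epsConst_mul_self (α γ : Fin N) : epsConst α γ * epsConst α γ = 1 := by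
  rw [epsConst]; split_ifs <;> norm_num

theorem eps_mul_self (α γ : Fin N) (s : Fin N → ℤ) : eps α γ s * eps α γ s = 1 := by
  rw [eps]
  split_ifs
  · exact neg_one_zpow_mul_self _
  · rw [neg_mul_neg]; exact neg_one_zpow_mul_self _

theorem sum_Ioi_split {α γ : Fin N} (h : α ≤ γ) (s : Fin N → ℤ) :
    ∑ μ ∈ Finset.Ioc α γ, s μ + ∑ μ ∈ Finset.Ioi γ, s μ = ∑ μ ∈ Finset.Ioi α, s μ := by
  rw [← Finset.sum_union]
  · refine Finset.sum_congr ?_ fun _ _ => rfl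
    ext μ
    simp only [Finset.mem_union, Finset.mem_Ioc, Finset.mem_Ioi]
    omega
  · rw [Finset.disjoint_left]
    intro μ h1 h2
    exact absurd (Finset.mem_Ioc.1 h1).2 (not_le.2 (Finset.mem_Ioi.1 h2))

/-- The tail signs at `α` and `γ` differ by the charges between the two components, which is what
`ε_{αγ}(s)` records. -/
theorem epsConst_mul_eps_mul_tailSign (α γ : Fin N) (s : Fin N → ℤ) :
    epsConst α γ * eps α γ s * tailSign γ s = tailSign α s := by
  have hne : (-1 : ℂ) ≠ 0 := by norm_num
  simp only [epsConst, eps, tailSign]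
  split_ifs with h
  · rw [← sum_Ioi_split h, zpow_add₀ hne, one_mul]
  · rw [← sum_Ioi_split (not_le.1 h).le, zpow_add₀ hne, neg_mul_neg, one_mul, ← mul_assoc,
      neg_one_zpow_mul_self, one_mul]

theorem sum_Ioi_unitVec (α γ : Fin N) :
    ∑ μ ∈ Finset.Ioi γ, unitVec α μ = if α ≤ γ then 0 else 1 := by
  simp only [unitVec, Pi.single_apply, Finset.sum_ite_eq', Finset.mem_Ioi, ← not_le]
  split_ifs <;> rfl

theorem tailSign_add_unitVec (α γ : Fin N) (s : Fin N → ℤ) :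
    tailSign γ (s + unitVec α) = epsConst α γ * tailSign γ s := by
  simp only [tailSign, Pi.add_apply, Finset.sum_add_distrib, sum_Ioi_unitVec, epsConst]
  split_ifs
  · rw [add_zero, one_mul]
  · rw [zpow_add_one₀ (by norm_num), mul_comm]

theorem tailSign_sub_unitVec (α γ : Fin N) (s : Fin N → ℤ) :
    tailSign γ (s - unitVec α) = epsConst α γ * tailSign γ s := by
  have h := tailSign_add_unitVec α γ (s - unitVec α)
  rw [sub_add_cancel] at h
  rw [h, ← mul_assoc, epsConst_mul_self, one_mul]

/-- The sign `(-1)^{n (n - 1) / 2}`. -/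
def chargeSign (n : ℤ) : ℂ := (-1) ^ (n * (n - 1) / 2)

theorem chargeSign_succ (n : ℤ) : chargeSign (n + 1) = chargeSign n * (-1) ^ n := by
  rw [chargeSign, chargeSign, ← zpow_add₀ (by norm_num),
    show (n + 1) * (n + 1 - 1) = n * (n - 1) + n * 2 by ring,
    Int.add_mul_ediv_right _ _ two_ne_zero]

/-- This minus sign is the one in front of the right side of the bilinear equation. -/
theorem chargeSign_pred (n : ℤ) : chargeSign (n - 1) = -chargeSign n * (-1) ^ n := by
  have h := chargeSign_succ (n - 1)
  rw [sub_add_cancel, zpow_sub_one₀ (by norm_num)] at h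
  rw [h, inv_neg_one]
  linear_combination (-chargeSign (n - 1)) * neg_one_zpow_mul_self n

theorem total_add_unitVec (s : Fin N → ℤ) (γ : Fin N) : total (s + unitVec γ) = total s + 1 := by
  simp [total, Finset.sum_add_distrib, unitVec]

theorem total_sub_unitVec (s : Fin N → ℤ) (γ : Fin N) : total (s - unitVec γ) = total s - 1 := by
  simp [total, Finset.sum_sub_distrib, unitVec]

theorem fermionTau_eq (A : Mode N → Mode N → ℂ) (α β : Fin N) (s : Fin N → ℤ) :
    fermionTau A α β s = chargeSign (total s) • tauExp A (s + unitVec α - unitVec β) s := rfl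

end Signs

/-! ### Proof of the integral bilinear equation -/

section Toda
open Finsupp MvPowerSeries
variable {N : ℕ}

/-- The fermionic bilinear identity between the evolved charged vacua. -/
theorem sum_bilinear {A : Mode N → Mode N → ℂ} (hA : WellDefined A) (φ φ' : dualFock N)
    (x y : Fock N) :
    ∑ γ : Fin N, ∑ᶠ j : ℤ, gForm hA (leftOp (psiT (γ, j)) (tmul φ x)) *
        gForm hA (leftOp (psiStarT (γ, j)) (tmul φ' y))
      = ∑ γ : Fin N, ∑ᶠ j : ℤ, gForm hA (rightOp (psi (γ, j)) (tmul φ x)) *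
        gForm hA (rightOp (psiStar (γ, j)) (tmul φ' y)) := by
  have f1 : Function.HasFiniteSupport fun i : Mode N =>
      gElem A (φ.1 ∘ₗ psi i) x * gElem A (φ'.1 ∘ₗ psiStar i) y := by
    refine ((finite_comp_psi φ.2).union (finite_comp_psiStar φ'.2)).subset fun i hi => ?_
    rcases le_or_gt 0 i.2 with h | h
    · exact Or.inl ⟨h, fun h0 => hi (by simp [h0, gElem])⟩
    · exact Or.inr ⟨h, fun h0 => hi (by simp [h0, gElem])⟩
  have f2 : Function.HasFiniteSupport fun i : Mode N =>
      gElem A φ.1 (psi i x) * gElem A φ'.1 (psiStar i y) := by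
    refine (psi_or_psiStar_finite x y).subset fun i hi => ⟨fun h0 => hi ?_, fun h0 => hi ?_⟩
    · simp [h0, gElem]
    · simp [h0, gElem]
  have h := bilinear_identity hA φ.2 φ'.2 x y
  rw [finsum_curry _ f1, finsum_curry _ f2, finsum_eq_sum_of_fintype,
    finsum_eq_sum_of_fintype] at h
  exact h

theorem exists_mapDomain (m : BilVar N →₀ ℕ) :
    ∃ M M' : TauVar N →₀ ℕ, m = M.mapDomain Sum.inl + M'.mapDomain Sum.inr := by
  refine ⟨m.comapDomain Sum.inl Sum.inl_injective.injOn,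
    m.comapDomain Sum.inr Sum.inr_injective.injOn, ?_⟩
  ext v
  rcases v with v | v
  · rw [Finsupp.add_apply, mapDomain_apply Sum.inl_injective, mapDomain_of_notMem_range _ _ (by simp),
      add_zero, comapDomain_apply]
  · rw [Finsupp.add_apply, mapDomain_apply Sum.inr_injective, mapDomain_of_notMem_range _ _ (by simp),
      zero_add, comapDomain_apply]

/-- Each coefficient of the `γ`-th term on either side is a sign times the component `γ` of the
fermionic identity, so it remains to see that the signs do not depend on `γ`. -/
theorem isTodaTau_fermionTau {A : Mode N → Mode N → ℂ} (hA : WellDefined A) :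
    IsTodaTau fun α β s => fermionTau A α β s := by
  intro α β s s'
  ext m
  obtain ⟨M, M', rfl⟩ := exists_mapDomain m
  simp only [map_neg, map_sum, map_smul, fermionTau_eq]
  -- The common factor: every sign depending on `γ` will occur squared.
  set K := chargeSign (total s) * chargeSign (total s') * tailSign α s * tailSign β s' with hK
  set x := coeff M (expSeries (linSeries tensorCurrent)) (tmul (braState (s + unitVec α)) (ket s))
    with hx
  set y := coeff M' (expSeries (linSeries tensorCurrent))
    (tmul (braState (s' - unitVec β)) (ket s')) with hy
  have hinv : ∀ β γ : Fin N, (eps β γ s')⁻¹ = eps β γ s' := fun β γ =>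
    inv_eq_of_mul_eq_one_left (eps_mul_self β γ s')
  have hsα : ∀ γ, tailSign γ s = epsConst α γ * eps α γ s * tailSign α s := fun γ => by
    rw [← epsConst_mul_eps_mul_tailSign α γ s]
    linear_combination (-tailSign γ s) * epsConst_mul_self α γ
      - epsConst α γ * epsConst α γ * tailSign γ s * eps_mul_self α γ s
  have hsβ : ∀ γ, tailSign γ s' = epsConst β γ * eps β γ s' * tailSign β s' := fun γ => by
    rw [← epsConst_mul_eps_mul_tailSign β γ s']
    linear_combination (-tailSign γ s') * epsConst_mul_self β γ
      - epsConst β γ * epsConst β γ * tailSign γ s' * eps_mul_self β γ s'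
  have hL : ∀ γ : Fin N, (eps α γ s * (eps β γ s')⁻¹) •
      coeff (M.mapDomain Sum.inl + M'.mapDomain Sum.inr)
        (res (C (zPow (s γ - s' γ + kron α γ + kron β γ - 2)) * expXi γ *
          shifted Sum.inl (shiftT γ (-1))
            (chargeSign (total s) • tauExp A (s + unitVec α - unitVec γ) s) *
          shifted Sum.inr (shiftT γ 1)
            (chargeSign (total s') • tauExp A (s' + unitVec γ - unitVec β) s')))
      = K * ∑ᶠ j : ℤ, gForm hA (leftOp (psiT (γ, j)) x) *
          gForm hA (leftOp (psiStarT (γ, j)) y) := by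
    intro γ
    rw [show s' + unitVec γ - unitVec β = s' - unitVec β + unitVec γ by abel,
      coeff_res_T hA γ (s + unitVec α) (s' - unitVec β) s s' _ _ _ ?_, hinv,
      tailSign_add_unitVec, tailSign_sub_unitVec, hsα, hsβ, smul_eq_mul, ← mul_assoc, hK]
    · congr 1
      have e1 := epsConst_mul_self α γ
      have e2 := epsConst_mul_self β γ
      have e3 := eps_mul_self α γ s
      have e4 := eps_mul_self β γ s'
      calc _ = chargeSign (total s) * chargeSign (total s') * tailSign α s * tailSign β s' *
          (epsConst α γ * epsConst α γ) * (epsConst β γ * epsConst β γ) *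
          (eps α γ s * eps α γ s) * (eps β γ s' * eps β γ s') := by ring
        _ = _ := by rw [e1, e2, e3, e4]; ring
    · simp only [Pi.add_apply, Pi.sub_apply, unitVec, Pi.single_apply, kron, eq_comm (a := γ)]
      ring
  have hR : ∀ γ : Fin N, (epsConst α γ * epsConst β γ * eps α γ s * epsTotal s *
            (eps β γ s')⁻¹ * (epsTotal s')⁻¹) •
      coeff (M.mapDomain Sum.inl + M'.mapDomain Sum.inr)
        (res (C (zPow (s' γ - s γ - 2)) * expXiBar γ *
          shifted Sum.inl (shiftTbar γ (-1)) (chargeSign (total (s + unitVec γ)) •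
            tauExp A (s + unitVec γ + unitVec α - unitVec γ) (s + unitVec γ)) *
          shifted Sum.inr (shiftTbar γ 1) (chargeSign (total (s' - unitVec γ)) •
            tauExp A (s' - unitVec γ + unitVec γ - unitVec β) (s' - unitVec γ))))
      = -(K * ∑ᶠ j : ℤ, gForm hA (rightOp (psi (γ, j)) x) *
          gForm hA (rightOp (psiStar (γ, j)) y)) := by
    intro γ
    have htot : (epsTotal s')⁻¹ = epsTotal s' :=
      inv_eq_of_mul_eq_one_left (neg_one_zpow_mul_self _)
    -- The shift of the argument by `[1]_γ` cancels in the bras, which therefore are the same for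
    -- all `γ`.
    rw [show s + unitVec γ + unitVec α - unitVec γ = s + unitVec α by abel,
      show s' - unitVec γ + unitVec γ - unitVec β = s' - unitVec β by abel,
      coeff_res_Tbar hA γ (s + unitVec α) (s' - unitVec β) s s' _ _ _ rfl, hinv, htot,
      total_add_unitVec, total_sub_unitVec, chargeSign_succ, chargeSign_pred, hsα, hsβ,
      smul_eq_mul, ← mul_assoc, hK, epsTotal, epsTotal, ← neg_mul]
    congr 1
    have e1 := epsConst_mul_self α γ
    have e2 := epsConst_mul_self β γ
    have e3 := eps_mul_self α γ s
    have e4 := eps_mul_self β γ s'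
    have e5 := neg_one_zpow_mul_self (total s)
    have e6 := neg_one_zpow_mul_self (total s')
    calc _ = -(chargeSign (total s) * chargeSign (total s') * tailSign α s * tailSign β s') *
        (epsConst α γ * epsConst α γ) * (epsConst β γ * epsConst β γ) *
        (eps α γ s * eps α γ s) * (eps β γ s' * eps β γ s') *
        ((-1 : ℂ) ^ total s * (-1) ^ total s) * ((-1) ^ total s' * (-1) ^ total s') := by ring
      _ = _ := by rw [e1, e2, e3, e4, e5, e6]; ring
  -- The evolved vectors are pure tensors, to which the fermionic identity applies.
  rw [Finset.sum_congr rfl fun γ _ => hL γ, Finset.sum_congr rfl fun γ _ => hR γ,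
    Finset.sum_neg_distrib, neg_neg, ← Finset.mul_sum, ← Finset.mul_sum, hx, hy,
    coeff_exp_tensorCurrent, coeff_exp_tensorCurrent, sum_bilinear hA]

end Toda

end MultiToda

end

theorem mainTheorem6 (N : ℕ) (A : MultiToda.Mode N → MultiToda.Mode N → ℂ)
    (hA : MultiToda.WellDefined A) :
    MultiToda.IsTodaTau (fun α β s => MultiToda.fermionTau A α β s) :=
  MultiToda.isTodaTau_fermionTau hA
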